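/- **Conventions.** A *weakly toric monoid* is (up to isomorphism) a finitely generated submonoid $P\subseteq\mathbb Z^N$ which is saturated in the subgroup $P^{\rm gp}\subseteq\mathbb Z^N$ it generates: if $p\in P^{\rm gp}$ and $mp\in P$ for some integer $m>0$, then $p\in P$. Put $\operatorname{rank}P=\operatorname{rank}P^{\rm gp}$. Let $X_P$ be the set of monoid morphisms $x:P\to([0,\infty),\cdot)$, write $\lambda_p(x)=x(p)$ for $p\in P$, give $X_P$ the weakest topology making all $\lambda_p$ continuous, and let $X_P^\circ$ be the set of $x$ with values in $(0,\infty)$. On an open $U\subseteq X_P$, a function $U\to\mathbb R$ is *smooth* if locally it has the form $g(\lambda_{r_1},\dots,\lambda_{r_m})$ with $r_i\in P$ and $g$ a $C^\infty$ function on an open subset of $\mathbb R^m$; a function $U\to[0,\infty)$ is *interior* if locally it has the form $\lambda_p\cdot h$ with $p\in P$ and $h>0$ smooth, and it is *smooth as a map to $[0,\infty)$* if near each point it is either interior or identically $0$. A continuous map $F$ between open subsets of $X_P$ and $X_Q$ is smooth if $\lambda_q\circ F$ is a smooth map to $[0,\infty)$ for every $q\in Q$; a diffeomorphism is a smooth bijection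 with smooth inverse. A *manifold with g-corners* of dimension $n$ is a Hausdorff, second countable space with a maximal atlas of charts $\phi:U\to Y$, homeomorphisms from open sets $U\subseteq X_P$ ($P$ weakly toric of rank $n$) onto open subsets of $Y$, whose transition maps are diffeomorphisms. Smooth functions $Y\to\mathbb R$, interior maps $Y\to[0,\infty)$, smooth maps of manifolds with g-corners and the interior $Y^\circ$ are defined through charts. The depth stratum $S^r(Y)$ is the set of points that correspond in charts to $u\in X_P$ such that $\{p\in P:u(p)\ne0\}$ has rank $n-r$. For $y\in Y$ let $C^\infty_y(Y)$ be the algebra of germs at $y$ of smooth functions, and $\mathcal I_y(Y)$ the multiplicative monoid of germs at $y$ of interior maps to $[0,\infty)$. The *b-tangent space* ${}^bT_yY$ is the vector space of pairs $(v,v')$, where $v:C^\infty_y(Y)\to\mathbb R$ is a derivation at $y$ and $v':\mathcal I_y(Y)\to(\mathbb R,+)$ is a monoid morphism, with $v'([\exp a])=v([a])$ for $[a]\in C^\infty_y(Y)$ and $v([b])=b(y)\,v'([b])$ for $[b]\in\mathcal I_y(Y)$; ${}^bT^*_yY$ is its dual. For smooth $h:Y\to\mathbb R$ let ${\rm d}h|_y\in{}^bT_y^*Y$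 be $(v,v')\mapsto v([h])$, and for interior $f:Y\to[0,\infty)$ let ${}^b{\rm d}f|_y\in{}^bT_y^*Y$ be $(v,v')\mapsto v'([f])$. For a multiplicative monoid $J$ of germs at $y$ let $J^\vee$ be the monoid of morphisms $J\to(\mathbb N,+)$ vanishing on the germs that are positive at $y$, and put $\tilde M_yY=\mathcal I_y(Y)^\vee$. For a smooth map $i:X\to Y$ of manifolds with g-corners and $x\in X$, $y=i(x)$, let $J_x=\{[c]\in\mathcal I_y(Y):[c\circ i]\in\mathcal I_x(X)\}$ (which is $\mathcal I_y(Y)$ if $i(X^\circ)\subseteq Y^\circ$), and let $\tilde M_xi:\tilde M_xX\to J_x^\vee$ be $\alpha\mapsto\bigl([c]\mapsto\alpha([c\circ i])\bigr)$. Then $i$ is an *immersion* if for every $x\in X$: (i) for $x\in S^r(X)$, the differential at $x$ of $i|_{S^r(X)}$ is injective on $T_xS^r(X)$; (ii) $\tilde M_xi$ is injective; (iii) the quotient monoid $J_x^\vee/\tilde M_xi(\tilde M_xX)$ (in which $p,p'$ are identified if $p+q=p'+q'$ for some $q,q'$ in the image) is torsion-free, that is, the group it generates is torsion-free. An *embedding*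 is an immersion that is a homeomorphism onto its image. **Corollary 4.17.** Let $Y$ be a manifold with g-corners, let $f_i,g_i:Y\to[0,\infty)$ be interior maps for $i=1,\dots,k$, and let $h_j:Y\to\mathbb R$ be smooth for $j=1,\dots,l$. Set $$X^\circ=\{y\in Y^\circ:\ f_i(y)=g_i(y)\ (i=1,\dots,k),\ h_j(y)=0\ (j=1,\dots,l)\},$$ and let $X=\overline{X^\circ}$ be the closure of $X^\circ$ in $Y$, with the subspace topology. Suppose that for every $x\in X$ the elements $${}^b{\rm d}f_1|_x-{}^b{\rm d}g_1|_x,\ \dots,\ {}^b{\rm d}f_k|_x-{}^b{\rm d}g_k|_x,\ {\rm d}h_1|_x,\ \dots,\ {\rm d}h_l|_x$$ are linearly independent in ${}^bT_x^*Y$. Then $k+l\le\dim Y$ if $X\neq\emptyset$, and, whenever $k+l\le\dim Y$, there is exactly one structure of a manifold with g-corners of dimension $\dim Y-k-l$ on $X$ for which the inclusion $X\hookrightarrow Y$ is an embedding. -/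

import Mathlib

open Filter Topology
open scoped NNReal ContDiff

noncomputable section

namespace GCorners

/-! ### Weakly toric monoids and the model spaces -/

/-- The rank of a submonoid `P` of `ℤᵏ`: the rank of the group it generates. -/
def monoidRank {k : ℕ} (P : AddSubmonoid (Fin k → ℤ)) : ℕ :=
  Module.finrank ℤ (AddSubgroup.closure (P : Set (Fin k → ℤ)))

/-- Weakly toric monoids, as submonoids of `ℤᵏ`: finitely generated and saturated in the group
they generate. (Integrality and torsion-freeness are automatic inside `ℤᵏ`.) -/
def IsWeaklyToric {k : ℕ} (P : AddSubmonoid (Fin k → ℤ)) : Prop :=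
  P.FG ∧ ∀ m : ℕ, 0 < m → ∀ p ∈ AddSubgroup.closure (P : Set (Fin k → ℤ)), m • p ∈ P → p ∈ P

/-- The model space `X_P` of monoid morphisms `P → ([0,∞), ·)`. -/
def ModelSpace {k : ℕ} (P : AddSubmonoid (Fin k → ℤ)) : Type := Multiplicative P →* ℝ≥0

namespace ModelSpace

variable {k : ℕ} {P : AddSubmonoid (Fin k → ℤ)}

/-- A point of `X_P` as a monoid morphism. -/
def toHom (x : ModelSpace P) : Multiplicative P →* ℝ≥0 := x

/-- The function `λ_p : X_P → [0,∞)`, `x ↦ x(p)`, regarded as real-valued. -/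
def lam (p : P) (x : ModelSpace P) : ℝ := (x.toHom (Multiplicative.ofAdd p) : ℝ≥0)

/-- The weakest topology for which every `λ_p` is continuous. -/
instance : TopologicalSpace (ModelSpace P) :=
  ⨅ p : P, TopologicalSpace.induced (lam p) inferInstance

/-- The interior of `X_P`: the morphisms with values in `(0,∞)`. -/
def interior (P : AddSubmonoid (Fin k → ℤ)) : Set (ModelSpace P) := {x | ∀ p, 0 < lam p x}

theorem lam_zero (x : ModelSpace P) : lam 0 x = 1 := by
  simp [lam]

theorem lam_add (p q : P) (x : ModelSpace P) : lam (p + q) x = lam p x * lam q x := by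
  simp [lam, ofAdd_add]

theorem lam_nonneg (p : P) (x : ModelSpace P) : 0 ≤ lam p x := NNReal.coe_nonneg _

theorem continuous_lam (p : P) : Continuous (lam p : ModelSpace P → ℝ) :=
  continuous_iff_le_induced.2 (iInf_le _ p)

/-- The support of a point `x` of `X_P`: the face of those `p ∈ P` with `x(p) ≠ 0`. -/
def supp (x : ModelSpace P) : AddSubmonoid (Fin k → ℤ) where
  carrier := {a | ∃ p : P, (p : Fin k → ℤ) = a ∧ lam p x ≠ 0}
  zero_mem' := ⟨0, rfl, by simp [lam_zero]⟩
  add_mem' := by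
    rintro _ _ ⟨p, rfl, hp⟩ ⟨q, rfl, hq⟩
    exact ⟨p + q, rfl, by rw [lam_add]; exact mul_ne_zero hp hq⟩

/-- A real function on `X_P` is smooth near `u` if near `u` it is `g(λ_{r₁}, …, λ_{r_m})` for some
`rᵢ ∈ P` and some smooth function `g` on an open subset of `ℝᵐ`. -/
def SmoothAt (f : ModelSpace P → ℝ) (u : ModelSpace P) : Prop :=
  ∃ (m : ℕ) (r : Fin m → P) (W : Set (Fin m → ℝ)) (g : (Fin m → ℝ) → ℝ),
    IsOpen W ∧ ContDiffOn ℝ ∞ g W ∧ (fun i => lam (r i) u) ∈ W ∧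
      ∀ᶠ x in 𝓝 u, f x = g fun i => lam (r i) x

/-- A function on `X_P` is, near `u`, an interior map to `[0,∞)` if near `u` it is `λ_p · h` with
`p ∈ P` and `h` smooth and positive. -/
def InteriorAt (f : ModelSpace P → ℝ) (u : ModelSpace P) : Prop :=
  ∃ (p : P) (h : ModelSpace P → ℝ), SmoothAt h u ∧ 0 < h u ∧ ∀ᶠ x in 𝓝 u, f x = lam p x * h x

/-- A function on `X_P` is, near `u`, a smooth map to `[0,∞)` if near `u` it is either interior or
identically zero. -/
def NonnegSmoothAt (f : ModelSpace P → ℝ) (u : ModelSpace P) : Prop :=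
  InteriorAt f u ∨ ∀ᶠ x in 𝓝 u, f x = 0

/-- A map `X_P → X_Q` is smooth near `u` if all `λ_q ∘ F` are smooth maps to `[0,∞)` near `u`. -/
def SmoothMapAt {l : ℕ} {Q : AddSubmonoid (Fin l → ℤ)} (F : ModelSpace P → ModelSpace Q)
    (u : ModelSpace P) : Prop :=
  ∀ q : Q, NonnegSmoothAt (fun x => lam q (F x)) u

theorem SmoothAt.congr {f f' : ModelSpace P → ℝ} {u : ModelSpace P} (hf : SmoothAt f u)
    (h : ∀ᶠ x in 𝓝 u, f' x = f x) : SmoothAt f' u := by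
  obtain ⟨m, r, W, g, hW, hg, hu, he⟩ := hf
  refine ⟨m, r, W, g, hW, hg, hu, ?_⟩
  filter_upwards [h, he] with x h1 h2
  rw [h1, h2]

theorem InteriorAt.congr {f f' : ModelSpace P → ℝ} {u : ModelSpace P} (hf : InteriorAt f u)
    (h : ∀ᶠ x in 𝓝 u, f' x = f x) : InteriorAt f' u := by
  obtain ⟨p, a, ha, hp, he⟩ := hf
  refine ⟨p, a, ha, hp, ?_⟩
  filter_upwards [h, he] with x h1 h2
  rw [h1, h2]

/-- Smooth functions of finitely many smooth functions are smooth. -/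
theorem SmoothAt.comp {m : ℕ} {f : Fin m → ModelSpace P → ℝ} {u : ModelSpace P}
    (hf : ∀ i, SmoothAt (f i) u) {W : Set (Fin m → ℝ)} {g : (Fin m → ℝ) → ℝ} (hW : IsOpen W)
    (hg : ContDiffOn ℝ ∞ g W) (hu : (fun i => f i u) ∈ W) :
    SmoothAt (fun x => g fun i => f i x) u := by
  choose n r V a hV ha hau he using hf
  let e : (Σ i, Fin (n i)) ≃ Fin (Fintype.card (Σ i, Fin (n i))) := Fintype.equivFin _
  let π : ∀ i, (Fin (Fintype.card (Σ i, Fin (n i))) → ℝ) → Fin (n i) → ℝ :=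
    fun i z j => z (e ⟨i, j⟩)
  have hπ : ∀ i, ContDiff ℝ ∞ (π i) := fun i => contDiff_pi.2 fun j => contDiff_apply ℝ ℝ _
  let A : (Fin (Fintype.card (Σ i, Fin (n i))) → ℝ) → Fin m → ℝ := fun z i => a i (π i z)
  let D : Set (Fin (Fintype.card (Σ i, Fin (n i))) → ℝ) := ⋂ i, π i ⁻¹' V i
  have hD : IsOpen D := isOpen_iInter_of_finite fun i => (hV i).preimage (hπ i).continuous
  have hA : ContDiffOn ℝ ∞ A D := contDiffOn_pi.2 fun i =>
    (ha i).comp (hπ i).contDiffOn fun z hz => Set.mem_iInter.1 hz i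
  let ρ : Fin (Fintype.card (Σ i, Fin (n i))) → P := fun t => r (e.symm t).1 (e.symm t).2
  have hρ : ∀ i x, π i (fun t => lam (ρ t) x) = fun j => lam (r i j) x := by
    intro i x
    funext j
    change lam (r (e.symm (e ⟨i, j⟩)).1 (e.symm (e ⟨i, j⟩)).2) x = _
    rw [e.symm_apply_apply]
  refine ⟨_, ρ, D ∩ A ⁻¹' W, g ∘ A, hA.continuousOn.isOpen_inter_preimage hD hW,
    hg.comp (hA.mono Set.inter_subset_left) (fun z hz => hz.2), ⟨?_, ?_⟩, ?_⟩
  · refine Set.mem_iInter.2 fun i => ?_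
    change π i (fun t => lam (ρ t) u) ∈ V i
    rw [hρ]
    exact hau i
  · have : A (fun t => lam (ρ t) u) = fun i => f i u := by
      funext i
      change a i (π i (fun t => lam (ρ t) u)) = _
      rw [hρ, (he i).self_of_nhds]
    change A (fun t => lam (ρ t) u) ∈ W
    rw [this]
    exact hu
  · filter_upwards [eventually_all.2 he] with x hx
    have : A (fun t => lam (ρ t) x) = fun i => f i x := by
      funext i
      change a i (π i (fun t => lam (ρ t) x)) = _
      rw [hρ, hx i]
    rw [Function.comp_apply, this]

theorem smoothAt_const (c : ℝ) (u : ModelSpace P) : SmoothAt (fun _ => c) u :=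
  ⟨0, Fin.elim0, Set.univ, fun _ => c, isOpen_univ, contDiffOn_const, trivial,
    Eventually.of_forall fun _ => rfl⟩

theorem smoothAt_lam (p : P) (u : ModelSpace P) : SmoothAt (lam p) u :=
  ⟨1, fun _ => p, Set.univ, fun z => z 0, isOpen_univ, (contDiff_apply ℝ ℝ 0).contDiffOn, trivial,
    Eventually.of_forall fun _ => rfl⟩

theorem SmoothAt.comp₁ {a : ModelSpace P → ℝ} {u : ModelSpace P} (ha : SmoothAt a u) {g : ℝ → ℝ}
    (hg : ContDiff ℝ ∞ g) : SmoothAt (fun x => g (a x)) u :=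
  SmoothAt.comp (m := 1) (f := fun _ => a) (fun _ => ha) (W := Set.univ) (g := fun z => g (z 0))
    isOpen_univ (hg.comp (contDiff_apply ℝ ℝ 0)).contDiffOn trivial

theorem SmoothAt.comp₂ {a b : ModelSpace P → ℝ} {u : ModelSpace P} (ha : SmoothAt a u)
    (hb : SmoothAt b u) {g : ℝ × ℝ → ℝ} (hg : ContDiff ℝ ∞ g) :
    SmoothAt (fun x => g (a x, b x)) u :=
  SmoothAt.comp (m := 2) (f := ![a, b]) (Fin.forall_fin_two.2 ⟨ha, hb⟩) (W := Set.univ)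
    (g := fun z => g (z 0, z 1)) isOpen_univ
    (hg.comp ((contDiff_apply ℝ ℝ 0).prodMk (contDiff_apply ℝ ℝ 1))).contDiffOn trivial

theorem SmoothAt.add {a b : ModelSpace P → ℝ} {u : ModelSpace P} (ha : SmoothAt a u)
    (hb : SmoothAt b u) : SmoothAt (fun x => a x + b x) u :=
  ha.comp₂ hb (contDiff_fst.add contDiff_snd)

theorem SmoothAt.mul {a b : ModelSpace P → ℝ} {u : ModelSpace P} (ha : SmoothAt a u)
    (hb : SmoothAt b u) : SmoothAt (fun x => a x * b x) u :=
  ha.comp₂ hb (contDiff_fst.mul contDiff_snd)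

theorem InteriorAt.smoothAt {f : ModelSpace P → ℝ} {u : ModelSpace P} (hf : InteriorAt f u) :
    SmoothAt f u := by
  obtain ⟨p, h, hh, -, he⟩ := hf
  exact ((smoothAt_lam p u).mul hh).congr he

theorem NonnegSmoothAt.smoothAt {f : ModelSpace P → ℝ} {u : ModelSpace P}
    (hf : NonnegSmoothAt f u) : SmoothAt f u := by
  rcases hf with hf | hf
  · exact hf.smoothAt
  · exact (smoothAt_const 0 u).congr hf

theorem interiorAt_of_pos {f : ModelSpace P → ℝ} {u : ModelSpace P} (hf : SmoothAt f u)
    (hu : 0 < f u) : InteriorAt f u :=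
  ⟨0, f, hf, hu, Eventually.of_forall fun x => by simp [lam_zero]⟩

theorem InteriorAt.mul {a b : ModelSpace P → ℝ} {u : ModelSpace P} (ha : InteriorAt a u)
    (hb : InteriorAt b u) : InteriorAt (fun x => a x * b x) u := by
  obtain ⟨p, h, hh, hp, he⟩ := ha
  obtain ⟨q, h', hh', hq, he'⟩ := hb
  refine ⟨p + q, _, hh.mul hh', mul_pos hp hq, ?_⟩
  filter_upwards [he, he'] with x h1 h2
  rw [h1, h2, lam_add]
  ring

end ModelSpace

open ModelSpace

/-! ### Manifolds with g-corners -/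

/-- An `n`-dimensional g-chart on `X`: a weakly toric monoid `P` of rank `n` and a homeomorphism
`φ` from an open subset of `X_P` to an open subset of `X`. -/
structure GChart (n : ℕ) (X : Type*) [TopologicalSpace X] where
  k : ℕ
  P : AddSubmonoid (Fin k → ℤ)
  weaklyToric : IsWeaklyToric P
  rank_eq : monoidRank P = n
  φ : OpenPartialHomeomorph (ModelSpace P) X

/-- Two g-charts are compatible if both transition maps between them are smooth. -/
def GChart.Compatible {n : ℕ} {X : Type*} [TopologicalSpace X] (c d : GChart n X) : Prop :=
  (∀ u ∈ c.φ.source, c.φ u ∈ d.φ.target → SmoothMapAt (fun x => d.φ.symm (c.φ x)) u) ∧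
  (∀ u ∈ d.φ.source, d.φ u ∈ c.φ.target → SmoothMapAt (fun x => c.φ.symm (d.φ x)) u)

/-- The structure of an `n`-dimensional manifold with g-corners on a topological space: the space
is Hausdorff and second countable, and carries a maximal g-atlas. -/
structure GCornersStructure (n : ℕ) (X : Type*) [TopologicalSpace X] where
  t2 : T2Space X
  secondCountable : SecondCountableTopology X
  charts : Set (GChart n X)
  compatible : ∀ c ∈ charts, ∀ d ∈ charts, c.Compatible d
  cover : ∀ x : X, ∃ c ∈ charts, x ∈ c.φ.target
  maximal : ∀ c : GChart n X, (∀ d ∈ charts, c.Compatible d) → c ∈ charts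

namespace GCornersStructure

variable {m n : ℕ} {X Y : Type*} [TopologicalSpace X] [TopologicalSpace Y]

/-- A real function is smooth near `x` if it is so in all charts around `x`. -/
def SmoothAt (S : GCornersStructure n X) (a : X → ℝ) (x : X) : Prop :=
  ∀ c ∈ S.charts, ∀ u ∈ c.φ.source, c.φ u = x → ModelSpace.SmoothAt (fun z => a (c.φ z)) u

/-- A function is, near `x`, an interior map to `[0,∞)` if it is so in all charts around `x`.
Such a function takes values in `[0,∞)` near `x`. -/
def InteriorAt (S : GCornersStructure n X) (b : X → ℝ) (x : X) : Prop :=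
  ∀ c ∈ S.charts, ∀ u ∈ c.φ.source, c.φ u = x → ModelSpace.InteriorAt (fun z => b (c.φ z)) u

/-- Smooth functions `X → ℝ`. -/
def IsSmooth (S : GCornersStructure n X) (a : X → ℝ) : Prop := ∀ x, S.SmoothAt a x

/-- Interior maps `X → [0,∞)`. -/
def IsInterior (S : GCornersStructure n X) (b : X → ℝ) : Prop := ∀ x, S.InteriorAt b x

/-- The interior `X°` of a manifold with g-corners. -/
def interior (S : GCornersStructure n X) : Set X :=
  {x | ∃ c ∈ S.charts, ∃ u ∈ c.φ.source, c.φ u = x ∧ u ∈ ModelSpace.interior c.P}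

/-- The depth stratum `Sᵏ(X)`: the points corresponding in charts to points of `X_P` whose support
is a face of `P` of corank `k`. -/
def stratum (S : GCornersStructure n X) (k : ℕ) : Set X :=
  {x | ∃ c ∈ S.charts, ∃ u ∈ c.φ.source, c.φ u = x ∧ monoidRank (supp u) + k = n}

/-- Smooth maps of manifolds with g-corners. -/
def IsSmoothMap (S : GCornersStructure m X) (T : GCornersStructure n Y) (f : X → Y) : Prop :=
  Continuous f ∧ ∀ c ∈ S.charts, ∀ d ∈ T.charts, ∀ u ∈ c.φ.source, f (c.φ u) ∈ d.φ.target →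
    SmoothMapAt (fun z => d.φ.symm (f (c.φ z))) u

section Functions

variable {S : GCornersStructure n X} {T : GCornersStructure m Y} {x : X} {a b : X → ℝ}

theorem eventually_chart {c : GChart n X} {u : ModelSpace c.P} (hu : u ∈ c.φ.source)
    {p : X → Prop} (h : ∀ᶠ z in 𝓝 (c.φ u), p z) : ∀ᶠ z in 𝓝 u, p (c.φ z) :=
  (c.φ.continuousAt hu).eventually h

theorem SmoothAt.congr (ha : S.SmoothAt a x) (h : ∀ᶠ z in 𝓝 x, b z = a z) : S.SmoothAt b x := by
  rintro c hc u hu rfl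
  exact (ha c hc u hu rfl).congr (eventually_chart hu h)

theorem InteriorAt.congr (ha : S.InteriorAt a x) (h : ∀ᶠ z in 𝓝 x, b z = a z) :
    S.InteriorAt b x := by
  rintro c hc u hu rfl
  exact (ha c hc u hu rfl).congr (eventually_chart hu h)

theorem InteriorAt.smoothAt (ha : S.InteriorAt a x) : S.SmoothAt a x :=
  fun c hc u hu h => (ha c hc u hu h).smoothAt

theorem SmoothAt.exp (ha : S.SmoothAt a x) : S.InteriorAt (fun z => Real.exp (a z)) x :=
  fun c hc u hu h =>
    interiorAt_of_pos ((ha c hc u hu h).comp₁ Real.contDiff_exp) (Real.exp_pos _)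

theorem SmoothAt.comp_map {f : X → Y} (hf : S.IsSmoothMap T f) {a : Y → ℝ}
    (ha : T.SmoothAt a (f x)) : S.SmoothAt (fun z => a (f z)) x := by
  rintro c hc u hu rfl
  obtain ⟨d, hd, hx⟩ := T.cover (f (c.φ u))
  have hev : ∀ᶠ z in 𝓝 u, f (c.φ z) ∈ d.φ.target :=
    eventually_chart hu (hf.1.continuousAt.eventually (d.φ.open_target.mem_nhds hx))
  obtain ⟨k, r, W, g, hW, hg, hmem, he⟩ :=
    ha d hd (d.φ.symm (f (c.φ u))) (d.φ.map_target hx) (d.φ.right_inv hx)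
  have hcont : ContinuousAt (fun z => d.φ.symm (f (c.φ z))) u :=
    (d.φ.continuousAt_symm hx).comp_of_eq
      (hf.1.continuousAt.comp_of_eq (c.φ.continuousAt hu) rfl) rfl
  refine (ModelSpace.SmoothAt.comp (f := fun i z => lam (r i) (d.φ.symm (f (c.φ z))))
    (fun i => (hf.2 c hc d hd u hu hx (r i)).smoothAt) hW hg hmem).congr ?_
  filter_upwards [hev, hcont.eventually he] with z h1 h2
  rw [← h2, d.φ.right_inv h1]

end Functions

/-! ### Germs, the b-tangent space, and strata -/

/-- The space `C^∞_x(X)` of germs at `x` of smooth functions. -/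
def smoothGerms (S : GCornersStructure n X) (x : X) : Submodule ℝ (Germ (𝓝 x) ℝ) where
  carrier := {a | ∃ f : X → ℝ, S.SmoothAt f x ∧ (f : Germ (𝓝 x) ℝ) = a}
  zero_mem' := ⟨fun _ => 0, fun _ _ u _ _ => smoothAt_const 0 u, rfl⟩
  add_mem' := by
    rintro _ _ ⟨f, hf, rfl⟩ ⟨g, hg, rfl⟩
    exact ⟨fun z => f z + g z, fun c hc u hu h => (hf c hc u hu h).add (hg c hc u hu h), rfl⟩
  smul_mem' := by
    rintro t _ ⟨f, hf, rfl⟩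
    exact ⟨fun z => t * f z,
      fun c hc u hu h => (smoothAt_const t u).mul (hf c hc u hu h), rfl⟩

theorem mul_mem_smoothGerms (S : GCornersStructure n X) (x : X) {a b : Germ (𝓝 x) ℝ}
    (ha : a ∈ S.smoothGerms x) (hb : b ∈ S.smoothGerms x) : a * b ∈ S.smoothGerms x := by
  obtain ⟨f, hf, rfl⟩ := ha
  obtain ⟨g, hg, rfl⟩ := hb
  exact ⟨fun z => f z * g z, fun c hc u hu h => (hf c hc u hu h).mul (hg c hc u hu h), rfl⟩

/-- The monoid `I_x(X)`, under multiplication, of germs at `x` of interior maps to `[0,∞)`. -/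
def interiorGerms (S : GCornersStructure n X) (x : X) : Submonoid (Germ (𝓝 x) ℝ) where
  carrier := {b | ∃ f : X → ℝ, S.InteriorAt f x ∧ (f : Germ (𝓝 x) ℝ) = b}
  one_mem' := ⟨fun _ => 1, fun _ _ u _ _ => interiorAt_of_pos (smoothAt_const 1 u) one_pos, rfl⟩
  mul_mem' := by
    rintro _ _ ⟨f, hf, rfl⟩ ⟨g, hg, rfl⟩
    exact ⟨fun z => f z * g z, fun c hc u hu h => (hf c hc u hu h).mul (hg c hc u hu h), rfl⟩

/-- The exponential map `C^∞_x(X) → I_x(X)`. -/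
def expGerm (S : GCornersStructure n X) (x : X) (a : S.smoothGerms x) : S.interiorGerms x :=
  ⟨(a : Germ (𝓝 x) ℝ).map Real.exp, by
    obtain ⟨_, f, hf, rfl⟩ := a
    exact ⟨_, hf.exp, rfl⟩⟩

/-- The inclusion `I_x(X) → C^∞_x(X)`. -/
def incGerm (S : GCornersStructure n X) (x : X) (b : S.interiorGerms x) : S.smoothGerms x :=
  ⟨b, by
    obtain ⟨_, f, hf, rfl⟩ := b
    exact ⟨f, hf.smoothAt, rfl⟩⟩

/-- A linear functional on `C^∞_x(X)` satisfying the Leibniz rule. -/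
def IsDerivation (S : GCornersStructure n X) (x : X) (v : S.smoothGerms x →ₗ[ℝ] ℝ) : Prop :=
  ∀ a b : S.smoothGerms x,
    v ⟨(a : Germ (𝓝 x) ℝ) * b, S.mul_mem_smoothGerms x a.2 b.2⟩ =
      v a * (b : Germ (𝓝 x) ℝ).value + (a : Germ (𝓝 x) ℝ).value * v b

/-- The b-tangent space `ᵇT_xX`: pairs `(v, v')` of a derivation `v` of `C^∞_x(X)` at `x` and a
monoid morphism `v'` from `(I_x(X), ·)` to `(ℝ, +)`, with `v' ∘ exp = v` and
`v [b] = b(x) v' [b]` for `[b] ∈ I_x(X)`. -/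
def bTangentSpace (S : GCornersStructure n X) (x : X) :
    Submodule ℝ ((S.smoothGerms x →ₗ[ℝ] ℝ) × (Additive (S.interiorGerms x) →+ ℝ)) where
  carrier := {w | S.IsDerivation x w.1 ∧
    (∀ a, w.2 (Additive.ofMul (S.expGerm x a)) = w.1 a) ∧
    ∀ b, w.1 (S.incGerm x b) = (b : Germ (𝓝 x) ℝ).value * w.2 (Additive.ofMul b)}
  zero_mem' := by simp [IsDerivation]
  add_mem' := by
    rintro w w' ⟨h1, h2, h3⟩ ⟨h1', h2', h3'⟩
    refine ⟨fun a b => ?_, fun a => ?_, fun b => ?_⟩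
    · simp only [Prod.fst_add, LinearMap.add_apply, h1 a b, h1' a b]
      ring
    · simp [h2, h2']
    · simp only [Prod.fst_add, LinearMap.add_apply, Prod.snd_add, AddMonoidHom.add_apply, h3, h3']
      ring
  smul_mem' := by
    rintro t w ⟨h1, h2, h3⟩
    refine ⟨fun a b => ?_, fun a => ?_, fun b => ?_⟩
    · simp only [Prod.smul_fst, LinearMap.smul_apply, h1 a b, smul_eq_mul]
      ring
    · simp [h2]
    · simp only [Prod.smul_fst, LinearMap.smul_apply, Prod.smul_snd, AddMonoidHom.smul_apply, h3,
        smul_eq_mul]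
      ring

/-- The b-cotangent space `ᵇT*_xX`. -/
abbrev BCotangentSpace (S : GCornersStructure n X) (x : X) : Type _ :=
  Module.Dual ℝ (S.bTangentSpace x)

/-- The differential `da|_x ∈ ᵇT*_xX` of a smooth function `a`: `(v, v') ↦ v [a]`. -/
def d (S : GCornersStructure n X) (a : X → ℝ) (ha : S.IsSmooth a) (x : X) :
    S.BCotangentSpace x where
  toFun w := w.1.1 ⟨(a : Germ (𝓝 x) ℝ), a, ha x, rfl⟩
  map_add' _ _ := rfl
  map_smul' _ _ := rfl

/-- The b-differential `ᵇdb|_x ∈ ᵇT*_xX` of an interior map `b` to `[0,∞)`: `(v, v') ↦ v' [b]`.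
In the interior this is `b⁻¹ db`, so `ᵇT[0,∞)` is trivialized by `t ∂/∂t`. -/
def bd (S : GCornersStructure n X) (b : X → ℝ) (hb : S.IsInterior b) (x : X) :
    S.BCotangentSpace x where
  toFun w := w.1.2 (Additive.ofMul ⟨(b : Germ (𝓝 x) ℝ), b, hb x, rfl⟩)
  map_add' _ _ := rfl
  map_smul' _ _ := rfl

/-- The tangent space `T_xSᵏ(X)` of a depth stratum at a point `x` of it: the derivations of
`C^∞_x(X)` at `x` that only depend on the restriction of functions to `Sᵏ(X)`. -/
def stratumTangentSpace (S : GCornersStructure n X) (k : ℕ) (x : X) :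
    Submodule ℝ (S.smoothGerms x →ₗ[ℝ] ℝ) where
  carrier := {v | S.IsDerivation x v ∧ ∀ (a : X → ℝ) (ha : S.SmoothAt a x),
    (∀ᶠ z in 𝓝 x, z ∈ S.stratum k → a z = 0) → v ⟨(a : Germ (𝓝 x) ℝ), a, ha, rfl⟩ = 0}
  zero_mem' := by simp [IsDerivation]
  add_mem' := by
    rintro v v' ⟨h1, h2⟩ ⟨h1', h2'⟩
    refine ⟨fun a b => ?_, fun a ha h => ?_⟩
    · simp only [LinearMap.add_apply, h1 a b, h1' a b]
      ring
    · simp [h2 a ha h, h2' a ha h]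
  smul_mem' := by
    rintro t v ⟨h1, h2⟩
    refine ⟨fun a b => ?_, fun a ha h => ?_⟩
    · simp only [LinearMap.smul_apply, h1 a b, smul_eq_mul]
      ring
    · simp [h2 a ha h]

/-! ### Pullback of germs, the monoids `M̃_xX`, immersions and embeddings -/

/-- Pullback of germs of functions by a map continuous at `x`. -/
def germPullback (f : X → Y) (x : X) (hf : ContinuousAt f x) :
    Germ (𝓝 (f x)) ℝ →* Germ (𝓝 x) ℝ where
  toFun a := a.compTendsto f hf
  map_one' := rfl
  map_mul' a b := by
    induction a, b using Germ.inductionOn₂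
    rfl

/-- Pullback `f^* : C^∞_{f(x)}(Y) → C^∞_x(X)` by a smooth map. -/
def smoothPullback (S : GCornersStructure m X) (T : GCornersStructure n Y) (f : X → Y)
    (hf : S.IsSmoothMap T f) (x : X) : T.smoothGerms (f x) →ₗ[ℝ] S.smoothGerms x where
  toFun a := ⟨germPullback f x hf.1.continuousAt a, by
    obtain ⟨_, a, ha, rfl⟩ := a
    exact ⟨_, ha.comp_map hf, rfl⟩⟩
  map_add' := by
    rintro ⟨_, a, ha, rfl⟩ ⟨_, b, hb, rfl⟩
    rfl
  map_smul' := by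
    rintro t ⟨_, a, ha, rfl⟩
    rfl

/-- For a submonoid `J` of germs at `x`: the additive monoid of morphisms `(J, ·) → (ℕ, +)` that
vanish on the germs which are positive at `x`. -/
def dualMonoid {x : X} (J : Submonoid (Germ (𝓝 x) ℝ)) : AddSubmonoid (Additive J →+ ℕ) where
  carrier := {α | ∀ b : J, 0 < (b : Germ (𝓝 x) ℝ).value → α (Additive.ofMul b) = 0}
  zero_mem' := by simp
  add_mem' := by
    intro α β hα hβ b hb
    simp [hα b hb, hβ b hb]

/-- The monoid `M̃_xX`. -/
abbrev MTilde (S : GCornersStructure n X) (x : X) : AddSubmonoid (Additive (S.interiorGerms x) →+ ℕ) :=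
  dualMonoid (S.interiorGerms x)

/-- The germs `[c] ∈ I_{f(x)}(Y)` with `[c ∘ f] ∈ I_x(X)`. If `f` is interior these are all of
`I_{f(x)}(Y)`. In general they are the germs of interior maps at the corner of `Y` into which `f`
maps the interior of `X` near `x`. -/
def pulledGerms (S : GCornersStructure m X) (T : GCornersStructure n Y) (f : X → Y)
    (hf : Continuous f) (x : X) : Submonoid (Germ (𝓝 (f x)) ℝ) :=
  T.interiorGerms (f x) ⊓ (S.interiorGerms x).comap (germPullback f x hf.continuousAt)

/-- The pullback `[c] ↦ [c ∘ f]` from the germs in `pulledGerms` to `I_x(X)`. -/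
def interiorPullback (S : GCornersStructure m X) (T : GCornersStructure n Y) (f : X → Y)
    (hf : Continuous f) (x : X) : S.pulledGerms T f hf x →* S.interiorGerms x where
  toFun c := ⟨germPullback f x hf.continuousAt c, c.2.2⟩
  map_one' := Subtype.ext (map_one _)
  map_mul' _ _ := Subtype.ext (map_mul _ _ _)

/-- The monoid morphism `M̃_xf : α ↦ α ∘ f^*`. For interior `f` its target is `M̃_{f(x)}Y`, and in
general it is the monoid `M̃` at `C(f)(x)` of the manifold of corners `C(Y)`. -/
def mTildeMap (S : GCornersStructure m X) (T : GCornersStructure n Y) (f : X → Y)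
    (hf : Continuous f) (x : X) : S.MTilde x →+ dualMonoid (S.pulledGerms T f hf x) where
  toFun α := ⟨α.1.comp (S.interiorPullback T f hf x).toAdditive, fun c hc => α.2 _ (by
    obtain ⟨_, ⟨c, hc', rfl⟩, h⟩ := c
    exact hc)⟩
  map_zero' := rfl
  map_add' _ _ := rfl

/-- The congruence defining the quotient monoid `M / N`: `p ∼ p'` iff `p + q = p' + q'` for some
`q, q' ∈ N`. -/
def quotientCon {M : Type*} [AddCommMonoid M] (N : AddSubmonoid M) : AddCon M where
  r p p' := ∃ q ∈ N, ∃ q' ∈ N, p + q = p' + q'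
  iseqv :=
    { refl := fun _ => ⟨0, N.zero_mem, 0, N.zero_mem, rfl⟩
      symm := fun ⟨q, hq, q', hq', h⟩ => ⟨q', hq', q, hq, h.symm⟩
      trans := by
        rintro a b c ⟨q, hq, q', hq', h⟩ ⟨r, hr, r', hr', h'⟩
        refine ⟨q + r, N.add_mem hq hr, r' + q', N.add_mem hr' hq', ?_⟩
        rw [← add_assoc, h, add_right_comm, h', add_assoc] }
  add' := by
    rintro a b c d ⟨q, hq, q', hq', h⟩ ⟨r, hr, r', hr', h'⟩
    refine ⟨q + r, N.add_mem hq hr, q' + r', N.add_mem hq' hr', ?_⟩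
    rw [add_add_add_comm, h, h', add_add_add_comm]

/-- A commutative monoid is torsion-free if the group it generates is. -/
def IsTorsionFreeMonoid (M : Type*) [AddCommMonoid M] : Prop :=
  IsAddTorsionFree (Algebra.GrothendieckAddGroup M)

/-- Immersions of manifolds with g-corners: smooth maps `f` such that for all `x`
(i) if `x ∈ Sᵏ(X)` then `d(f|_{Sᵏ(X)})|_x` is injective; (ii) `M̃_xf` is injective; and
(iii) the quotient of the target of `M̃_xf` by its image is torsion-free. -/
def IsImmersion (S : GCornersStructure m X) (T : GCornersStructure n Y) (f : X → Y) : Prop :=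
  ∃ hf : S.IsSmoothMap T f, ∀ x : X,
    (∀ k, x ∈ S.stratum k → Set.InjOn
      (fun v : S.smoothGerms x →ₗ[ℝ] ℝ => v.comp (S.smoothPullback T f hf x))
      (S.stratumTangentSpace k x)) ∧
    Function.Injective (S.mTildeMap T f hf.1 x) ∧
    IsTorsionFreeMonoid (quotientCon (AddMonoidHom.mrange (S.mTildeMap T f hf.1 x))).Quotient

/-- Embeddings: immersions that are homeomorphisms onto their image. -/
def IsEmbedding (S : GCornersStructure m X) (T : GCornersStructure n Y) (f : X → Y) : Prop :=
  S.IsImmersion T f ∧ Topology.IsEmbedding f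

end GCornersStructure

/-- For interior maps `f i, g i : Y → [0,∞)` and functions `h j : Y → ℝ`: the set `X°` of solutions
of `f i = g i`, `h j = 0` in the interior of `Y`. -/
def solutionSet {n k l : ℕ} {Y : Type*} [TopologicalSpace Y] (S : GCornersStructure n Y)
    (f g : Fin k → Y → ℝ) (h : Fin l → Y → ℝ) : Set Y :=
  {y | y ∈ S.interior ∧ (∀ i, f i y = g i y) ∧ ∀ j, h j y = 0}

end GCorners

end

noncomputable section

namespace GCorners

/-! ### Finitely generated monoids of lattice points -/

/-! In a chart `X_Q` at a point `u`, every interior map is `λ_q · exp C` with `C` smooth. On the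
interior the equation `f_i = g_i` therefore reads `log x (d_i) + C_i(λ_r x) = 0`, with `d_i` in the
group `Q^gp`. A b-tangent vector at `u` yields a functional in `Hom(Q^gp, ℝ)`, so the independence
hypothesis gives independence of `k + l` linear forms on this `n`-dimensional space. The bound `k +
l ≤ n` follows at once.

At a boundary point part of `log x` is infinite, so the implicit function theorem cannot be applied
to `log x` itself; it is applied to a bounded part. Let `K ⊆ Q^gp` consist of the vectors
annihilated by every functional that kills the `d_i` and the elements of `Q` nonzero at `u` (the
units). On solutions near `u` the values of `log x` on `K` stay bounded, hence everything unbounded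
factors through the free group `Q^gp / K`. Splitting this quotient off by a map `ψ`, the correction
`κ = log x - log x ∘ lift ∘ ψ` extends continuously to the closure and solves a nondegenerate smooth
system of `n` equations: the `k + l` given ones and `m` normalizations (`exists_adaptedFrame`,
`exists_correction`). The model of the closure is `X_P`, where `P` is the saturation of `ψ(Q)` plus
a free group of unit directions. One direction of the parametrization is `λ_q = λ_{ψ q} · exp κ(q)`
with `κ` an implicit function on `X_P`; the other is monomial in ambient coordinates
(`exists_retraction`, `exists_local_parametrization`).

These charts have two properties: ambient interior maps pull back to interior maps, and each `λ_p`
is locally a quotient of such pullbacks. The decisive lemma is `interiorAt_of_logHom`: a continuous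
function equal to `λ_e · exp c` on the interior, with `e` merely in the group of `P`, is interior.
Otherwise Farkas' lemma supplies a curve into the boundary point along which `λ_e` blows up. So such
a quotient is interior in every chart that pulls interior maps back, the charts are compatible, and
they define a structure. The quotient description also yields the three immersion conditions
(`isImmersion_of_charts`).

For uniqueness, take any structure whose inclusion `F` is an embedding. In charts, `log F(z) = log z
∘ φ + C_z` with `φ` a map of lattices and `C_z` smooth. Injectivity and torsion-freeness on `M̃`
make `φ` surjective modulo units (`IsImmersion.exists_sub_mem_faceGroup`); with a section `ψ` modulo
units, `κ = log z - log F(z) ∘ ψ` is smooth and `λ_p · exp(-κ(p))` is an ambient quotient. The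
condition on strata makes a system of equations for `κ` have injective derivative, so `κ` is a
smooth function of ambient data. Thus every chart is admissible (`IsImmersion.isAdmissible`), and
two maximal atlases of admissible charts coincide (`eq_of_isAdmissible`). -/

/-- Farkas' lemma over an ordered field. -/
theorem mem_cone_or_exists_separating {𝕜 V : Type*} [Field 𝕜] [LinearOrder 𝕜]
    [IsStrictOrderedRing 𝕜] [AddCommGroup V] [Module 𝕜 V] {N : ℕ} (v : Fin N → V) (b : V) :
    (∃ c : Fin N → 𝕜, (∀ i, 0 ≤ c i) ∧ b = ∑ i, c i • v i) ∨
      ∃ α : V →ₗ[𝕜] 𝕜, (∀ i, 0 ≤ α (v i)) ∧ α b < 0 := by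
  induction N generalizing b with
  | zero =>
    by_cases hb : b = 0
    · exact Or.inl ⟨Fin.elim0, fun i => i.elim0, by simp [hb]⟩
    · right
      obtain ⟨α, hα⟩ : ∃ α : Module.Dual 𝕜 V, α b ≠ 0 := by
        by_contra! h
        exact hb ((Module.forall_dual_apply_eq_zero_iff 𝕜 b).1 h)
      rcases lt_or_gt_of_ne hα with h | h
      · exact ⟨α, fun i => i.elim0, h⟩
      · exact ⟨-α, fun i => i.elim0, by simpa using h⟩
  | succ N ih =>
    rcases ih (fun i => v i.succ) b with ⟨c, hc, hb⟩ | ⟨α, hα, hb⟩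
    · left
      refine ⟨Fin.cons 0 c, fun i => ?_, by simp [Fin.sum_univ_succ, hb]⟩
      refine Fin.cases ?_ (fun j => ?_) i
      · simp
      · simpa using hc j
    by_cases h0 : 0 ≤ α (v 0)
    · exact Or.inr ⟨α, fun i => Fin.cases h0 hα i, hb⟩
    push Not at h0
    -- Only `v 0` lies on the negative side of `α`, as does `b`. Here `π` is the projection onto
    -- `ker α` along `v 0`, and the induction hypothesis is applied to the projected vectors.
    let π : V →ₗ[𝕜] V := LinearMap.id - ((α (v 0))⁻¹ • α).smulRight (v 0)
    have hπ : ∀ x, π x = x - ((α (v 0))⁻¹ * α x) • v 0 := fun x => by simp [π]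
    rcases ih (fun i => π (v i.succ)) (π b) with ⟨c, hc, hc'⟩ | ⟨β, hβ, hβb⟩
    · left
      -- The coefficient of `v 0` collects what the projections removed; it is nonnegative because
      -- `α b < 0`, `α (v 0) < 0` and the other `α (v i)` are nonnegative.
      refine ⟨Fin.cons ((α (v 0))⁻¹ * α b - ∑ i, c i * ((α (v 0))⁻¹ * α (v i.succ))) c,
        fun i => ?_, ?_⟩
      · refine Fin.cases ?_ (fun j => ?_) i
        · have h1 : 0 ≤ (α (v 0))⁻¹ * α b :=
            mul_nonneg_of_nonpos_of_nonpos (inv_nonpos.2 h0.le) hb.le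
          have h2 : ∑ i, c i * ((α (v 0))⁻¹ * α (v i.succ)) ≤ 0 :=
            Finset.sum_nonpos fun i _ => mul_nonpos_of_nonneg_of_nonpos (hc i)
              (mul_nonpos_of_nonpos_of_nonneg (inv_nonpos.2 h0.le) (hα i))
          simp only [Fin.cons_zero]
          linarith
        · simpa using hc j
      · have h3 : b = π b + ((α (v 0))⁻¹ * α b) • v 0 := by rw [hπ]; abel
        rw [Fin.sum_univ_succ]
        simp only [Fin.cons_zero, Fin.cons_succ]
        refine h3.trans ?_
        rw [hc']
        simp only [hπ, smul_sub, Finset.sum_sub_distrib, sub_smul, Finset.sum_smul, smul_smul]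
        abel
    · right
      refine ⟨β.comp π, fun i => ?_, hβb⟩
      refine Fin.cases ?_ (fun j => hβ j) i
      have : π (v 0) = 0 := by rw [hπ, inv_mul_cancel₀ h0.ne, one_smul, sub_self]
      simp [this]

theorem exists_common_denominator {N : ℕ} (c : Fin N → ℚ) :
    ∃ n : ℕ, 0 < n ∧ ∃ a : Fin N → ℤ, ∀ i, (n : ℚ) * c i = a i := by
  refine ⟨∏ i, (c i).den, Finset.prod_pos fun i _ => (c i).den_pos, ?_⟩
  have : ∀ i, ∃ a : ℤ, ((∏ j, (c j).den : ℕ) : ℚ) * c i = a := by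
    intro i
    obtain ⟨t, ht⟩ := Finset.dvd_prod_of_mem (fun j => (c j).den) (Finset.mem_univ i)
    refine ⟨t * (c i).num, ?_⟩
    have h := Rat.den_mul_eq_num (c i)
    rw [ht]
    push_cast
    rw [← h]
    ring
  choose a ha using this
  exact ⟨a, ha⟩

section

variable {k : ℕ} {P F : AddSubmonoid (Fin k → ℤ)}

theorem exists_generators {A : Type*} [AddCommMonoid A] {P : AddSubmonoid A} (hP : P.FG) :
    ∃ (N : ℕ) (r : Fin N → A), P = AddSubmonoid.closure (Set.range r) := by
  obtain ⟨s, rfl⟩ := hP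
  refine ⟨s.card, fun i => (s.equivFin.symm i : A), ?_⟩
  congr 1
  ext x
  constructor
  · intro hx
    exact ⟨s.equivFin ⟨x, hx⟩, by simp⟩
  · rintro ⟨i, rfl⟩
    exact (s.equivFin.symm i).2

/-- Farkas' lemma over `ℚ`, with denominators cleared on either side: in the coefficients of the
conic combination, or in the separating functional. -/
theorem mem_or_exists_separating (hP : P.FG) (e : Fin k → ℤ) :
    (∃ n : ℕ, 0 < n ∧ n • e ∈ P) ∨ ∃ α : (Fin k → ℤ) →+ ℤ, (∀ p ∈ P, 0 ≤ α p) ∧ α e < 0 := by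
  obtain ⟨N, r, rfl⟩ := exists_generators hP
  let ι : (Fin k → ℤ) →+ (Fin k → ℚ) :=
    { toFun := fun x i => x i, map_zero' := by ext; simp, map_add' := by intros; ext; simp }
  have hι : ∀ x i, ι x i = x i := fun _ _ => rfl
  rcases mem_cone_or_exists_separating (𝕜 := ℚ) (fun i => ι (r i)) (ι e) with
    ⟨c, hc, he⟩ | ⟨α, hα, he⟩
  · left
    obtain ⟨n, hn, a, ha⟩ := exists_common_denominator c
    have ha0 : ∀ i, 0 ≤ a i := fun i => by
      have : (0 : ℚ) ≤ a i := by rw [← ha]; exact mul_nonneg (Nat.cast_nonneg _) (hc i)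
      exact_mod_cast this
    refine ⟨n, hn, ?_⟩
    have : n • e = ∑ i, (a i).toNat • r i := by
      ext j
      have h := congrFun he j
      simp only [Finset.sum_apply, Pi.smul_apply, hι, smul_eq_mul] at h
      have h2 : ((n * e j : ℤ) : ℚ) = ((∑ i, a i * r i j : ℤ) : ℚ) := by
        push_cast
        rw [h, Finset.mul_sum]
        exact Finset.sum_congr rfl fun i _ => by rw [← ha]; ring
      have h3 : (n * e j : ℤ) = ∑ i, a i * r i j := by exact_mod_cast h2
      simp only [Pi.smul_apply, nsmul_eq_mul, Finset.sum_apply]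
      rw [h3]
      refine Finset.sum_congr rfl fun i _ => ?_
      conv_lhs => rw [← Int.toNat_of_nonneg (ha0 i)]
      simp
    rw [this]
    exact sum_mem fun i _ => nsmul_mem (AddSubmonoid.subset_closure (Set.mem_range_self i)) _
  · right
    obtain ⟨n, hn, a, ha⟩ := exists_common_denominator fun j => α (Pi.single j 1)
    let β : (Fin k → ℤ) →+ ℤ :=
      { toFun := fun x => ∑ j, x j * a j
        map_zero' := by simp
        map_add' := fun x y => by simp [add_mul, Finset.sum_add_distrib] }
    have hβ : ∀ x, ((β x : ℤ) : ℚ) = n * α (ι x) := by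
      intro x
      have : ι x = ∑ j, (x j : ℚ) • (Pi.single j (1 : ℚ) : Fin k → ℚ) := by
        ext i
        simp [hι, Finset.sum_apply, Pi.single_apply]
      change ((∑ j, x j * a j : ℤ) : ℚ) = _
      rw [this, map_sum, Finset.mul_sum]
      push_cast
      refine Finset.sum_congr rfl fun j _ => ?_
      rw [map_smul, smul_eq_mul, ← ha]
      ring
    have hn' : (0 : ℚ) < n := by exact_mod_cast hn
    refine ⟨β, fun p hp => ?_, ?_⟩
    · induction hp using AddSubmonoid.closure_induction with
      | mem x hx =>
        obtain ⟨i, rfl⟩ := hx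
        have : (0 : ℚ) ≤ β (r i) := by rw [hβ]; exact mul_nonneg hn'.le (hα i)
        exact_mod_cast this
      | zero => simp
      | add x y _ _ hx hy => rw [map_add]; exact add_nonneg hx hy
    · have : ((β e : ℤ) : ℚ) < 0 := by rw [hβ]; exact mul_neg_of_pos_of_neg hn' he
      exact_mod_cast this

theorem mem_addSubgroupClosure_iff {A : Type*} [AddCommGroup A] {P : AddSubmonoid A} {x : A} :
    x ∈ AddSubgroup.closure (P : Set A) ↔ ∃ a ∈ P, ∃ b ∈ P, x = a - b := by
  constructor
  · intro hx
    induction hx using AddSubgroup.closure_induction with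
    | mem x hx => exact ⟨x, hx, 0, P.zero_mem, by simp⟩
    | zero => exact ⟨0, P.zero_mem, 0, P.zero_mem, by simp⟩
    | add x y _ _ hx hy =>
      obtain ⟨a, ha, b, hb, rfl⟩ := hx
      obtain ⟨a', ha', b', hb', rfl⟩ := hy
      exact ⟨a + a', P.add_mem ha ha', b + b', P.add_mem hb hb', by abel⟩
    | neg x _ hx =>
      obtain ⟨a, ha, b, hb, rfl⟩ := hx
      exact ⟨b, hb, a, ha, by abel⟩
  · rintro ⟨a, ha, b, hb, rfl⟩
    exact sub_mem (AddSubgroup.subset_closure ha) (AddSubgroup.subset_closure hb)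

/-- A morphism from a submonoid of an abelian group to an abelian group extends to the group
generated by the submonoid. -/
theorem exists_extension_closure {A B : Type*} [AddCommGroup A] [AddCommGroup B]
    {P : AddSubmonoid A} (f : P →+ B) :
    ∃ g : AddSubgroup.closure (P : Set A) →+ B,
      ∀ p : P, g ⟨p, AddSubgroup.subset_closure p.2⟩ = f p := by
  have hex : ∀ x : AddSubgroup.closure (P : Set A), ∃ a b : P, (x : A) = a - b := fun x => by
    obtain ⟨a, ha, b, hb, h⟩ := mem_addSubgroupClosure_iff.1 x.2
    exact ⟨⟨a, ha⟩, ⟨b, hb⟩, h⟩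
  choose a b hab using hex
  have key : ∀ c d c' d' : P, (c : A) - d = c' - d' → f c - f d = f c' - f d' := by
    intro c d c' d' h
    have h1 : c + d' = c' + d := Subtype.ext (by
      push_cast
      rw [sub_eq_sub_iff_add_eq_add] at h
      exact h)
    have h2 := congrArg f h1
    rw [map_add, map_add] at h2
    rw [sub_eq_sub_iff_add_eq_add, h2]
  refine ⟨AddMonoidHom.mk' (fun x => f (a x) - f (b x)) fun x y => ?_, fun p => ?_⟩
  · have := key (a (x + y)) (b (x + y)) (a x + a y) (b x + b y) (by
      rw [← hab, AddSubgroup.coe_add, hab x, hab y]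
      push_cast
      abel)
    rw [this, map_add, map_add]
    abel
  · have := key (a ⟨p, AddSubgroup.subset_closure p.2⟩) (b ⟨p, AddSubgroup.subset_closure p.2⟩)
      p 0 (by rw [← hab]; simp)
    simpa using this

/-- A real-valued morphism on a submonoid of an abelian group extends to the group. -/
theorem exists_real_extension {A : Type*} [AddCommGroup A] {P : AddSubmonoid A} (f : P →+ ℝ) :
    ∃ g : A →+ ℝ, ∀ p : P, g p = f p := by
  obtain ⟨g, hg⟩ := exists_extension_closure f
  obtain ⟨h, hh⟩ := (Module.Baer.of_divisible ℝ).extension_property_addMonoidHom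
    (AddSubgroup.closure (P : Set A)).subtype Subtype.val_injective g
  exact ⟨h, fun p => by rw [← hg, ← hh]; rfl⟩

/-- Faces of a monoid. -/
structure IsFace {A : Type*} [AddCommGroup A] (P F : AddSubmonoid A) : Prop where
  le : F ≤ P
  mem_of_add : ∀ p ∈ P, ∀ q ∈ P, p + q ∈ F → p ∈ F

theorem IsFace.mem_of_add_right {A : Type*} [AddCommGroup A] {P F : AddSubmonoid A}
    (h : IsFace P F) {p q : A} (hp : p ∈ P) (hq : q ∈ P) (hpq : p + q ∈ F) : q ∈ F :=
  h.mem_of_add q hq p hp (by rwa [add_comm])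

theorem IsFace.mem_of_nsmul {A : Type*} [AddCommGroup A] {P F : AddSubmonoid A}
    (h : IsFace P F) {p : A} (hp : p ∈ P) {n : ℕ} (hn : 0 < n) (hpn : n • p ∈ F) : p ∈ F := by
  obtain ⟨m, rfl⟩ := Nat.exists_eq_succ_of_ne_zero hn.ne'
  rw [succ_nsmul] at hpn
  exact h.mem_of_add_right (nsmul_mem hp m) hp hpn

/-- If a sum of generators lies in a face, so does each summand; hence no generator outside the face
is ever needed. -/
theorem IsFace.eq_closure {A : Type*} [AddCommGroup A] {P F : AddSubmonoid A} (h : IsFace P F)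
    {N : ℕ} {r : Fin N → A} (hr : P = AddSubmonoid.closure (Set.range r)) :
    F = AddSubmonoid.closure (Set.range r ∩ F) := by
  refine le_antisymm ?_ ((AddSubmonoid.closure_le).2 Set.inter_subset_right)
  intro x hx
  have hxP := h.le hx
  have : ∀ y ∈ P, y ∈ F → y ∈ AddSubmonoid.closure (Set.range r ∩ F) := by
    intro y hy
    have hy' := hy
    rw [hr] at hy'
    induction hy' using AddSubmonoid.closure_induction with
    | mem y hy' => exact fun hF => AddSubmonoid.subset_closure ⟨hy', hF⟩
    | zero => exact fun _ => zero_mem _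
    | add y z hy' hz' ihy ihz =>
      rw [← hr] at hy' hz'
      exact fun hF => add_mem (ihy hy' (h.mem_of_add y hy' z hz' hF))
        (ihz hz' (h.mem_of_add_right hy' hz' hF))
  exact this x hxP hx

theorem IsFace.fg {A : Type*} [AddCommGroup A] {P F : AddSubmonoid A} (h : IsFace P F)
    (hP : P.FG) : F.FG := by
  obtain ⟨N, r, hr⟩ := exists_generators hP
  rw [AddSubmonoid.fg_iff]
  exact ⟨_, (h.eq_closure hr).symm, (Set.finite_range r).inter_of_left _⟩

/-- An element of the group of a weakly toric monoid either becomes an element of the monoid after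
adding an element of the face `F`, or is separated from the monoid by a functional vanishing
on `F`. -/
theorem IsFace.exists_add_mem_or_separating (h : IsFace P F) (hP : IsWeaklyToric P)
    {e : Fin k → ℤ} (he : e ∈ AddSubgroup.closure (P : Set (Fin k → ℤ))) :
    (∃ f ∈ F, e + f ∈ P) ∨
      ∃ α : (Fin k → ℤ) →+ ℤ, (∀ p ∈ P, 0 ≤ α p) ∧ (∀ f ∈ F, α f = 0) ∧ α e < 0 := by
  -- Inverting `F` inside `P` forces a functional that is nonnegative on the enlarged monoid to
  -- vanish on `F`.
  have hfg : (P ⊔ F.map (-AddMonoidHom.id _)).FG := hP.1.sup ((h.fg hP.1).map _)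
  rcases mem_or_exists_separating hfg e with ⟨n, hn, hne⟩ | ⟨α, hα, hαe⟩
  · left
    obtain ⟨p, hp, f', hf', hpf⟩ := AddSubmonoid.mem_sup.1 hne
    obtain ⟨f, hf, rfl⟩ := hf'
    refine ⟨f, hf, hP.2 n hn _ (add_mem he (AddSubgroup.subset_closure (h.le hf))) ?_⟩
    obtain ⟨m, rfl⟩ := Nat.exists_eq_succ_of_ne_zero hn.ne'
    have : m.succ • (e + f) = p + m • f := by
      rw [nsmul_add, ← hpf, succ_nsmul f m]
      simp only [AddMonoidHom.neg_apply, AddMonoidHom.id_apply]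
      abel
    rw [this]
    exact add_mem hp (nsmul_mem (h.le hf) _)
  · right
    have h1 : ∀ p ∈ P, 0 ≤ α p := fun p hp => hα p (AddSubmonoid.mem_sup_left hp)
    refine ⟨α, h1, fun f hf => le_antisymm ?_ (h1 f (h.le hf)), hαe⟩
    have := hα (-f) (AddSubmonoid.mem_sup_right ⟨f, hf, rfl⟩)
    simpa using this

/-- For a generator `r i` outside `F`, no element of `F` moves `-r i` into `P`, since the face
property would put `r i` into `F`. So some functional is positive at `r i`, nonnegative on `P` and
zero on `F`; the sum over all generators works. -/
theorem IsFace.exists_pos_functional (h : IsFace P F) (hP : IsWeaklyToric P) :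
    ∃ α : (Fin k → ℤ) →+ ℤ, (∀ f ∈ F, α f = 0) ∧ ∀ p ∈ P, p ∉ F → 0 < α p := by
  obtain ⟨N, r, hr⟩ := exists_generators hP.1
  have hrP : ∀ i, r i ∈ P := fun i => hr ▸ AddSubmonoid.subset_closure ⟨i, rfl⟩
  have : ∀ i, ∃ α : (Fin k → ℤ) →+ ℤ, (∀ p ∈ P, 0 ≤ α p) ∧ (∀ f ∈ F, α f = 0) ∧
      (r i ∉ F → 0 < α (r i)) := by
    intro i
    by_cases hi : r i ∈ F
    · exact ⟨0, by simp, by simp, fun h => (h hi).elim⟩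
    rcases h.exists_add_mem_or_separating hP
      (neg_mem (AddSubgroup.subset_closure (hrP i))) with ⟨f, hf, hfp⟩ | ⟨α, h1, h2, h3⟩
    · exact (hi (h.mem_of_add _ (hrP i) _ hfp (by simpa using hf))).elim
    · exact ⟨α, h1, h2, fun _ => by simpa using h3⟩
  choose α h1 h2 h3 using this
  refine ⟨∑ i, α i, fun f hf => ?_, fun p hp => ?_⟩
  · simp only [AddMonoidHom.finsetSum_apply]
    exact Finset.sum_eq_zero fun i _ => h2 i f hf
  · have h0 : ∀ q ∈ P, 0 ≤ (∑ i, α i) q := fun q hq => by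
      simp only [AddMonoidHom.finsetSum_apply]
      exact Finset.sum_nonneg fun i _ => h1 i q hq
    have hp' := hp
    rw [hr] at hp'
    induction hp' using AddSubmonoid.closure_induction with
    | mem p hp' =>
      obtain ⟨i, rfl⟩ := hp'
      intro hi
      simp only [AddMonoidHom.finsetSum_apply]
      exact Finset.sum_pos' (fun j _ => h1 j _ (hrP i)) ⟨i, Finset.mem_univ _, h3 i hi⟩
    | zero => exact fun h => (h (zero_mem _)).elim
    | add p q hp' hq' ihp ihq =>
      rw [← hr] at hp' hq'
      intro hpq
      rw [map_add]
      by_cases hpF : p ∈ F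
      · have hqF : q ∉ F := fun hqF => hpq (add_mem hpF hqF)
        exact add_pos_of_nonneg_of_pos (h0 p hp') (ihq hq' hqF)
      · exact add_pos_of_pos_of_nonneg (ihp hp' hpF) (h0 q hq')

/-- The saturation of a submonoid of `ℤᵏ`. -/
def saturation (R : AddSubmonoid (Fin k → ℤ)) : AddSubmonoid (Fin k → ℤ) where
  carrier := {z | ∃ n : ℕ, 0 < n ∧ n • z ∈ R}
  zero_mem' := ⟨1, one_pos, by simp⟩
  add_mem' := by
    rintro x y ⟨n, hn, hx⟩ ⟨m, hm, hy⟩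
    refine ⟨n * m, mul_pos hn hm, ?_⟩
    rw [nsmul_add]
    refine add_mem ?_ ?_
    · rw [mul_comm, mul_nsmul']
      exact nsmul_mem hx m
    · rw [mul_nsmul']
      exact nsmul_mem hy n

theorem le_saturation (R : AddSubmonoid (Fin k → ℤ)) : R ≤ saturation R :=
  fun z hz => ⟨1, one_pos, by simpa using hz⟩

/-- Gordan's lemma: the saturation of a finitely generated submonoid of `ℤᵏ` is finitely
generated. -/
theorem saturation_fg {R : AddSubmonoid (Fin k → ℤ)} (hR : R.FG) : (saturation R).FG := by
  obtain ⟨N, r, rfl⟩ := exists_generators hR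
  set R := AddSubmonoid.closure (Set.range r)
  have hrR : ∀ i, r i ∈ R := fun i => AddSubmonoid.subset_closure ⟨i, rfl⟩
  -- Subtracting integer parts of the rational coefficients from `z` leaves a combination of the `r
  -- i` with coefficients in `[0, 1)`, whose coordinates are bounded by `B`. Finitely many lattice
  -- points remain.
  let B : Fin k → ℤ := fun j => ∑ i, |r i j|
  let S : Set (Fin k → ℤ) := Set.range r ∪ (Set.Icc (-B) B ∩ saturation R)
  have hS : S.Finite := (Set.finite_range r).union ((Set.finite_Icc _ _).inter_of_left _)
  rw [AddSubmonoid.fg_iff]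
  refine ⟨S, le_antisymm ?_ ?_, hS⟩
  · rw [AddSubmonoid.closure_le]
    rintro _ (⟨i, rfl⟩ | h)
    · exact le_saturation _ (hrR i)
    · exact h.2
  · rintro z ⟨n, hn, hz⟩
    obtain ⟨a, ha⟩ := AddSubmonoid.mem_closure_range_iff_of_fintype.1 hz
    have hzz : z = ∑ i, (a i / n) • r i + (z - ∑ i, (a i / n) • r i) := by abel
    have hrem : n • (z - ∑ i, (a i / n) • r i) = ∑ i, (a i % n) • r i := by
      rw [nsmul_sub, ha, Finset.smul_sum, ← Finset.sum_sub_distrib]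
      refine Finset.sum_congr rfl fun i _ => ?_
      rw [smul_smul, sub_eq_iff_eq_add, ← add_nsmul, Nat.mod_add_div]
    rw [hzz]
    have hr' : ∀ i, r i ∈ AddSubmonoid.closure S := fun i =>
      AddSubmonoid.subset_closure (Set.mem_union_left _ (Set.mem_range_self i))
    refine add_mem (sum_mem fun i _ => nsmul_mem (hr' i) _)
      (AddSubmonoid.subset_closure (Set.mem_union_right _ ?_))
    refine ⟨?_, n, hn, by rw [hrem]; exact sum_mem fun i _ => nsmul_mem (hrR i) _⟩
    set y := z - ∑ i, (a i / n) • r i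
    have habs : ∀ j, |y j| ≤ B j := by
      intro j
      have h1 : (n : ℤ) * y j = ∑ i, ((a i % n : ℕ) : ℤ) * r i j := by
        have := congrFun hrem j
        simpa [Finset.sum_apply] using this
      have hn' : (0 : ℤ) < n := by exact_mod_cast hn
      have h2 : (n : ℤ) * |y j| ≤ n * B j := by
        calc (n : ℤ) * |y j| = |(n : ℤ) * y j| := by rw [abs_mul, abs_of_pos hn']
          _ ≤ ∑ i, |((a i % n : ℕ) : ℤ) * r i j| := by
              rw [h1]; exact Finset.abs_sum_le_sum_abs _ _
          _ ≤ ∑ i, (n : ℤ) * |r i j| := by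
              refine Finset.sum_le_sum fun i _ => ?_
              rw [abs_mul, Nat.abs_cast]
              exact mul_le_mul_of_nonneg_right
                (by exact_mod_cast (Nat.mod_lt (a i) hn).le) (abs_nonneg _)
          _ = n * B j := by rw [Finset.mul_sum]
      exact le_of_mul_le_mul_left h2 hn'
    exact ⟨fun j => (abs_le.1 (habs j)).1, fun j => (abs_le.1 (habs j)).2⟩

theorem isWeaklyToric_saturation {R : AddSubmonoid (Fin k → ℤ)} (hR : R.FG) :
    IsWeaklyToric (saturation R) := by
  refine ⟨saturation_fg hR, ?_⟩
  rintro m hm p - ⟨n, hn, h⟩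
  exact ⟨n * m, mul_pos hn hm, by rwa [mul_comm, mul_nsmul]⟩

end

/-! ### Geometry of the model spaces -/

section

variable {k : ℕ} {P : AddSubmonoid (Fin k → ℤ)}

/-- The group generated by a submonoid of `ℤᵏ`. -/
abbrev Grp (P : AddSubmonoid (Fin k → ℤ)) : AddSubgroup (Fin k → ℤ) :=
  AddSubgroup.closure (P : Set (Fin k → ℤ))

/-- The inclusion of a submonoid of `ℤᵏ` into the group it generates. -/
def toGrp : P →+ Grp P where
  toFun p := ⟨p, AddSubgroup.subset_closure p.2⟩
  map_zero' := rfl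
  map_add' _p _q := rfl

@[simp] theorem coe_toGrp (p : P) : ((toGrp p : Grp P) : Fin k → ℤ) = p := rfl

theorem toGrp_injective : Function.Injective (toGrp : P → Grp P) := fun _ _ h =>
  Subtype.ext (congrArg (fun x : Grp P => (x : Fin k → ℤ)) h)

theorem exists_eq_toGrp_sub (g : Grp P) : ∃ p q : P, g = toGrp p - toGrp q := by
  obtain ⟨a, ha, b, hb, h⟩ := mem_addSubgroupClosure_iff.1 g.2
  exact ⟨⟨a, ha⟩, ⟨b, hb⟩, Subtype.ext h⟩

theorem grp_hom_ext {B : Type*} [AddGroup B] {f g : Grp P →+ B}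
    (h : ∀ p : P, f (toGrp p) = g (toGrp p)) : f = g := by
  ext x
  obtain ⟨p, q, rfl⟩ := exists_eq_toGrp_sub x
  rw [map_sub, map_sub, h, h]

theorem exists_toGrp_extension {B : Type*} [AddCommGroup B] (f : P →+ B) :
    ∃ g : Grp P →+ B, ∀ p : P, g (toGrp p) = f p := exists_extension_closure f

/-- A finite family of generators of a monoid. -/
def Generates {N : ℕ} (r : Fin N → P) : Prop := ∀ p : P, ∃ a : Fin N → ℕ, p = ∑ i, a i • r i

theorem exists_generates (hP : P.FG) : ∃ (N : ℕ) (r : Fin N → P), Generates r := by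
  obtain ⟨N, r, hr⟩ := exists_generators hP
  have hrP : ∀ i, r i ∈ P := fun i => hr ▸ AddSubmonoid.subset_closure (Set.mem_range_self i)
  refine ⟨N, fun i => ⟨r i, hrP i⟩, fun p => ?_⟩
  have hp : (p : Fin k → ℤ) ∈ AddSubmonoid.closure (Set.range r) := hr.le p.2
  obtain ⟨a, ha⟩ := AddSubmonoid.mem_closure_range_iff_of_fintype.1 hp
  exact ⟨a, Subtype.ext (by push_cast; exact ha)⟩

end

namespace ModelSpace

variable {k : ℕ} {P : AddSubmonoid (Fin k → ℤ)}

theorem ext {x y : ModelSpace P} (h : ∀ p, lam p x = lam p y) : x = y :=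
  MonoidHom.ext fun p => NNReal.coe_injective (h (Multiplicative.toAdd p))

/-- The point of `X_P` with prescribed values of the functions `λ_p`. -/
def ofFun (f : P → ℝ) (h0 : ∀ p, 0 ≤ f p) (h1 : f 0 = 1)
    (hadd : ∀ p q, f (p + q) = f p * f q) : ModelSpace P :=
  ({ toFun := fun p => ⟨f p.toAdd, h0 _⟩
     map_one' := NNReal.coe_injective h1
     map_mul' := fun p q => NNReal.coe_injective (hadd p.toAdd q.toAdd) } :
    Multiplicative P →* ℝ≥0)

theorem tendsto_nhds_iff {ι : Type*} {l : Filter ι} {F : ι → ModelSpace P} {u : ModelSpace P} :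
    Tendsto F l (𝓝 u) ↔ ∀ p, Tendsto (fun i => lam p (F i)) l (𝓝 (lam p u)) := by
  simp only [nhds_iInf, nhds_induced, tendsto_iInf, tendsto_comap_iff, Function.comp_def]

theorem continuousAt_iff {Z : Type*} [TopologicalSpace Z] {F : Z → ModelSpace P} {z : Z} :
    ContinuousAt F z ↔ ∀ p, ContinuousAt (fun x => lam p (F x)) z := tendsto_nhds_iff

theorem lam_nsmul (n : ℕ) (p : P) (x : ModelSpace P) : lam (n • p) x = lam p x ^ n := by
  induction n with
  | zero => simp [lam_zero]
  | succ n ih => rw [succ_nsmul, lam_add, ih, pow_succ]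

theorem lam_sum {ι : Type*} (s : Finset ι) (p : ι → P) (x : ModelSpace P) :
    lam (∑ i ∈ s, p i) x = ∏ i ∈ s, lam (p i) x := by
  classical
  induction s using Finset.induction_on with
  | empty => simp [lam_zero]
  | insert i s hi ih => rw [Finset.sum_insert hi, Finset.prod_insert hi, lam_add, ih]

theorem mem_supp {x : ModelSpace P} {p : P} : (p : Fin k → ℤ) ∈ supp x ↔ lam p x ≠ 0 := by
  constructor
  · rintro ⟨q, hq, h⟩
    rwa [← Subtype.ext hq]
  · exact fun h => ⟨p, rfl, h⟩

theorem supp_le (x : ModelSpace P) : supp x ≤ P := by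
  rintro _ ⟨p, rfl, -⟩
  exact p.2

theorem isFace_supp (x : ModelSpace P) : IsFace P (supp x) where
  le := supp_le x
  mem_of_add p hp q hq h := by
    have h' : ((⟨p, hp⟩ + ⟨q, hq⟩ : P) : Fin k → ℤ) ∈ supp x := h
    rw [mem_supp, lam_add] at h'
    exact (mem_supp (p := ⟨p, hp⟩)).2 (left_ne_zero_of_mul h')

/-- The action of `Hom(P^gp, ℝ)` on `X_P`. -/
def flow (δ : Grp P →+ ℝ) (x : ModelSpace P) : ModelSpace P :=
  ofFun (fun p => Real.exp (δ (toGrp p)) * lam p x)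
    (fun p => mul_nonneg (Real.exp_pos _).le (lam_nonneg p x)) (by simp [lam_zero])
    (fun p q => by rw [map_add, map_add, Real.exp_add, lam_add]; ring)

@[simp] theorem lam_flow (δ : Grp P →+ ℝ) (x : ModelSpace P) (p : P) :
    lam p (flow δ x) = Real.exp (δ (toGrp p)) * lam p x := rfl

/-- The interior point of `X_P` with logarithm `δ`. -/
def expPt (δ : Grp P →+ ℝ) : ModelSpace P :=
  ofFun (fun p => Real.exp (δ (toGrp p))) (fun p => (Real.exp_pos _).le) (by simp)
    (fun p q => by rw [map_add, map_add, Real.exp_add])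

@[simp] theorem lam_expPt (δ : Grp P →+ ℝ) (p : P) :
    lam p (expPt δ) = Real.exp (δ (toGrp p)) := rfl

theorem expPt_mem_interior (δ : Grp P →+ ℝ) : expPt δ ∈ interior P := fun _ => Real.exp_pos _

theorem exists_logHom {x : ModelSpace P} (hx : x ∈ interior P) :
    ∃ ξ : Grp P →+ ℝ, ∀ p, ξ (toGrp p) = Real.log (lam p x) :=
  exists_toGrp_extension (AddMonoidHom.mk' (fun p => Real.log (lam p x)) (by
      intro p q
      rw [lam_add, Real.log_mul (hx p).ne' (hx q).ne']) : P →+ ℝ)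

open Classical in
/-- The logarithm of an interior point of `X_P`. -/
def logHom (x : ModelSpace P) : Grp P →+ ℝ :=
  if hx : x ∈ interior P then (exists_logHom hx).choose else 0

theorem logHom_toGrp {x : ModelSpace P} (hx : x ∈ interior P) (p : P) :
    logHom x (toGrp p) = Real.log (lam p x) := by
  rw [logHom, dif_pos hx]
  exact (exists_logHom hx).choose_spec p

theorem exp_logHom {x : ModelSpace P} (hx : x ∈ interior P) (p : P) :
    Real.exp (logHom x (toGrp p)) = lam p x := by
  rw [logHom_toGrp hx, Real.exp_log (hx p)]

theorem logHom_expPt (δ : Grp P →+ ℝ) : logHom (expPt δ) = δ :=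
  grp_hom_ext fun p => by rw [logHom_toGrp (expPt_mem_interior δ), lam_expPt, Real.log_exp]

/-- The logarithm is defined on the support of `w` and extends to the whole group because `ℝ` is
divisible. Off the support the values of `η` are arbitrary. -/
theorem exists_log_supp (w : ModelSpace P) :
    ∃ η : Grp P →+ ℝ, ∀ p : P, lam p w ≠ 0 → Real.exp (η (toGrp p)) = lam p w := by
  let F : AddSubmonoid (Grp P) := (supp w).comap (Grp P).subtype
  have hF : ∀ x : F, ∃ p : P, (x : Grp P) = toGrp p ∧ 0 < lam p w := by
    rintro ⟨x, p, hp, hpw⟩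
    exact ⟨p, Subtype.ext hp.symm, (lam_nonneg p w).lt_of_ne' hpw⟩
  choose π hπ hπ0 using hF
  have hadd : ∀ x y, π (x + y) = π x + π y := fun x y => toGrp_injective (by
    rw [map_add, ← hπ, ← hπ, ← hπ]; rfl)
  obtain ⟨η, hη⟩ := exists_real_extension (AddMonoidHom.mk' (fun x : F => Real.log (lam (π x) w))
    (fun x y => by rw [hadd, lam_add, Real.log_mul (hπ0 x).ne' (hπ0 y).ne']) : F →+ ℝ)
  refine ⟨η, fun p hp => ?_⟩
  have hpF : toGrp p ∈ F := mem_supp.2 hp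
  have h1 := hη ⟨toGrp p, hpF⟩
  have h2 : π ⟨toGrp p, hpF⟩ = p := toGrp_injective (hπ _).symm
  simp only [AddMonoidHom.mk'_apply, h2] at h1
  rw [h1, Real.exp_log ((lam_nonneg p w).lt_of_ne' hp)]

/-- The real functional on `P^gp` given by an integral functional on `ℤᵏ`. -/
def realHom (P : AddSubmonoid (Fin k → ℤ)) (α : (Fin k → ℤ) →+ ℤ) : Grp P →+ ℝ :=
  (Int.castAddHom ℝ).comp (α.comp (Grp P).subtype)

theorem realHom_apply (α : (Fin k → ℤ) →+ ℤ) (g : Grp P) : realHom P α g = (α g : ℤ) := rfl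

/-- Every boundary point is the limit of a one-parameter curve of interior points: moving by `-s α`
leaves the coordinates on the face fixed and sends all others to zero. -/
theorem tendsto_expPt_sub {w : ModelSpace P} {η : Grp P →+ ℝ}
    (hη : ∀ p : P, lam p w ≠ 0 → Real.exp (η (toGrp p)) = lam p w) {α : (Fin k → ℤ) →+ ℤ}
    (h0 : ∀ p ∈ supp w, α p = 0) (h1 : ∀ p ∈ P, p ∉ supp w → 0 < α p) :
    Tendsto (fun s : ℝ => expPt (η - s • realHom P α)) atTop (𝓝 w) := by
  rw [tendsto_nhds_iff]
  intro p
  by_cases hp : lam p w = 0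
  · have hα : (0 : ℝ) < (α p : ℤ) := by
      exact_mod_cast h1 p p.2 (fun h => mem_supp.1 h hp)
    simp only [lam_expPt, hp]
    refine Real.tendsto_exp_atBot.comp ?_
    have : (fun s : ℝ => (η - s • realHom P α) (toGrp p)) =
        fun s => η (toGrp p) + s * -((α p : ℤ) : ℝ) := by
      ext s
      simp [realHom_apply, sub_eq_add_neg]
    rw [this]
    exact tendsto_atBot_add_const_left _ _ (tendsto_id.atTop_mul_const_of_neg (neg_lt_zero.2 hα))
  · have : (fun s : ℝ => lam p (expPt (η - s • realHom P α))) = fun _ => lam p w := by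
      ext s
      rw [lam_expPt, AddMonoidHom.sub_apply, AddMonoidHom.smul_apply, realHom_apply, coe_toGrp,
        h0 p (mem_supp.2 hp)]
      simp [hη p hp]
    rw [this]
    exact tendsto_const_nhds

/-- Density of the interior, from the curve above with a functional that is positive exactly off the
support. -/
theorem nhdsWithin_interior_neBot (hP : IsWeaklyToric P) (w : ModelSpace P) :
    (𝓝[interior P] w).NeBot := by
  obtain ⟨η, hη⟩ := exists_log_supp w
  obtain ⟨α, h0, h1⟩ := (isFace_supp w).exists_pos_functional hP
  exact ((tendsto_nhdsWithin_iff.2 ⟨tendsto_expPt_sub hη h0 h1,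
    Eventually.of_forall fun _ => expPt_mem_interior _⟩).neBot)

/-- If `λ_e`, for `e ∈ P^gp`, is bounded on the interior near `w`, then `e` lies in the localization
of `P` at the support of `w`. -/
theorem exists_add_eq_of_bounded (hP : IsWeaklyToric P) {w : ModelSpace P} {e : Grp P} {B : ℝ}
    (h : ∀ᶠ x in 𝓝[interior P] w, Real.exp (logHom x e) ≤ B) :
    ∃ f p : P, lam f w ≠ 0 ∧ e + toGrp f = toGrp p := by
  rcases (isFace_supp w).exists_add_mem_or_separating hP e.2 with ⟨f, hf, hfp⟩ | ⟨α, h1, h2, h3⟩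
  · exact ⟨⟨f, supp_le w hf⟩, ⟨_, hfp⟩, mem_supp.1 hf, Subtype.ext rfl⟩
  exfalso
  obtain ⟨η, hη⟩ := exists_log_supp w
  obtain ⟨β, hβ0, hβ1⟩ := (isFace_supp w).exists_pos_functional hP
  -- `α` may vanish off the face, so it is perturbed by `β`. Since `α e ≤ -1`, the factor `|β e| +
  -- 1` keeps `γ e` negative, while `γ` is positive on `P` off the support. Along the resulting
  -- curve `λ_e` tends to infinity.
  let γ : (Fin k → ℤ) →+ ℤ := (|β e| + 1) • α + β
  have hγ : ∀ x, γ x = (|β e| + 1) * α x + β x := fun x => by simp [γ]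
  have hγ0 : ∀ p ∈ supp w, γ p = 0 := fun p hp => by rw [hγ, h2 p hp, hβ0 p hp]; simp
  have hγ1 : ∀ p ∈ P, p ∉ supp w → 0 < γ p := fun p hp hpw => by
    rw [hγ]
    exact add_pos_of_nonneg_of_pos (mul_nonneg (by positivity) (h1 p hp)) (hβ1 p hp hpw)
  have hγe : γ e < 0 := by
    rw [hγ]
    nlinarith [abs_nonneg (β e), le_abs_self (β e)]
  have htend : Tendsto (fun s : ℝ => expPt (η - s • realHom P γ)) atTop (𝓝[interior P] w) :=
    tendsto_nhdsWithin_iff.2 ⟨tendsto_expPt_sub hη hγ0 hγ1,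
      Eventually.of_forall fun _ => expPt_mem_interior _⟩
  have h4 := htend.eventually h
  have h5 : Tendsto (fun s : ℝ => Real.exp (logHom (expPt (η - s • realHom P γ)) e))
      atTop atTop := by
    refine Real.tendsto_exp_atTop.comp ?_
    have : (fun s : ℝ => logHom (expPt (η - s • realHom P γ)) e) =
        fun s => η e + s * -((γ e : ℤ) : ℝ) := by
      ext s
      rw [logHom_expPt]
      simp [realHom_apply, sub_eq_add_neg]
    rw [this]
    have : (0 : ℝ) < -((γ e : ℤ) : ℝ) := by
      have : ((γ e : ℤ) : ℝ) < 0 := by exact_mod_cast hγe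
      linarith
    exact tendsto_atTop_add_const_left _ _ (tendsto_id.atTop_mul_const this)
  obtain ⟨s, hs1, hs2⟩ := (h4.and (h5.eventually (eventually_gt_atTop B))).exists
  exact absurd hs1 (not_le.2 hs2)

/-- The lower bound gives `c * λ_f ≤ λ_p` on the interior, and the limit at `w` keeps `λ_p` from
vanishing there. Thus `e` is a difference of two elements of the support. -/
theorem exists_add_eq_of_bounded_below (hP : IsWeaklyToric P) {w : ModelSpace P} {e : Grp P}
    {B c : ℝ} (hc : 0 < c)
    (h : ∀ᶠ x in 𝓝[interior P] w, Real.exp (logHom x e) ≤ B ∧ c ≤ Real.exp (logHom x e)) :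
    ∃ f p : P, lam f w ≠ 0 ∧ lam p w ≠ 0 ∧ e + toGrp f = toGrp p := by
  obtain ⟨f, p, hf, hfp⟩ := exists_add_eq_of_bounded hP (h.mono fun _ h => h.1)
  refine ⟨f, p, hf, ?_, hfp⟩
  have := nhdsWithin_interior_neBot hP w
  have h1 : ∀ᶠ x in 𝓝[interior P] w, c * lam f x ≤ lam p x := by
    filter_upwards [h, self_mem_nhdsWithin] with x hx hxi
    rw [← exp_logHom hxi p, ← hfp, map_add, Real.exp_add, exp_logHom hxi]
    exact mul_le_mul_of_nonneg_right hx.2 (lam_nonneg f x)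
  have h2 : c * lam f w ≤ lam p w :=
    le_of_tendsto_of_tendsto
      ((continuous_const.mul (continuous_lam f)).continuousAt.mono_left nhdsWithin_le_nhds)
      ((continuous_lam p).continuousAt.mono_left nhdsWithin_le_nhds) h1
  have h3 : 0 < c * lam f w := mul_pos hc ((lam_nonneg f w).lt_of_ne' hf)
  exact (h3.trans_le h2).ne'

/-- By density of the interior, identities between continuous functions need only be checked where
logarithms make sense; most identities below are proved this way. -/
theorem eventuallyEq_of_interior (hP : IsWeaklyToric P) {E : Type*} [TopologicalSpace E] [T2Space E]
    {f g : ModelSpace P → E} {w : ModelSpace P} (hf : ∀ᶠ x in 𝓝 w, ContinuousAt f x)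
    (hg : ∀ᶠ x in 𝓝 w, ContinuousAt g x) (h : ∀ᶠ x in 𝓝 w, x ∈ interior P → f x = g x) :
    ∀ᶠ x in 𝓝 w, f x = g x := by
  filter_upwards [hf, hg, eventually_eventually_nhds.2 h] with x h1 h2 h3
  have := nhdsWithin_interior_neBot hP x
  refine tendsto_nhds_unique_of_eventuallyEq (h1.mono_left nhdsWithin_le_nhds)
    (h2.mono_left (nhdsWithin_le_nhds (s := interior P))) ?_
  exact eventually_nhdsWithin_iff.2 h3

/-! #### Smooth functions -/

theorem SmoothAt.continuousAt {f : ModelSpace P → ℝ} {u : ModelSpace P} (hf : SmoothAt f u) :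
    ContinuousAt f u := by
  obtain ⟨m, r, W, g, hW, hg, hu, he⟩ := hf
  have h1 : ContinuousAt (fun x => g fun i => lam (r i) x) u :=
    ContinuousAt.comp (f := fun x i => lam (r i) x)
      (hg.continuousOn.continuousAt (hW.mem_nhds hu))
      (continuous_pi fun i => continuous_lam (r i)).continuousAt
  exact h1.congr (he.mono fun x hx => hx.symm)

theorem SmoothAt.eventually {f : ModelSpace P → ℝ} {u : ModelSpace P} (hf : SmoothAt f u) :
    ∀ᶠ x in 𝓝 u, SmoothAt f x := by
  obtain ⟨m, r, W, g, hW, hg, hu, he⟩ := hf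
  have h1 : ∀ᶠ x in 𝓝 u, (fun i => lam (r i) x) ∈ W :=
    (continuous_pi fun i => continuous_lam (r i)).continuousAt.eventually (hW.mem_nhds hu)
  filter_upwards [h1, eventually_eventually_nhds.2 he] with x h2 h3
  exact ⟨m, r, W, g, hW, hg, h2, h3⟩

theorem SmoothAt.eventually_continuousAt {f : ModelSpace P → ℝ} {u : ModelSpace P}
    (hf : SmoothAt f u) : ∀ᶠ x in 𝓝 u, ContinuousAt f x :=
  hf.eventually.mono fun _ h => h.continuousAt

theorem SmoothAt.comp_on {a : ModelSpace P → ℝ} {u : ModelSpace P} (ha : SmoothAt a u)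
    {g : ℝ → ℝ} {W : Set ℝ} (hW : IsOpen W) (hg : ContDiffOn ℝ ∞ g W) (hu : a u ∈ W) :
    SmoothAt (fun x => g (a x)) u :=
  SmoothAt.comp (m := 1) (f := fun _ => a) (fun _ => ha) (W := (fun z => z 0) ⁻¹' W)
    (g := fun z => g (z 0)) (hW.preimage (continuous_apply 0))
    (hg.comp (contDiff_apply ℝ ℝ 0).contDiffOn (fun _ h => h)) hu

theorem SmoothAt.log {a : ModelSpace P → ℝ} {u : ModelSpace P} (ha : SmoothAt a u)
    (hu : a u ≠ 0) : SmoothAt (fun x => Real.log (a x)) u :=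
  ha.comp_on isOpen_compl_singleton
    (fun _ hz => (Real.contDiffAt_log.2 hz).contDiffWithinAt) hu

theorem SmoothAt.inv {a : ModelSpace P → ℝ} {u : ModelSpace P} (ha : SmoothAt a u)
    (hu : a u ≠ 0) : SmoothAt (fun x => (a x)⁻¹) u :=
  ha.comp_on isOpen_compl_singleton
    (fun _ hz => (contDiffAt_inv ℝ hz).contDiffWithinAt) hu

theorem SmoothAt.exp {a : ModelSpace P → ℝ} {u : ModelSpace P} (ha : SmoothAt a u) :
    SmoothAt (fun x => Real.exp (a x)) u := ha.comp₁ Real.contDiff_exp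

theorem SmoothAt.neg {a : ModelSpace P → ℝ} {u : ModelSpace P} (ha : SmoothAt a u) :
    SmoothAt (fun x => -a x) u := ha.comp₁ contDiff_neg

theorem SmoothAt.sub {a b : ModelSpace P → ℝ} {u : ModelSpace P} (ha : SmoothAt a u)
    (hb : SmoothAt b u) : SmoothAt (fun x => a x - b x) u := by
  simpa only [sub_eq_add_neg] using ha.add hb.neg

theorem SmoothAt.sum {ι : Type*} (s : Finset ι) {a : ι → ModelSpace P → ℝ} {u : ModelSpace P}
    (ha : ∀ i ∈ s, SmoothAt (a i) u) : SmoothAt (fun x => ∑ i ∈ s, a i x) u := by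
  classical
  induction s using Finset.induction_on with
  | empty => simpa using smoothAt_const 0 u
  | insert i s hi ih =>
    simp only [Finset.sum_insert hi]
    exact (ha i (Finset.mem_insert_self i s)).add
      (ih fun j hj => ha j (Finset.mem_insert_of_mem hj))

theorem InteriorAt.eventually_pos {f : ModelSpace P → ℝ} {u : ModelSpace P}
    (hf : InteriorAt f u) : ∀ᶠ x in 𝓝 u, x ∈ interior P → 0 < f x := by
  obtain ⟨p, h, hh, hp, he⟩ := hf
  filter_upwards [hh.continuousAt.eventually (lt_mem_nhds hp), he] with x h2 h3 hx
  rw [h3]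
  exact mul_pos (hx p) h2

theorem InteriorAt.not_eventually_zero (hP : IsWeaklyToric P) {f : ModelSpace P → ℝ}
    {u : ModelSpace P} (hf : InteriorAt f u) : ¬ ∀ᶠ x in 𝓝 u, f x = 0 := by
  intro h
  have := nhdsWithin_interior_neBot hP u
  obtain ⟨x, hx1, hx2⟩ :=
    ((eventually_nhdsWithin_iff.2 (hf.eventually_pos)).and (nhdsWithin_le_nhds h)).exists
  exact hx1.ne' hx2

theorem InteriorAt.exists_logHom {f : ModelSpace P → ℝ} {u : ModelSpace P} (hf : InteriorAt f u) :
    ∃ (p : P) (c : ModelSpace P → ℝ), SmoothAt c u ∧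
      ∀ᶠ x in 𝓝 u, f x = lam p x * Real.exp (c x) := by
  obtain ⟨p, h, hh, hp, he⟩ := hf
  refine ⟨p, fun x => Real.log (h x), hh.log hp.ne', ?_⟩
  filter_upwards [he, hh.continuousAt.eventually (lt_mem_nhds hp)] with x h1 h2
  rw [h1, Real.exp_log h2]

theorem interiorAt_lam (p : P) (u : ModelSpace P) : InteriorAt (lam p) u :=
  ⟨p, fun _ => 1, smoothAt_const 1 u, one_pos, Eventually.of_forall fun x => by simp⟩

/-- A function that is continuous near `w` and agrees with `λ_e · exp c` on the interior, with
`e ∈ P^gp` and `c` smooth, is interior. -/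
theorem interiorAt_of_logHom (hP : IsWeaklyToric P) {w : ModelSpace P} {b : ModelSpace P → ℝ}
    (hb : ∀ᶠ x in 𝓝 w, ContinuousAt b x) {e : Grp P} {c : ModelSpace P → ℝ} (hc : SmoothAt c w)
    (h : ∀ᶠ x in 𝓝 w, x ∈ interior P → b x = Real.exp (logHom x e + c x)) : InteriorAt b w := by
  -- On the interior `λ_e = b · exp(-c)`, and both factors are continuous at `w`; the constants are
  -- crude bounds for them.
  have hbd : ∀ᶠ x in 𝓝[interior P] w,
      Real.exp (logHom x e) ≤ (b w + 1) * Real.exp (-c w + 1) := by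
    rw [eventually_nhdsWithin_iff]
    filter_upwards [h, hb.self_of_nhds.eventually (gt_mem_nhds (lt_add_one (b w))),
      hc.neg.continuousAt.eventually (gt_mem_nhds (lt_add_one (-c w)))] with x h1 h2 h3 hx
    have h4 : Real.exp (logHom x e) = b x * Real.exp (-c x) := by
      rw [h1 hx, ← Real.exp_add, add_neg_cancel_right]
    rw [h4]
    have h5 : 0 ≤ b x := by rw [h1 hx]; exact (Real.exp_pos _).le
    exact mul_le_mul h2.le (Real.exp_le_exp.2 h3.le) (Real.exp_pos _).le (h5.trans h2.le)
  obtain ⟨f, p, hf, hfp⟩ := exists_add_eq_of_bounded hP hbd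
  have hsm : SmoothAt (fun x => (lam f x)⁻¹ * Real.exp (c x)) w :=
    ((smoothAt_lam f w).inv hf).mul hc.exp
  refine ⟨p, _, hsm, mul_pos (inv_pos.2 ((lam_nonneg f w).lt_of_ne' hf)) (Real.exp_pos _), ?_⟩
  refine eventuallyEq_of_interior hP hb ((smoothAt_lam p w).mul hsm).eventually_continuousAt ?_
  filter_upwards [h] with x h1 hx
  rw [h1 hx, Real.exp_add, ← exp_logHom hx p, ← hfp, map_add, Real.exp_add, exp_logHom hx]
  have := (hx f).ne'
  field_simp

/-- The class of an interior function in `P` modulo the units at `u` is well defined. -/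
theorem add_eq_add_of_eventuallyEq (hP : IsWeaklyToric P) {u : ModelSpace P} {p q : P}
    {a b : ModelSpace P → ℝ} (ha : ContinuousAt a u) (hb : ContinuousAt b u) (ha0 : 0 < a u)
    (hb0 : 0 < b u) (h : ∀ᶠ x in 𝓝 u, x ∈ interior P → lam p x * a x = lam q x * b x) :
    ∃ f g : P, lam f u ≠ 0 ∧ lam g u ≠ 0 ∧ p + f = q + g := by
  have hc : ContinuousAt (fun x => b x / a x) u := hb.div ha ha0.ne'
  have hc0 : 0 < b u / a u := div_pos hb0 ha0
  -- On the interior `λ_{p-q} = b / a`, which has a positive limit at `u` and is therefore bounded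
  -- above and away from zero.
  obtain ⟨f, g, hf, hg, hfg⟩ := exists_add_eq_of_bounded_below hP (w := u) (e := toGrp p - toGrp q)
    (B := b u / a u + 1) (half_pos hc0) (by
      rw [eventually_nhdsWithin_iff]
      filter_upwards [h, hc.eventually (gt_mem_nhds (lt_add_one _)),
        hc.eventually (lt_mem_nhds (half_lt_self hc0)), ha.eventually (lt_mem_nhds ha0)]
        with x h1 h2 h3 h4 hx
      have h5 : Real.exp (logHom x (toGrp p - toGrp q)) = b x / a x := by
        rw [map_sub, Real.exp_sub, exp_logHom hx, exp_logHom hx,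
          div_eq_div_iff (hx q).ne' h4.ne', h1 hx, mul_comm]
      rw [h5]
      exact ⟨h2.le, h3.le⟩)
  refine ⟨f, g, hf, hg, toGrp_injective ?_⟩
  rw [map_add, map_add, ← hfg]
  abel

/-! #### Smooth maps -/

section Maps

variable {l : ℕ} {Q : AddSubmonoid (Fin l → ℤ)} {F : ModelSpace P → ModelSpace Q}
  {u : ModelSpace P}

theorem SmoothMapAt.continuousAt (hF : SmoothMapAt F u) : ContinuousAt F u :=
  continuousAt_iff.2 fun q => (hF q).smoothAt.continuousAt

theorem SmoothMapAt.congr {F' : ModelSpace P → ModelSpace Q} (hF : SmoothMapAt F u)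
    (h : ∀ᶠ x in 𝓝 u, F' x = F x) : SmoothMapAt F' u := by
  intro q
  rcases hF q with hq | hq
  · exact Or.inl (hq.congr (h.mono fun x hx => by simp only [hx]))
  · refine Or.inr ?_
    filter_upwards [h, hq] with x h1 h2
    simp only [h1, h2]

theorem SmoothAt.comp_smoothMapAt {f : ModelSpace Q → ℝ} (hF : SmoothMapAt F u)
    (hf : SmoothAt f (F u)) : SmoothAt (fun x => f (F x)) u := by
  obtain ⟨m, r, W, g, hW, hg, hu, he⟩ := hf
  refine (SmoothAt.comp (f := fun i x => lam (r i) (F x)) (fun i => (hF (r i)).smoothAt) hW hg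
    hu).congr (hF.continuousAt.eventually he)

theorem InteriorAt.comp_smoothMapAt {f : ModelSpace Q → ℝ} (hF : SmoothMapAt F u)
    (hf : InteriorAt f (F u)) : NonnegSmoothAt (fun x => f (F x)) u := by
  obtain ⟨q, h, hh, hp, he⟩ := hf
  have he' := hF.continuousAt.eventually he
  rcases hF q with hq | hq
  · exact Or.inl ((hq.mul (interiorAt_of_pos (SmoothAt.comp_smoothMapAt hF hh) hp)).congr he')
  · refine Or.inr ?_
    filter_upwards [hq, he'] with x h1 h2
    rw [h2, h1, zero_mul]

theorem NonnegSmoothAt.comp_smoothMapAt {f : ModelSpace Q → ℝ} (hF : SmoothMapAt F u)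
    (hf : NonnegSmoothAt f (F u)) : NonnegSmoothAt (fun x => f (F x)) u := by
  rcases hf with hf | hf
  · exact hf.comp_smoothMapAt hF
  · exact Or.inr (hF.continuousAt.eventually hf)

theorem SmoothMapAt.comp {l' : ℕ} {R : AddSubmonoid (Fin l' → ℤ)}
    {G : ModelSpace Q → ModelSpace R} (hG : SmoothMapAt G (F u)) (hF : SmoothMapAt F u) :
    SmoothMapAt (fun x => G (F x)) u := fun q =>
  NonnegSmoothAt.comp_smoothMapAt (f := fun y => lam q (G y)) hF (hG q)

theorem InteriorAt.comp_interior {f : ModelSpace Q → ℝ}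
    (hF : ∀ q, InteriorAt (fun x => lam q (F x)) u) (hf : InteriorAt f (F u)) :
    InteriorAt (fun x => f (F x)) u := by
  have hF' : SmoothMapAt F u := fun q => Or.inl (hF q)
  obtain ⟨q, h, hh, hp, he⟩ := hf
  exact ((hF q).mul (interiorAt_of_pos (SmoothAt.comp_smoothMapAt hF' hh) hp)).congr
    (hF'.continuousAt.eventually he)

end Maps

end ModelSpace

/-! ### Calculus: cutoffs, Hadamard's lemma and the implicit function theorem -/

section Calculus

/-- A cutoff makes local smooth functions global, so that later arguments on germs need not carry
domains. -/
theorem exists_contDiff_eventuallyEq {E E' : Type*} [NormedAddCommGroup E] [NormedSpace ℝ E]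
    [FiniteDimensional ℝ E] [NormedAddCommGroup E'] [NormedSpace ℝ E'] {g : E → E'} {W : Set E}
    (hW : IsOpen W) (hg : ContDiffOn ℝ ∞ g W) {y : E} (hy : y ∈ W) :
    ∃ g' : E → E', ContDiff ℝ ∞ g' ∧ ∀ᶠ z in 𝓝 y, g' z = g z := by
  obtain ⟨ε, hε, hball⟩ := Metric.isOpen_iff.1 hW y hy
  let b : ContDiffBump y := ⟨ε / 3, ε / 2, by positivity, by linarith⟩
  have hsub : tsupport b ⊆ W := by
    rw [b.tsupport_eq]
    exact (Metric.closedBall_subset_ball (by change ε / 2 < ε; linarith)).trans hball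
  refine ⟨fun z => b z • g z, contDiff_iff_contDiffAt.2 fun z => ?_, ?_⟩
  · by_cases hz : z ∈ tsupport b
    · exact b.contDiffAt.smul (hg.contDiffAt (hW.mem_nhds (hsub hz)))
    · have h0 : ∀ᶠ x in 𝓝 z, b x • g x = 0 := by
        filter_upwards [(isClosed_tsupport b).isOpen_compl.mem_nhds hz] with x hx
        rw [image_eq_zero_of_notMem_tsupport hx, zero_smul]
      exact (contDiffAt_const (c := (0 : E'))).congr_of_eventuallyEq h0
  · filter_upwards [b.eventuallyEq_one] with z hz
    rw [hz]
    simp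

-- The integral is the value at `0` of the convolution of the indicator of `(0, 1]` with `s ↦ χ s *
-- H (y, -s)`. The cutoff `χ` equals `1` on `[-1, 0]` and supplies the compact support needed for
-- differentiating a convolution with parameters.
open MeasureTheory in
theorem contDiff_parametric_integral {E : Type*} [NormedAddCommGroup E] [NormedSpace ℝ E]
    {H : E × ℝ → ℝ} (hH : ContDiff ℝ ∞ H) :
    ContDiff ℝ ∞ fun y => ∫ t in (0 : ℝ)..1, H (y, t) := by
  let χ : ContDiffBump (0 : ℝ) := ⟨2, 3, by norm_num, by norm_num⟩
  let f : ℝ → ℝ := (Set.Ioc (0 : ℝ) 1).indicator fun _ => 1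
  have hf : LocallyIntegrable f volume :=
    (integrable_indicator_iff measurableSet_Ioc).2 (by simp) |>.locallyIntegrable
  let g : E → ℝ → ℝ := fun y s => χ s * H (y, -s)
  have hg : ContDiffOn ℝ ∞ ↿g (Set.univ ×ˢ Set.univ) := by
    refine ContDiff.contDiffOn ?_
    exact (χ.contDiff.comp contDiff_snd).mul
      (hH.comp (contDiff_fst.prodMk contDiff_snd.neg))
  have key := contDiffOn_convolution_right_with_param (μ := volume)
    (ContinuousLinearMap.mul ℝ ℝ) isOpen_univ (isCompact_closedBall (0 : ℝ) 3) (g := g)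
    (fun y s _ hs => by
      have : χ s = 0 := χ.zero_of_le_dist (by
        simp only [Metric.mem_closedBall, not_le] at hs
        exact hs.le)
      simp [g, this]) hf hg
  rw [Set.univ_prod_univ, contDiffOn_univ] at key
  have h2 := key.comp (contDiff_id.prodMk (contDiff_const (c := (0 : ℝ))) : ContDiff ℝ ∞
    fun y : E => (y, (0 : ℝ)))
  convert h2 using 1
  ext y
  rw [intervalIntegral.integral_of_le zero_le_one, ← integral_indicator measurableSet_Ioc]
  refine integral_congr_ae (Eventually.of_forall fun t => ?_)
  by_cases ht : t ∈ Set.Ioc (0 : ℝ) 1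
  · have : χ (-t) = 1 := χ.one_of_mem_closedBall (by
      simp only [Metric.mem_closedBall, dist_zero_right, norm_neg, Real.norm_eq_abs]
      rw [abs_of_pos ht.1]
      exact ht.2.trans (by norm_num [χ]))
    simp [f, g, ht, this]
  · simp [f, ht]

/-- Hadamard's lemma. -/
theorem exists_hadamard {N : ℕ} {g : (Fin N → ℝ) → ℝ} (hg : ContDiff ℝ ∞ g) (y₀ : Fin N → ℝ) :
    ∃ h : Fin N → (Fin N → ℝ) → ℝ, (∀ i, ContDiff ℝ ∞ (h i)) ∧
      (∀ i, h i y₀ = fderiv ℝ g y₀ (Pi.single i 1)) ∧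
      ∀ y, g y = g y₀ + ∑ i, (y i - y₀ i) * h i y := by
  have hg' : ContDiff ℝ ∞ (fderiv ℝ g) := hg.fderiv_right (by norm_num)
  let H : Fin N → (Fin N → ℝ) × ℝ → ℝ := fun i v =>
    fderiv ℝ g (y₀ + v.2 • (v.1 - y₀)) (Pi.single i 1)
  have hline : ContDiff ℝ ∞ fun v : (Fin N → ℝ) × ℝ => y₀ + v.2 • (v.1 - y₀) :=
    contDiff_const.add (contDiff_snd.smul (contDiff_fst.sub contDiff_const))
  have hH : ∀ i, ContDiff ℝ ∞ (H i) := fun i => (hg'.comp hline).clm_apply contDiff_const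
  refine ⟨fun i y => ∫ t in (0 : ℝ)..1, H i (y, t), fun i => contDiff_parametric_integral (hH i),
    fun i => by simp [H], fun y => ?_⟩
  have hderiv : ∀ t : ℝ, HasDerivAt (fun t : ℝ => g (y₀ + t • (y - y₀)))
      (∑ i, (y i - y₀ i) * H i (y, t)) t := by
    intro t
    have h1 : HasDerivAt (fun t : ℝ => y₀ + t • (y - y₀)) (y - y₀) t := by
      simpa using ((hasDerivAt_id t).smul_const (y - y₀)).const_add y₀
    have h2 := ((hg.differentiable (by norm_num)) (y₀ + t • (y - y₀))).hasFDerivAt.comp_hasDerivAt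
      t h1
    have h3 : y - y₀ = ∑ i, (y i - y₀ i) • (Pi.single i (1 : ℝ) : Fin N → ℝ) := by
      ext j
      simp [Finset.sum_apply, Pi.single_apply]
    have h4 : fderiv ℝ g (y₀ + t • (y - y₀)) (y - y₀) = ∑ i, (y i - y₀ i) * H i (y, t) := by
      conv_lhs => rw [h3, map_sum]
      refine Finset.sum_congr rfl fun i _ => ?_
      rw [map_smul, smul_eq_mul, ← h3]
    rw [h4] at h2
    exact h2
  have hcont : ∀ i, Continuous fun t : ℝ => (y i - y₀ i) * H i (y, t) := fun i =>
    continuous_const.mul ((hH i).continuous.comp (continuous_const.prodMk continuous_id))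
  have h3 := intervalIntegral.integral_eq_sub_of_hasDerivAt (a := 0) (b := 1)
    (fun t _ => hderiv t)
    ((continuous_finsetSum _ fun i _ => hcont i).intervalIntegrable _ _)
  rw [intervalIntegral.integral_finsetSum fun i _ => (hcont i).intervalIntegrable _ _] at h3
  simp only [intervalIntegral.integral_const_mul, one_smul, zero_smul, add_zero,
    add_sub_cancel] at h3
  linarith

/-- `C^∞` at the single point `u.1` does not give `C^∞` on a neighbourhood, since the neighbourhood
may shrink with the order. The implicit function is therefore compared with the one constructed at
each nearby point of its graph; local uniqueness makes them agree. -/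
theorem exists_implicit_of_invertible {E₁ E₂ F : Type*} [NormedAddCommGroup E₁] [NormedSpace ℝ E₁]
    [FiniteDimensional ℝ E₁] [NormedAddCommGroup E₂] [NormedSpace ℝ E₂] [FiniteDimensional ℝ E₂]
    [NormedAddCommGroup F] [NormedSpace ℝ F] [FiniteDimensional ℝ F] {f : E₁ × E₂ → F}
    (hf : ContDiff ℝ ∞ f) {u : E₁ × E₂} (hu : f u = 0)
    (hinv : (fderiv ℝ f u ∘L .inr ℝ E₁ E₂).IsInvertible) :
    ∃ Θ : E₁ → E₂, ContDiff ℝ ∞ Θ ∧ Θ u.1 = u.2 ∧ ∀ᶠ v in 𝓝 u, f v = 0 ↔ v.2 = Θ v.1 := by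
  have := FiniteDimensional.complete ℝ E₁
  have := FiniteDimensional.complete ℝ E₂
  have := FiniteDimensional.complete ℝ F
  have hn : (∞ : WithTop ℕ∞) ≠ 0 := by norm_num
  let Θ : E₁ → E₂ := hf.contDiffAt.implicitFunction hn hinv
  have hΘu : Θ u.1 = u.2 := ContDiffAt.implicitFunction_apply_self _ hn hinv
  have hΘ : ∀ᶠ v in 𝓝 u, f v = 0 ↔ Θ v.1 = v.2 := by
    have := ContDiffAt.eventually_apply_eq_iff_implicitFunction hf.contDiffAt hn hinv
    rwa [hu] at this
  have hcd : ContDiffAt ℝ ∞ Θ u.1 := ContDiffAt.contDiffAt_implicitFunction _ hn hinv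
  have hinv' : ∀ᶠ v in 𝓝 u, (fderiv ℝ f v ∘L .inr ℝ E₁ E₂).IsInvertible := by
    have hc : Continuous fun v => fderiv ℝ f v ∘L .inr ℝ E₁ E₂ :=
      (hf.continuous_fderiv hn).clm_comp continuous_const
    obtain ⟨A, hA⟩ := hinv
    have := hc.continuousAt.eventually (hA ▸ ContinuousLinearEquiv.nhds A :
      Set.range ((↑) : (E₂ ≃L[ℝ] F) → E₂ →L[ℝ] F) ∈ 𝓝 (fderiv ℝ f u ∘L .inr ℝ E₁ E₂))
    exact this
  have hgood : ∀ᶠ x in 𝓝 u.1, ContDiffAt ℝ ∞ Θ x := by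
    have hg : Tendsto (fun x => (x, Θ x)) (𝓝 u.1) (𝓝 u) := by
      have : ContinuousAt (fun x => (x, Θ x)) u.1 := continuousAt_id.prodMk hcd.continuousAt
      rw [ContinuousAt, hΘu] at this
      exact this
    have hcont : ∀ᶠ x in 𝓝 u.1, ContinuousAt Θ x := by
      have h1 : ContDiffAt ℝ 1 Θ u.1 := hcd.of_le (by norm_num)
      exact (h1.eventually (by norm_num)).mono fun x hx => hx.continuousAt
    filter_upwards [hg.eventually (hinv'.and (eventually_eventually_nhds.2 hΘ)), hcont]
      with x ⟨h1, h2⟩ h3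
    have h0 : f (x, Θ x) = 0 := h2.self_of_nhds.2 rfl
    have h4 := ContDiffAt.eventually_apply_eq_iff_implicitFunction (u := (x, Θ x))
      hf.contDiffAt hn h1
    have h5 := ContDiffAt.contDiffAt_implicitFunction (u := (x, Θ x)) hf.contDiffAt hn h1
    refine h5.congr_of_eventuallyEq ?_
    have h6 : Tendsto (fun x' => (x', Θ x')) (𝓝 x) (𝓝 (x, Θ x)) :=
      (continuousAt_id.prodMk h3 : ContinuousAt (fun x' => (x', Θ x')) x)
    filter_upwards [h6.eventually (h4.and h2)] with x' ⟨h7, h8⟩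
    rw [h0] at h7
    exact (h7.1 (h8.2 rfl)).symm
  obtain ⟨W, hWsub, hW, huW⟩ := eventually_nhds_iff.1 hgood
  obtain ⟨Θ', hΘ', heq⟩ := exists_contDiff_eventuallyEq hW
    (fun x hx => (hWsub x hx).contDiffWithinAt) huW
  refine ⟨Θ', hΘ', by rw [heq.self_of_nhds, hΘu], ?_⟩
  filter_upwards [hΘ, continuousAt_fst.eventually heq] with v h1 h2
  rw [h1, h2, eq_comm]

/-- Composing with a left inverse of the injective partial derivative reduces to the invertible
case. Solutions of the original system solve the composed one, which gives uniqueness also for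
overdetermined systems; the converse needs the left inverse to be injective, hence equal dimensions.
-/
theorem exists_implicit_of_injective {E₁ E₂ F : Type*} [NormedAddCommGroup E₁] [NormedSpace ℝ E₁]
    [FiniteDimensional ℝ E₁] [NormedAddCommGroup E₂] [NormedSpace ℝ E₂] [FiniteDimensional ℝ E₂]
    [NormedAddCommGroup F] [NormedSpace ℝ F] [FiniteDimensional ℝ F] {f : E₁ × E₂ → F}
    (hf : ContDiff ℝ ∞ f) {u : E₁ × E₂} (hu : f u = 0) {A : E₂ →L[ℝ] F}
    (hA : HasFDerivAt (fun κ => f (u.1, κ)) A u.2) (hinj : Function.Injective A) :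
    ∃ Θ : E₁ → E₂, ContDiff ℝ ∞ Θ ∧ Θ u.1 = u.2 ∧ (∀ᶠ v in 𝓝 u, f v = 0 → v.2 = Θ v.1) ∧
      (Module.finrank ℝ F = Module.finrank ℝ E₂ → ∀ᶠ x in 𝓝 u.1, f (x, Θ x) = 0) := by
  obtain ⟨B, hB⟩ := LinearMap.exists_leftInverse_of_injective (A : E₂ →ₗ[ℝ] F)
    (LinearMap.ker_eq_bot.2 hinj)
  let B' : F →L[ℝ] E₂ := LinearMap.toContinuousLinearMap B
  have hB' : B' ∘L A = ContinuousLinearMap.id ℝ E₂ := by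
    ext x
    exact LinearMap.congr_fun hB x
  have hpart : fderiv ℝ f u ∘L .inr ℝ E₁ E₂ = A := by
    have h1 : HasFDerivAt (fun κ : E₂ => (u.1, κ)) (.inr ℝ E₁ E₂) u.2 := hasFDerivAt_prodMk_right _ _
    have h2 : HasFDerivAt f (fderiv ℝ f u) (u.1, u.2) :=
      (hf.differentiable (by norm_num) u).hasFDerivAt
    exact (h2.comp u.2 h1).unique hA
  have hf' : ContDiff ℝ ∞ fun v => B' (f v) := B'.contDiff.comp hf
  have hder : fderiv ℝ (fun v => B' (f v)) u ∘L .inr ℝ E₁ E₂ = ContinuousLinearMap.id ℝ E₂ := by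
    have : fderiv ℝ (fun v => B' (f v)) u = B' ∘L fderiv ℝ f u :=
      (B'.hasFDerivAt.comp u (hf.differentiable (by norm_num) u).hasFDerivAt).fderiv
    rw [this, ContinuousLinearMap.comp_assoc, hpart, hB']
  obtain ⟨Θ, h1, h2, h3⟩ := exists_implicit_of_invertible hf' (u := u) (by simp [hu])
    (hder ▸ ⟨ContinuousLinearEquiv.refl ℝ E₂, rfl⟩)
  refine ⟨Θ, h1, h2, h3.mono fun v h hv => h.1 (by simp [hv]), fun hdim => ?_⟩
  have hBinj : Function.Injective B := by
    have hsurj : Function.Surjective B := fun x => ⟨A x, LinearMap.congr_fun hB x⟩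
    exact (LinearMap.injective_iff_surjective_of_finrank_eq_finrank hdim).2 hsurj
  have hg : Tendsto (fun x => (x, Θ x)) (𝓝 u.1) (𝓝 u) := by
    have : ContinuousAt (fun x => (x, Θ x)) u.1 :=
      continuousAt_id.prodMk h1.continuous.continuousAt
    rw [ContinuousAt, h2] at this
    exact this
  filter_upwards [hg.eventually h3] with x hx
  exact hBinj (by rw [map_zero]; exact hx.2 rfl)

end Calculus

section HomCoordinates

variable {G : Type*} [AddCommGroup G] {n : ℕ}

/-- A basis of a free abelian group identifies real-valued homomorphisms with vectors. -/
def homEquiv (b : Module.Basis (Fin n) ℤ G) : (Fin n → ℝ) ≃ₗ[ℝ] (G →+ ℝ) where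
  toFun κ := AddMonoidHom.mk' (fun g => ∑ i, (b.repr g i : ℝ) * κ i) fun g h => by
    simp [add_mul, Finset.sum_add_distrib]
  map_add' κ κ' := by
    ext g
    simp [mul_add, Finset.sum_add_distrib]
  map_smul' c κ := by
    ext g
    simp only [AddMonoidHom.mk'_apply, Pi.smul_apply, smul_eq_mul, RingHom.id_apply,
      AddMonoidHom.smul_apply, Finset.mul_sum]
    exact Finset.sum_congr rfl fun i _ => by ring
  invFun δ i := δ (b i)
  left_inv κ := by
    ext i
    simp [Finsupp.single_apply]
  right_inv δ := by
    ext g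
    simp only [AddMonoidHom.mk'_apply]
    conv_rhs => rw [← b.sum_repr g, map_sum]
    exact Finset.sum_congr rfl fun i _ => by rw [map_zsmul, zsmul_eq_mul]

theorem homEquiv_apply (b : Module.Basis (Fin n) ℤ G) (κ : Fin n → ℝ) (g : G) :
    homEquiv b κ g = ∑ i, (b.repr g i : ℝ) * κ i := rfl

theorem homEquiv_symm_apply (b : Module.Basis (Fin n) ℤ G) (δ : G →+ ℝ) (i : Fin n) :
    (homEquiv b).symm δ i = δ (b i) := rfl

/-- Evaluation of homomorphisms in coordinates. -/
def evalCLM (b : Module.Basis (Fin n) ℤ G) (g : G) : (Fin n → ℝ) →L[ℝ] ℝ :=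
  ∑ i, (b.repr g i : ℝ) • ContinuousLinearMap.proj i

theorem evalCLM_apply (b : Module.Basis (Fin n) ℤ G) (g : G) (κ : Fin n → ℝ) :
    evalCLM b g κ = homEquiv b κ g := by
  simp [evalCLM, homEquiv_apply]

/-- The implicit function theorem for the system of equations
`κ(D i) + C i (z · exp κ(r)) = τ i` in an unknown homomorphism `κ`. -/
theorem exists_implicit_hom (b : Module.Basis (Fin n) ℤ G) {ι : Type} [Fintype ι] {N : ℕ}
    (r : Fin N → G) (D : ι → G) (C : ι → (Fin N → ℝ) → ℝ) (hC : ∀ i, ContDiff ℝ ∞ (C i))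
    (z₀ : Fin N → ℝ) (τ₀ : ι → ℝ) (κ₀ : G →+ ℝ)
    (h0 : ∀ i, κ₀ (D i) + C i (fun j => z₀ j * Real.exp (κ₀ (r j))) = τ₀ i)
    (hinj : ∀ δ : G →+ ℝ, (∀ i, δ (D i) + fderiv ℝ (C i) (fun j => z₀ j * Real.exp (κ₀ (r j)))
      (fun j => z₀ j * Real.exp (κ₀ (r j)) * δ (r j)) = 0) → δ = 0) :
    ∃ Θ : (Fin N → ℝ) × (ι → ℝ) → (G →+ ℝ), (∀ g, ContDiff ℝ ∞ fun v => Θ v g) ∧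
      Θ (z₀, τ₀) = κ₀ ∧
      (∀ {α : Type} {l : Filter α} {z : α → Fin N → ℝ} {τ : α → ι → ℝ} {κ : α → (G →+ ℝ)},
        Tendsto z l (𝓝 z₀) → Tendsto τ l (𝓝 τ₀) →
        (∀ g, Tendsto (fun x => κ x g) l (𝓝 (κ₀ g))) →
        (∀ᶠ x in l, ∀ i, κ x (D i) + C i (fun j => z x j * Real.exp (κ x (r j))) = τ x i) →
        ∀ᶠ x in l, κ x = Θ (z x, τ x)) ∧
      (Fintype.card ι = n → ∀ᶠ v in 𝓝 (z₀, τ₀),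
        ∀ i, Θ v (D i) + C i (fun j => v.1 j * Real.exp (Θ v (r j))) = v.2 i) := by
  let f : ((Fin N → ℝ) × (ι → ℝ)) × (Fin n → ℝ) → ι → ℝ := fun v i =>
    evalCLM b (D i) v.2 + C i (fun j => v.1.1 j * Real.exp (evalCLM b (r j) v.2)) - v.1.2 i
  have hf : ContDiff ℝ ∞ f := by
    refine contDiff_pi.2 fun i => ((ContDiff.add ?_ ?_).sub ?_)
    · exact (evalCLM b (D i)).contDiff.comp contDiff_snd
    · refine (hC i).comp (contDiff_pi.2 fun j => ContDiff.mul ?_ ?_)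
      · exact (contDiff_apply ℝ ℝ j).comp (contDiff_fst.comp contDiff_fst)
      · exact Real.contDiff_exp.comp ((evalCLM b (r j)).contDiff.comp contDiff_snd)
    · exact (contDiff_apply ℝ ℝ i).comp (contDiff_snd.comp contDiff_fst)
  have hf_eq : ∀ z τ (κ : G →+ ℝ), f ((z, τ), (homEquiv b).symm κ) = 0 ↔
      ∀ i, κ (D i) + C i (fun j => z j * Real.exp (κ (r j))) = τ i := by
    intro z τ κ
    simp only [funext_iff, f, evalCLM_apply, LinearEquiv.apply_symm_apply, Pi.zero_apply,
      sub_eq_zero]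
  let κ' := (homEquiv b).symm κ₀
  let y₀ : Fin N → ℝ := fun j => z₀ j * Real.exp (κ₀ (r j))
  have hev : ∀ g, evalCLM b g κ' = κ₀ g := fun g => by
    rw [evalCLM_apply, LinearEquiv.apply_symm_apply]
  let A : (Fin n → ℝ) →L[ℝ] (ι → ℝ) := ContinuousLinearMap.pi fun i =>
    evalCLM b (D i) + (fderiv ℝ (C i) y₀) ∘L
      (ContinuousLinearMap.pi fun j => y₀ j • evalCLM b (r j))
  have hA : HasFDerivAt (fun κ => f ((z₀, τ₀), κ)) A κ' := by
    refine hasFDerivAt_pi.2 fun i => HasFDerivAt.sub_const _ (HasFDerivAt.add ?_ ?_)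
    · exact (evalCLM b (D i)).hasFDerivAt
    · have h1 : HasFDerivAt (fun κ : Fin n → ℝ => fun j => z₀ j * Real.exp (evalCLM b (r j) κ))
          (ContinuousLinearMap.pi fun j => y₀ j • evalCLM b (r j)) κ' := by
        refine hasFDerivAt_pi.2 fun j => ?_
        have h2 := ((evalCLM b (r j)).hasFDerivAt (x := κ')).exp.const_mul (z₀ j)
        rw [hev, smul_smul] at h2
        exact h2
      have h3 : HasFDerivAt (C i) (fderiv ℝ (C i) y₀)
          (fun j => z₀ j * Real.exp (evalCLM b (r j) κ')) := by
        simp only [hev]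
        exact ((hC i).differentiable (by norm_num) _).hasFDerivAt
      exact h3.comp κ' h1
  have hAinj : Function.Injective A := by
    rw [injective_iff_map_eq_zero]
    intro δ hδ
    have h1 : homEquiv b δ = 0 := hinj _ fun i => by
      have := congrFun hδ i
      simp only [A, ContinuousLinearMap.pi_apply, add_apply,
        ContinuousLinearMap.comp_apply, evalCLM_apply, Pi.zero_apply] at this
      rw [← this]
      congr 2
      ext j
      simp [y₀, evalCLM_apply]
    simpa using h1
  obtain ⟨Θ, hΘ1, hΘ2, hΘ3, hΘ4⟩ := exists_implicit_of_injective hf (u := ((z₀, τ₀), κ'))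
    ((hf_eq _ _ _).2 h0) hA hAinj
  refine ⟨fun v => homEquiv b (Θ v), fun g => ?_, ?_, ?_, ?_⟩
  · simp only [← evalCLM_apply]
    exact (evalCLM b g).contDiff.comp hΘ1
  · change homEquiv b (Θ (z₀, τ₀)) = κ₀
    have : Θ (z₀, τ₀) = κ' := hΘ2
    rw [this, LinearEquiv.apply_symm_apply]
  · intro α l z τ κ hz hτ hκ h
    have hκ' : Tendsto (fun x => (homEquiv b).symm (κ x)) l (𝓝 κ') :=
      tendsto_pi_nhds.2 fun i => hκ (b i)
    filter_upwards [((hz.prodMk_nhds hτ).prodMk_nhds hκ').eventually hΘ3, h] with x h1 h2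
    have h3 : (homEquiv b).symm (κ x) = Θ (z x, τ x) := h1 ((hf_eq _ _ _).2 h2)
    rw [← h3, LinearEquiv.apply_symm_apply]
  · intro hcard
    filter_upwards [hΘ4 (by simp [hcard])] with v hv
    have := (hf_eq v.1 v.2 (homEquiv b (Θ v))).1 (by
      rw [LinearEquiv.symm_apply_apply]; exact hv)
    exact this

end HomCoordinates

namespace ModelSpace

/-! #### Smooth functions in terms of generators, and derivatives along the flow -/

variable {k : ℕ} {P : AddSubmonoid (Fin k → ℤ)} {N : ℕ}

/-- The functions `λ_{r_i}` as a map to Euclidean space. -/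
def lamv (r : Fin N → P) (x : ModelSpace P) : Fin N → ℝ := fun i => lam (r i) x

theorem continuous_lamv (r : Fin N → P) : Continuous (lamv r) :=
  continuous_pi fun i => continuous_lam (r i)

theorem SmoothAt.of_comp_lamv {r : Fin N → P} {g : (Fin N → ℝ) → ℝ} (hg : ContDiff ℝ ∞ g)
    {f : ModelSpace P → ℝ} {u : ModelSpace P} (h : ∀ᶠ x in 𝓝 u, f x = g (lamv r x)) :
    SmoothAt f u := ⟨N, r, Set.univ, g, isOpen_univ, hg.contDiffOn, trivial, h⟩

/-- Each `λ_s` is a monomial in the coordinates of the generators, so one fixed finite set of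
coordinates serves all smooth germs. -/
theorem SmoothAt.exists_eq_comp_lamv {r : Fin N → P} (hr : Generates r) {f : ModelSpace P → ℝ}
    {u : ModelSpace P} (hf : SmoothAt f u) :
    ∃ g : (Fin N → ℝ) → ℝ, ContDiff ℝ ∞ g ∧ ∀ᶠ x in 𝓝 u, f x = g (lamv r x) := by
  obtain ⟨m, s, W, g, hW, hg, hu, he⟩ := hf
  choose a ha using fun i => hr (s i)
  let M : (Fin N → ℝ) → Fin m → ℝ := fun z i => ∏ j, z j ^ a i j
  have hM : ContDiff ℝ ∞ M := contDiff_pi.2 fun i =>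
    contDiff_prod fun j _ => (contDiff_apply ℝ ℝ j).pow _
  have hMs : ∀ x, M (lamv r x) = fun i => lam (s i) x := fun x => by
    ext i
    conv_rhs => rw [ha i, lam_sum]
    simp only [M, lamv, lam_nsmul]
  obtain ⟨g', hg', heq⟩ := exists_contDiff_eventuallyEq (hW.preimage hM.continuous)
    (hg.comp hM.contDiffOn fun z hz => hz) (y := lamv r u) (by
      change M (lamv r u) ∈ W
      rwa [hMs])
  refine ⟨g', hg', ?_⟩
  filter_upwards [he, (continuous_lamv r).continuousAt.eventually heq] with x h1 h2
  rw [h1, h2, Function.comp_apply, hMs]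

/-- The derivative of a function at `u` along the flow of `δ`. -/
def bder (f : ModelSpace P → ℝ) (u : ModelSpace P) (δ : Grp P →+ ℝ) : ℝ :=
  deriv (fun s : ℝ => f (flow (s • δ) u)) 0

theorem flow_zero (u : ModelSpace P) : flow 0 u = u := ext fun p => by simp

theorem tendsto_flow (u : ModelSpace P) (δ : Grp P →+ ℝ) :
    Tendsto (fun s : ℝ => flow (s • δ) u) (𝓝 0) (𝓝 u) := by
  rw [tendsto_nhds_iff]
  intro p
  have h1 : Continuous fun s : ℝ => lam p (flow (s • δ) u) := by
    simp only [lam_flow, AddMonoidHom.smul_apply, smul_eq_mul]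
    fun_prop
  have h2 := h1.tendsto 0
  simpa [flow_zero] using h2

theorem hasDerivAt_lam_flow (p : P) (u : ModelSpace P) (δ : Grp P →+ ℝ) :
    HasDerivAt (fun s : ℝ => lam p (flow (s • δ) u)) (lam p u * δ (toGrp p)) 0 := by
  have h1 : HasDerivAt (fun s : ℝ => s * δ (toGrp p)) (δ (toGrp p)) 0 := by
    simpa using (hasDerivAt_id (0 : ℝ)).mul_const (δ (toGrp p))
  have h2 := h1.exp.mul_const (lam p u)
  simp only [zero_mul, Real.exp_zero, one_mul] at h2
  rw [mul_comm]
  exact h2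

theorem hasDerivAt_comp_lamv_flow {r : Fin N → P} {g : (Fin N → ℝ) → ℝ} (hg : ContDiff ℝ ∞ g)
    {f : ModelSpace P → ℝ} {u : ModelSpace P} (h : ∀ᶠ x in 𝓝 u, f x = g (lamv r x))
    (δ : Grp P →+ ℝ) :
    HasDerivAt (fun s : ℝ => f (flow (s • δ) u))
      (fderiv ℝ g (lamv r u) fun i => lam (r i) u * δ (toGrp (r i))) 0 := by
  have h1 : HasDerivAt (fun s : ℝ => lamv r (flow (s • δ) u))
      (fun i => lam (r i) u * δ (toGrp (r i))) 0 :=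
    hasDerivAt_pi.2 fun i => hasDerivAt_lam_flow (r i) u δ
  have h2 : HasFDerivAt g (fderiv ℝ g (lamv r u)) (lamv r (flow ((0 : ℝ) • δ) u)) := by
    rw [zero_smul, flow_zero]
    exact (hg.differentiable (by norm_num) _).hasFDerivAt
  exact (h2.comp_hasDerivAt 0 h1).congr_of_eventuallyEq ((tendsto_flow u δ).eventually h)

theorem bder_eq_fderiv {r : Fin N → P} {g : (Fin N → ℝ) → ℝ} (hg : ContDiff ℝ ∞ g)
    {f : ModelSpace P → ℝ} {u : ModelSpace P} (h : ∀ᶠ x in 𝓝 u, f x = g (lamv r x))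
    (δ : Grp P →+ ℝ) :
    bder f u δ = fderiv ℝ g (lamv r u) fun i => lam (r i) u * δ (toGrp (r i)) :=
  (hasDerivAt_comp_lamv_flow hg h δ).deriv

end ModelSpace

/-! ### Frames of a free abelian group adapted to a linear system -/

section Frames

theorem nonempty_basis_grp {k n : ℕ} {P : AddSubmonoid (Fin k → ℤ)} (h : monoidRank P = n) :
    Nonempty (Module.Basis (Fin n) ℤ (Grp P)) := by
  have : Module.Finite ℤ (Grp P) :=
    inferInstanceAs (Module.Finite ℤ (AddSubgroup.toIntSubmodule (Grp P)))
  have : Module.Free ℤ (Grp P) :=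
    inferInstanceAs (Module.Free ℤ (AddSubgroup.toIntSubmodule (Grp P)))
  exact ⟨Module.finBasisOfFinrankEq ℤ (Grp P) h⟩

variable {G : Type} [AddCommGroup G]

/-- A torsion-free quotient of a finitely generated free abelian group splits off. -/
theorem exists_basis_quotient {n : ℕ} (b : Module.Basis (Fin n) ℤ G) (K : AddSubgroup G)
    (hK : ∀ (m : ℕ) (g : G), 0 < m → m • g ∈ K → g ∈ K) :
    ∃ (a : ℕ) (π : G →+ (Fin a → ℤ)) (σ : Fin a → G), (∀ i, π (σ i) = Pi.single i 1) ∧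
      (∀ g, π g = 0 ↔ g ∈ K) ∧ ∀ g, g - ∑ i, π g i • σ i ∈ K := by
  have h1 : Module.Finite ℤ G := Module.Finite.of_basis b
  have h2 : Module.Finite ℤ (G ⧸ K) :=
    Module.Finite.of_surjective (QuotientAddGroup.mk' K).toIntLinearMap
      (QuotientAddGroup.mk'_surjective K)
  have h3 : IsAddTorsionFree (G ⧸ K) := by
    refine ⟨fun m hm => ?_⟩
    change Function.Injective (nsmulAddMonoidHom m : (G ⧸ K) →+ (G ⧸ K))
    rw [injective_iff_map_eq_zero]
    intro x hx
    induction x using QuotientAddGroup.induction_on with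
    | H g =>
      refine (QuotientAddGroup.eq_zero_iff g).2 (hK m g (Nat.pos_of_ne_zero hm) ?_)
      exact (QuotientAddGroup.eq_zero_iff (m • g)).1 hx
  have h4 : Module.Free ℤ (G ⧸ K) := Module.free_of_finite_type_torsion_free'
  let bA := Module.finBasis ℤ (G ⧸ K)
  let π : G →+ (Fin (Module.finrank ℤ (G ⧸ K)) → ℤ) :=
    (bA.equivFun.toLinearMap.toAddMonoidHom).comp (QuotientAddGroup.mk' K)
  have hπ : ∀ g i, π g i = bA.repr (g : G ⧸ K) i := fun _ _ => rfl
  choose σ hσ using fun i => QuotientAddGroup.mk'_surjective K (bA i)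
  have hσ' : ∀ i, ((σ i : G) : G ⧸ K) = bA i := hσ
  refine ⟨_, π, σ, fun i => ?_, fun g => ?_, fun g => ?_⟩
  · ext j
    rw [hπ, hσ', bA.repr_self, Finsupp.single_apply, Pi.single_apply]
    simp [eq_comm]
  · constructor
    · intro h
      refine (QuotientAddGroup.eq_zero_iff g).1 (bA.ext_elem fun i => ?_)
      rw [← hπ, h]
      simp
    · intro h
      ext i
      rw [hπ, (QuotientAddGroup.eq_zero_iff g).2 h]
      simp
  · rw [← QuotientAddGroup.eq_zero_iff]
    have := bA.sum_repr (g : G ⧸ K)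
    have h5 : ((∑ i, π g i • σ i : G) : G ⧸ K) = g := by
      conv_rhs => rw [← this]
      change QuotientAddGroup.mk' K _ = _
      rw [map_sum]
      refine Finset.sum_congr rfl fun i _ => ?_
      rw [map_zsmul, hπ, ← hσ']
      rfl
    rw [QuotientAddGroup.mk_sub, h5, sub_self]

/-- Vectors `e` of `G`, split into those in a prescribed family `φ` (indexed by `T`) and those
spanning a complement of the common annihilator of the annihilators of `φ` and `d`. -/
structure AdaptedFrame {N k : ℕ} (φ : Fin N → G) (d : Fin k → G) (m : ℕ) where
  e : Fin m → G
  T : Set (Fin m)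
  ψ : G →+ (Fin m → ℤ)
  e_mem : ∀ μ ∈ T, ∃ i, e μ = φ i
  ψ_φ : ∀ i, ψ (φ i) = 0
  ψ_d : ∀ i, ψ (d i) = 0
  ψ_e : ∀ μ ∉ T, ψ (e μ) = Pi.single μ 1
  ψ_T : ∀ g, ∀ μ ∈ T, ψ g μ = 0
  inj : ∀ δ : G →+ ℝ, (∀ i, δ (φ i) = 0) → (∀ i, δ (d i) = 0) → (∀ μ ∉ T, δ (e μ) = 0) → δ = 0

/-- The `Λ i` are the differentials of the equations; `hd` and `hd'` say that, on functionals
killing the units `φ`, they have the same common zeros as the `d i`. The forms `Λ`, evaluation at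
lifts of a basis of `G / K`, and evaluation at suitably many `φ i` form a basis of the dual of
`Hom(G, ℝ)`. The frame consists of the lattice vectors in this basis, so it has `m = n - card κ`
members, and `T` marks those taken from `φ`. -/
theorem exists_adaptedFrame {n N k m : ℕ} {κ : Type} [Fintype κ] (b : Module.Basis (Fin n) ℤ G)
    (φ : Fin N → G) (d : Fin k → G) (Λ : κ → Module.Dual ℝ (G →+ ℝ)) (hΛ : LinearIndependent ℝ Λ)
    (hd : ∀ δ, (∀ i, δ (φ i) = 0) → (∀ i, Λ i δ = 0) → ∀ i, δ (d i) = 0)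
    (hd' : ∀ δ, (∀ i, δ (φ i) = 0) → (∀ i, δ (d i) = 0) → ∀ i, Λ i δ = 0)
    (hm : m + Fintype.card κ = n) :
    ∃ A : AdaptedFrame φ d m,
      ∀ δ : G →+ ℝ, (∀ i, Λ i δ = 0) → (∀ μ, δ (A.e μ) = 0) → δ = 0 := by
  classical
  have hfin : FiniteDimensional ℝ (G →+ ℝ) := Module.Finite.equiv (homEquiv b)
  have hdim : Module.finrank ℝ (G →+ ℝ) = n := by
    rw [← (homEquiv b).finrank_eq]; simp
  -- The double annihilator of `φ` and `d`. It is saturated because `ℝ` is torsion-free, so `G / K`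
  -- is free.
  let K : AddSubgroup G :=
    { carrier := {g | ∀ δ : G →+ ℝ, (∀ i, δ (φ i) = 0) → (∀ i, δ (d i) = 0) → δ g = 0}
      zero_mem' := fun δ _ _ => map_zero δ
      add_mem' := fun ha hb δ h1 h2 => by rw [map_add, ha δ h1 h2, hb δ h1 h2, add_zero]
      neg_mem' := fun ha δ h1 h2 => by rw [map_neg, ha δ h1 h2, neg_zero] }
  have hφK : ∀ i, φ i ∈ K := fun i δ h _ => h i
  have hdK : ∀ i, d i ∈ K := fun i δ _ h => h i
  obtain ⟨a, π, σ, hπσ, hπK, hσK⟩ := exists_basis_quotient b K fun m g hm hg δ h1 h2 => by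
    have := hg δ h1 h2
    rw [map_nsmul, smul_eq_zero] at this
    exact this.resolve_left hm.ne'
  let ev : G → Module.Dual ℝ (G →+ ℝ) := fun g =>
    { toFun := fun δ => δ g, map_add' := fun _ _ => rfl, map_smul' := fun _ _ => rfl }
  let v : κ ⊕ (Fin N ⊕ Fin a) → Module.Dual ℝ (G →+ ℝ) :=
    Sum.elim Λ (Sum.elim (fun i => ev (φ i)) (fun i => ev (σ i)))
  have hKσ : ∀ δ : G →+ ℝ, (∀ i, δ (φ i) = 0) → (∀ i, δ (d i) = 0) → (∀ i, δ (σ i) = 0) →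
      δ = 0 := by
    intro δ h1 h2 h3
    ext g
    have := hσK g δ h1 h2
    rw [map_sub, map_sum, Finset.sum_eq_zero fun i _ => by rw [map_zsmul, h3, smul_zero],
      sub_zero] at this
    exact this
  let s : Set (κ ⊕ (Fin N ⊕ Fin a)) := Set.range Sum.inl ∪ Set.range (Sum.inr ∘ Sum.inr)
  let i₀ : κ ⊕ Fin a → κ ⊕ (Fin N ⊕ Fin a) := Sum.map id Sum.inr
  have hi₀ : Function.Injective i₀ := Function.injective_id.sumMap Sum.inr_injective
  -- Functionals factoring through `π` kill every `Λ i` by `hd'`, so a linear relation first loses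
  -- its coefficients at the `σ j`, and then those at the `Λ i` by hypothesis.
  have hlin₀ : LinearIndependent ℝ (v ∘ i₀) := by
    rw [Fintype.linearIndependent_iff]
    intro c hc
    have hc' : ∀ δ : G →+ ℝ, ∑ i, c (Sum.inl i) * Λ i δ + ∑ i, c (Sum.inr i) * δ (σ i) = 0 := by
      intro δ
      have := LinearMap.congr_fun hc δ
      rw [Fintype.sum_sum_type] at this
      simpa [v, i₀, ev, LinearMap.sum_apply] using this
    have h1 : ∀ j, c (Sum.inr j) = 0 := by
      intro j
      let δ : G →+ ℝ := (Int.castAddHom ℝ).comp ((Pi.evalAddMonoidHom (fun _ => ℤ) j).comp π)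
      have hδ : ∀ g, δ g = (π g j : ℝ) := fun _ => rfl
      have hδφ : ∀ i, δ (φ i) = 0 := fun i => by rw [hδ, (hπK _).2 (hφK i)]; simp
      have hδd : ∀ i, δ (d i) = 0 := fun i => by rw [hδ, (hπK _).2 (hdK i)]; simp
      have := hc' δ
      rw [Finset.sum_eq_zero fun i _ => by rw [hd' δ hδφ hδd i, mul_zero], zero_add] at this
      simpa [hδ, hπσ, Pi.single_apply] using this
    have h2 : ∀ j, c (Sum.inl j) = 0 := by
      refine Fintype.linearIndependent_iff.1 hΛ (fun j => c (Sum.inl j)) ?_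
      ext δ
      have := hc' δ
      simp only [h1, zero_mul, Finset.sum_const_zero, add_zero] at this
      simpa [LinearMap.sum_apply] using this
    rintro (j | j)
    exacts [h2 j, h1 j]
  have hs : LinearIndepOn ℝ v (Set.range i₀) := (linearIndepOn_range_iff hi₀ v).2 hlin₀
  -- All `Λ i` and `σ i` are already present, so only evaluations at vectors of `φ` are added here.
  obtain ⟨B, -, hsB, hspan, hB⟩ := exists_linearIndepOn_extension hs (Set.subset_univ _)
  have hzero : ∀ δ : G →+ ℝ, (∀ x ∈ B, v x δ = 0) → δ = 0 := by
    intro δ hδ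
    have h1 : ∀ x, v x δ = 0 := by
      intro x
      have h2 := hspan ⟨x, trivial, rfl⟩
      have h3 : ∀ f ∈ Submodule.span ℝ (v '' B), f δ = 0 := by
        intro f hf
        induction hf using Submodule.span_induction with
        | mem f hf => obtain ⟨x, hx, rfl⟩ := hf; exact hδ x hx
        | zero => rfl
        | add f g _ _ hf hg => rw [LinearMap.add_apply, hf, hg, add_zero]
        | smul c f _ hf => rw [LinearMap.smul_apply, hf, smul_zero]
      exact h3 _ h2
    have hφ0 : ∀ i, δ (φ i) = 0 := fun i => h1 (Sum.inr (Sum.inl i))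
    exact hKσ δ hφ0 (hd δ hφ0 fun i => h1 (Sum.inl i)) fun i => h1 (Sum.inr (Sum.inr i))
  -- The chosen forms are independent, giving `≤`, and separate functionals, giving `≥`.
  have hcard : Fintype.card B = n := by
    refine le_antisymm ?_ ?_
    · have := LinearIndependent.fintype_card_le_finrank hB
      rwa [Subspace.dual_finrank_eq, hdim] at this
    · let M : (G →+ ℝ) →ₗ[ℝ] (B → ℝ) := LinearMap.pi fun x => v x
      have hM : Function.Injective M := by
        rw [injective_iff_map_eq_zero]
        exact fun δ hδ => hzero δ fun x hx => congrFun hδ ⟨x, hx⟩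
      have := LinearMap.finrank_le_finrank_of_injective hM
      rwa [hdim, Module.finrank_fintype_fun_eq_card] at this
  have hinl : ∀ i, Sum.inl i ∈ B := fun i => hsB ⟨Sum.inl i, rfl⟩
  have hinr : ∀ i, Sum.inr (Sum.inr i) ∈ B := fun i => hsB ⟨Sum.inr i, rfl⟩
  let R := {x : Fin N ⊕ Fin a // Sum.inr x ∈ B}
  have hR : Fintype.card R = m := by
    let E : κ ⊕ R ≃ B :=
      { toFun := Sum.elim (fun i => ⟨Sum.inl i, hinl i⟩) fun x => ⟨Sum.inr x.1, x.2⟩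
        invFun := fun x => match x with
          | ⟨Sum.inl i, _⟩ => Sum.inl i
          | ⟨Sum.inr i, h⟩ => Sum.inr ⟨i, h⟩
        left_inv := by rintro (i | i) <;> rfl
        right_inv := by rintro ⟨i | i, h⟩ <;> rfl }
    have := Fintype.card_congr E
    rw [Fintype.card_sum, hcard] at this
    omega
  let ν : R ≃ Fin m := Fintype.equivFinOfCardEq hR
  let S : Fin m → Fin N ⊕ Fin a := fun μ => (ν.symm μ).1
  have hSinj : Function.Injective S := Subtype.val_injective.comp ν.symm.injective
  have hSσ : ∀ i, ∃ μ, S μ = Sum.inr i := fun i => ⟨ν ⟨Sum.inr i, hinr i⟩, by simp [S]⟩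
  let w : Fin N ⊕ Fin a → G := Sum.elim φ σ
  let ψ : G →+ (Fin m → ℤ) :=
    { toFun := fun g μ => Sum.elim (fun _ => 0) (π g) (S μ)
      map_zero' := by ext μ; rcases h : S μ with i | i <;> simp
      map_add' := fun g g' => by ext μ; rcases h : S μ with i | i <;> simp [h] }
  have hψ : ∀ g μ, ψ g μ = Sum.elim (fun _ => 0) (π g) (S μ) := fun _ _ => rfl
  have hψK : ∀ g ∈ K, ψ g = 0 := fun g hg => by
    ext μ
    rw [hψ, (hπK g).2 hg]
    rcases S μ with i | i <;> simp
  refine ⟨⟨fun μ => w (S μ), {μ | (S μ).isLeft}, ψ, ?_, fun i => hψK _ (hφK i),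
    fun i => hψK _ (hdK i), ?_, ?_, ?_⟩, ?_⟩
  · intro μ hμ
    obtain ⟨i, hi⟩ := Sum.isLeft_iff.1 hμ
    exact ⟨i, by simp [hi, w]⟩
  · intro μ hμ
    have hμ' : ¬ (S μ).isLeft := hμ
    rw [Sum.not_isLeft] at hμ'
    obtain ⟨i, hi⟩ := Sum.isRight_iff.1 hμ'
    ext μ'
    rw [hψ, hi]
    simp only [w, Sum.elim_inr, hπσ]
    by_cases hμμ : μ' = μ
    · subst hμμ
      simp [hi]
    · rw [Pi.single_eq_of_ne hμμ]
      rcases h : S μ' with j | j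
      · simp
      · have : j ≠ i := fun hj => hμμ (hSinj (by rw [h, hi, hj]))
        simp [this]
  · intro g μ hμ
    obtain ⟨i, hi⟩ := Sum.isLeft_iff.1 hμ
    rw [hψ, hi]
    simp
  · intro δ h1 h2 h3
    refine hKσ δ h1 h2 fun i => ?_
    obtain ⟨μ, hμ⟩ := hSσ i
    have := h3 μ (by simp [hμ])
    simpa [hμ, w] using this
  · intro δ h1 h2
    refine hzero δ fun x hx => ?_
    rcases x with i | x
    · exact h1 i
    · have := h2 (ν ⟨x, hx⟩)
      have hS : S (ν ⟨x, hx⟩) = x := by simp [S]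
      change δ (w (S (ν ⟨x, hx⟩))) = 0 at this
      rw [hS] at this
      rcases x with i | i <;> exact this

end Frames

open ModelSpace

/-! ### The monoid of the solution chart -/

namespace AdaptedFrame

section

variable {G : Type} [AddCommGroup G] {N k m : ℕ} {φ : Fin N → G} {d : Fin k → G}
  (A : AdaptedFrame φ d m)

/-- The homomorphism `ℤᵐ → G` given by the vectors of the frame. -/
def lift : (Fin m → ℤ) →+ G where
  toFun z := ∑ μ, z μ • A.e μ
  map_zero' := by simp
  map_add' z z' := by simp [add_smul, Finset.sum_add_distrib]

theorem lift_apply (z : Fin m → ℤ) : A.lift z = ∑ μ, z μ • A.e μ := rfl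

theorem lift_single (μ : Fin m) : A.lift (Pi.single μ 1) = A.e μ := by
  classical
  rw [lift_apply, Finset.sum_eq_single μ]
  · simp
  · intro ν _ h
    simp [h]
  · simp

/-- The subgroup of `ℤᵐ` of vectors supported in `T`. -/
def unitGroup : AddSubgroup (Fin m → ℤ) where
  carrier := {z | ∀ μ ∉ A.T, z μ = 0}
  zero_mem' := fun _ _ => rfl
  add_mem' := fun h h' μ hμ => by simp [h μ hμ, h' μ hμ]
  neg_mem' := fun h μ hμ => by simp [h μ hμ]

theorem single_mem_unitGroup {μ : Fin m} (hμ : μ ∈ A.T) :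
    (Pi.single μ 1 : Fin m → ℤ) ∈ A.unitGroup := fun ν hν => by
  classical
  exact Pi.single_eq_of_ne (fun h : ν = μ => hν (h ▸ hμ)) _

theorem ψ_e_of_mem {μ : Fin m} (hμ : μ ∈ A.T) : A.ψ (A.e μ) = 0 := by
  obtain ⟨i, hi⟩ := A.e_mem μ hμ
  rw [hi, A.ψ_φ]

theorem ψ_lift_of_notMem (z : Fin m → ℤ) {ν : Fin m} (hν : ν ∉ A.T) : A.ψ (A.lift z) ν = z ν := by
  classical
  rw [lift_apply, map_sum, Finset.sum_apply, Finset.sum_eq_single ν]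
  · rw [map_zsmul, A.ψ_e ν hν]
    simp
  · intro μ _ hμ
    rw [map_zsmul]
    by_cases h : μ ∈ A.T
    · rw [A.ψ_e_of_mem h]
      simp
    · rw [A.ψ_e μ h, Pi.smul_apply, Pi.single_eq_of_ne hμ.symm, smul_zero]
  · simp

theorem ψ_lift_of_mem {z : Fin m → ℤ} (hz : z ∈ A.unitGroup) : A.ψ (A.lift z) = 0 := by
  ext ν
  by_cases hν : ν ∈ A.T
  · exact A.ψ_T _ ν hν
  · rw [A.ψ_lift_of_notMem z hν]
    exact hz ν hν

theorem sub_ψ_lift_mem (z : Fin m → ℤ) : z - A.ψ (A.lift z) ∈ A.unitGroup := fun ν hν => by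
  rw [Pi.sub_apply, A.ψ_lift_of_notMem z hν, sub_self]

end

section

variable {K N k m : ℕ} {Q : AddSubmonoid (Fin K → ℤ)} {φ : Fin N → Grp Q} {d : Fin k → Grp Q}
  (A : AdaptedFrame φ d m)

/-- The submonoid of `ℤᵐ` generated by the image of `Q` and the unit directions. -/
def preMonoid : AddSubmonoid (Fin m → ℤ) :=
  AddMonoidHom.mrange (A.ψ.comp (toGrp : Q →+ Grp Q)) ⊔ A.unitGroup.toAddSubmonoid

/-- The weakly toric monoid modelling the solution set. -/
def monoid : AddSubmonoid (Fin m → ℤ) := saturation A.preMonoid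

theorem preMonoid_fg (hQ : Q.FG) : A.preMonoid.FG := by
  refine AddSubmonoid.FG.sup ?_ ?_
  · have : AddMonoid.FG Q := (AddMonoid.fg_iff_addSubmonoid_fg Q).2 hQ
    rw [AddMonoidHom.mrange_eq_map]
    exact (AddMonoid.FG.fg_top (M := Q)).map _
  · rw [← AddSubgroup.fg_iff_addSubmonoid_fg]
    have : (AddSubgroup.toIntSubmodule A.unitGroup).FG := IsNoetherian.noetherian _
    simpa using (Submodule.fg_iff_addSubgroup_fg _).1 this

theorem isWeaklyToric_monoid (hQ : Q.FG) : IsWeaklyToric A.monoid :=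
  isWeaklyToric_saturation (A.preMonoid_fg hQ)

theorem mem_monoid_of_unit {z : Fin m → ℤ} (hz : z ∈ A.unitGroup) : z ∈ A.monoid :=
  le_saturation _ (AddSubmonoid.mem_sup_right hz)

theorem ψ_mem_monoid (q : Q) : A.ψ (toGrp q) ∈ A.monoid :=
  le_saturation _ (AddSubmonoid.mem_sup_left ⟨q, rfl⟩)

/-- The map `Q → A.monoid` induced by `ψ`. -/
def ψQ : Q →+ A.monoid where
  toFun q := ⟨A.ψ (toGrp q), A.ψ_mem_monoid q⟩
  map_zero' := Subtype.ext (by simp)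
  map_add' p q := Subtype.ext (by simp)

/-- Elements of the unit group as elements of the monoid. -/
def unit : A.unitGroup →+ A.monoid where
  toFun t := ⟨t, A.mem_monoid_of_unit t.2⟩
  map_zero' := rfl
  map_add' _ _ := rfl

@[simp] theorem coe_ψQ (q : Q) : (A.ψQ q : Fin m → ℤ) = A.ψ (toGrp q) := rfl

@[simp] theorem coe_unit (t : A.unitGroup) : (A.unit t : Fin m → ℤ) = t := rfl

theorem lam_unit_pos (t : A.unitGroup) (w : ModelSpace A.monoid) : 0 < lam (A.unit t) w := by
  refine (lam_nonneg _ _).lt_of_ne' fun h => ?_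
  have h1 : lam (A.unit (t + -t)) w = 1 := by rw [add_neg_cancel, map_zero, lam_zero]
  rw [map_add, lam_add, h, zero_mul] at h1
  exact zero_ne_one h1

theorem exists_nsmul_eq (p : A.monoid) :
    ∃ n : ℕ, 0 < n ∧ ∃ (q : Q) (t : A.unitGroup), n • p = A.ψQ q + A.unit t := by
  obtain ⟨n, hn, h⟩ := p.2
  obtain ⟨_, ⟨q, rfl⟩, t, ht, h⟩ := AddSubmonoid.mem_sup.1 h
  exact ⟨n, hn, q, ⟨t, ht⟩, Subtype.ext (by simpa using h.symm)⟩

/-- The image of `Q` generates the coordinates outside `T`, and the unit group contains those in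
`T`. Hence the model has the required dimension `m`. -/
theorem grp_monoid_eq_top : Grp A.monoid = ⊤ := by
  rw [eq_top_iff]
  intro z _
  have h1 : z - A.ψ (A.lift z) ∈ Grp A.monoid :=
    AddSubgroup.subset_closure (A.mem_monoid_of_unit (A.sub_ψ_lift_mem z))
  have h2 : A.ψ (A.lift z) ∈ Grp A.monoid := by
    obtain ⟨p, q, h⟩ := exists_eq_toGrp_sub (A.lift z)
    rw [h, map_sub]
    exact sub_mem (AddSubgroup.subset_closure (A.ψ_mem_monoid p))
      (AddSubgroup.subset_closure (A.ψ_mem_monoid q))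
  simpa using add_mem h1 h2

theorem monoidRank_monoid : monoidRank A.monoid = m := by
  have : monoidRank A.monoid = Module.finrank ℤ (⊤ : AddSubgroup (Fin m → ℤ)) := by
    rw [monoidRank, ← A.grp_monoid_eq_top]
  rw [this]
  have h2 : Module.finrank ℤ (⊤ : Submodule ℤ (Fin m → ℤ)) = m := by simp
  exact h2

end

end AdaptedFrame

namespace ModelSpace

theorem SmoothAt.comp_prod {K : ℕ} {P : AddSubmonoid (Fin K → ℤ)} {N : ℕ} {ι : Type} [Fintype ι]
    {f : Fin N → ModelSpace P → ℝ} {f' : ι → ModelSpace P → ℝ} {u : ModelSpace P}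
    (hf : ∀ i, SmoothAt (f i) u) (hf' : ∀ i, SmoothAt (f' i) u)
    {g : (Fin N → ℝ) × (ι → ℝ) → ℝ} (hg : ContDiff ℝ ∞ g) :
    SmoothAt (fun x => g (fun i => f i x, fun i => f' i x)) u := by
  let E := Fintype.equivFin (Fin N ⊕ ι)
  have key := SmoothAt.comp (u := u) (f := fun i => Sum.elim f f' (E.symm i))
    (fun i => by rcases h : E.symm i with j | j <;> simp [hf, hf'])
    (W := Set.univ) (g := fun z => g (fun i => z (E (Sum.inl i)), fun i => z (E (Sum.inr i))))
    isOpen_univ (hg.comp ((contDiff_pi.2 fun i => contDiff_apply ℝ ℝ _).prodMk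
      (contDiff_pi.2 fun i => contDiff_apply ℝ ℝ _))).contDiffOn trivial
  simpa using key

end ModelSpace

/-! ### Local structure of the closure of a solution set -/

section

variable {K N k l m n : ℕ} {Q : AddSubmonoid (Fin K → ℤ)}

open Classical in
/-- The generators in the support of `u`, the others being replaced by zero. -/
def faceGen (r : Fin N → Q) (u : ModelSpace Q) (i : Fin N) : Q := if lam (r i) u = 0 then 0 else r i

theorem lam_faceGen_ne_zero (r : Fin N → Q) (u : ModelSpace Q) (i : Fin N) :
    lam (faceGen r u i) u ≠ 0 := by
  rw [faceGen]
  split_ifs with h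
  · simp [lam_zero]
  · exact h

theorem exists_eq_sum_faceGen {r : Fin N → Q} (hr : Generates r) {u : ModelSpace Q} {f : Q}
    (hf : lam f u ≠ 0) : ∃ a : Fin N → ℕ, f = ∑ i, a i • faceGen r u i := by
  obtain ⟨a, rfl⟩ := hr f
  refine ⟨a, Finset.sum_congr rfl fun i _ => ?_⟩
  rw [lam_sum, Finset.prod_ne_zero_iff] at hf
  have := hf i (Finset.mem_univ i)
  rw [lam_nsmul] at this
  by_cases ha : a i = 0
  · simp [ha]
  · rw [faceGen, if_neg]
    intro h
    exact this (by rw [h, zero_pow ha])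

theorem eq_zero_of_faceGen {B : Type*} [AddCommMonoid B] {r : Fin N → Q} (hr : Generates r)
    {u : ModelSpace Q} {δ : Grp Q →+ B} (h : ∀ i, δ (toGrp (faceGen r u i)) = 0) {f : Q}
    (hf : lam f u ≠ 0) : δ (toGrp f) = 0 := by
  obtain ⟨a, rfl⟩ := exists_eq_sum_faceGen hr hf
  rw [map_sum, map_sum]
  exact Finset.sum_eq_zero fun i _ => by rw [map_nsmul, map_nsmul, h, nsmul_zero]

/-- The open set where the generators in the support of `u` do not vanish. -/
def faceOpen (r : Fin N → Q) (u : ModelSpace Q) : Set (ModelSpace Q) :=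
  {x | ∀ i, lam (faceGen r u i) x ≠ 0}

theorem isOpen_faceOpen (r : Fin N → Q) (u : ModelSpace Q) : IsOpen (faceOpen r u) := by
  rw [faceOpen, Set.ofPred_forall]
  exact isOpen_iInter_of_finite fun i => isOpen_ne_fun (continuous_lam _) continuous_const

theorem mem_faceOpen (r : Fin N → Q) (u : ModelSpace Q) : u ∈ faceOpen r u :=
  lam_faceGen_ne_zero r u

/-- The solutions in the interior of `X_Q` of the equations `d i + C i = 0` (in logarithmic
coordinates) and `H j = 0`. -/
def localSolution (r : Fin N → Q) (d : Fin k → Grp Q) (C : Fin k → (Fin N → ℝ) → ℝ)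
    (H : Fin l → (Fin N → ℝ) → ℝ) : Set (ModelSpace Q) :=
  {x | x ∈ interior Q ∧ (∀ i, logHom x (d i) + C i (lamv r x) = 0) ∧ ∀ j, H j (lamv r x) = 0}

theorem eq_of_mem_closure {X : Type*} [TopologicalSpace X] {s : Set X} {x : X} {f g : X → ℝ}
    (hx : x ∈ closure s) (hf : ContinuousAt f x) (hg : ContinuousAt g x)
    (h : ∀ᶠ y in 𝓝 x, y ∈ s → f y = g y) : f x = g x := by
  have := mem_closure_iff_nhdsWithin_neBot.1 hx
  exact tendsto_nhds_unique_of_eventuallyEq (hf.mono_left nhdsWithin_le_nhds)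
    (hg.mono_left nhdsWithin_le_nhds) (eventually_nhdsWithin_iff.2 h)

variable {r : Fin N → Q} {u : ModelSpace Q} {d : Fin k → Grp Q} {C : Fin k → (Fin N → ℝ) → ℝ}
  {H : Fin l → (Fin N → ℝ) → ℝ}

/-- By `A.inj` a functional is a linear function of its values on the units, on the `d i` and on the
`e μ` with `μ ∉ T`. For `log x - log x ∘ lift ∘ ψ` these values are `log λ` of units, `-C i` and
`0`, all of which are continuous across the boundary although `log x` is not defined there. -/
theorem exists_correction (A : AdaptedFrame (fun i => toGrp (faceGen r u i)) d m)
    (hC : ∀ i, Continuous (C i)) :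
    ∃ κ : ModelSpace Q → (Grp Q →+ ℝ),
      (∀ x ∈ faceOpen r u, ∀ g, ContinuousAt (fun x => κ x g) x) ∧
      ∀ x ∈ localSolution r d C H, ∀ g, κ x g = logHom x g - logHom x (A.lift (A.ψ g)) := by
  classical
  let M : (Grp Q →+ ℝ) →ₗ[ℝ] (Fin N ⊕ Fin k ⊕ Fin m → ℝ) :=
    { toFun := fun δ => Sum.elim (fun i => δ (toGrp (faceGen r u i)))
        (Sum.elim (fun i => δ (d i)) (fun μ => if μ ∈ A.T then 0 else δ (A.e μ)))
      map_add' := fun δ δ' => by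
        ext (i | i | i)
        · rfl
        · rfl
        · by_cases h : i ∈ A.T <;> simp [h]
      map_smul' := fun c δ => by
        ext (i | i | i)
        · rfl
        · rfl
        · by_cases h : i ∈ A.T <;> simp [h] }
  have hM : LinearMap.ker M = ⊥ := by
    rw [LinearMap.ker_eq_bot']
    intro δ hδ
    refine A.inj δ (fun i => congrFun hδ (Sum.inl i)) (fun i => congrFun hδ (Sum.inr (Sum.inl i)))
      fun μ hμ => ?_
    have := congrFun hδ (Sum.inr (Sum.inr μ))
    simpa [M, hμ] using this
  obtain ⟨B, hB⟩ := LinearMap.exists_leftInverse_of_injective M hM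
  let V : ModelSpace Q → (Fin N ⊕ Fin k ⊕ Fin m → ℝ) := fun x =>
    Sum.elim (fun i => Real.log (lam (faceGen r u i) x))
      (Sum.elim (fun i => -C i (lamv r x)) fun _ => 0)
  refine ⟨fun x => B (V x), fun x hx g => ?_, fun x hx g => ?_⟩
  · have hV : ContinuousAt V x := by
      refine continuousAt_pi.2 ?_
      rintro (i | i | i)
      · exact (continuous_lam _).continuousAt.log (hx i)
      · exact ((hC i).comp (continuous_lamv r)).neg.continuousAt
      · exact continuousAt_const
    let Bg : (Fin N ⊕ Fin k ⊕ Fin m → ℝ) →ₗ[ℝ] ℝ :=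
      { toFun := fun v => B v g, map_add' := fun v w => by simp, map_smul' := fun c v => by simp }
    exact (LinearMap.continuous_of_finiteDimensional Bg).continuousAt.comp hV
  · let δ : Grp Q →+ ℝ := logHom x - (logHom x).comp (A.lift.comp A.ψ)
    have hδ : M δ = V x := by
      ext (i | i | μ)
      · simp [M, V, δ, A.ψ_φ, logHom_toGrp hx.1]
      · have := hx.2.1 i
        simp only [M, V, δ, LinearMap.coe_mk, AddHom.coe_mk, Sum.elim_inr, Sum.elim_inl,
          AddMonoidHom.sub_apply, AddMonoidHom.comp_apply, A.ψ_d, map_zero]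
        linarith
      · by_cases h : μ ∈ A.T
        · simp [M, V, h]
        · simp [M, V, h, δ, A.ψ_e μ h, A.lift_single]
    have : B (M δ) = δ := LinearMap.congr_fun hB δ
    change B (V x) g = _
    rw [← hδ, this]
    rfl

/-- The formula for `J` on solutions involves logarithms. A multiple of `p` comes from `Q` and the
unit group, which rewrites `λ_p ∘ J` as a root of some `λ_q` times an exponential of the continuous
correction `κ`; this extends to the closure, and multiplicativity in `p` extends with it. -/
theorem exists_retraction (A : AdaptedFrame (fun i => toGrp (faceGen r u i)) d m)
    (hC : ∀ i, Continuous (C i)) :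
    ∃ J : ModelSpace Q → ModelSpace A.monoid,
      ContinuousOn J (faceOpen r u ∩ closure (localSolution r d C H)) ∧
      ∀ x ∈ localSolution r d C H, ∀ p, lam p (J x) = Real.exp (logHom x (A.lift p)) := by
  classical
  obtain ⟨κ, hκc, hκ⟩ := exists_correction (H := H) A hC
  set S := localSolution r d C H
  choose c hc q t hp using A.exists_nsmul_eq
  -- From `c p • p = ψ q + t`: on solutions `log x (lift ψ q) = log x (q) - κ(q)` and `log x (lift
  -- t) = κ(lift t)`, the latter because `ψ` kills lifts of units.
  let R : A.monoid → ModelSpace Q → ℝ := fun p x =>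
    lam (q p) x ^ ((c p : ℝ)⁻¹) * Real.exp ((κ x (A.lift (t p)) - κ x (toGrp (q p))) / c p)
  have hR0 : ∀ p x, 0 ≤ R p x := fun p x =>
    mul_nonneg (Real.rpow_nonneg (lam_nonneg _ _) _) (Real.exp_pos _).le
  have hRc : ∀ p, ∀ x ∈ faceOpen r u, ContinuousAt (R p) x := by
    intro p x hx
    refine ContinuousAt.mul ?_ (Real.continuous_exp.continuousAt.comp
      (((hκc x hx _).sub (hκc x hx _)).div_const _))
    exact (continuous_lam _).continuousAt.rpow_const (Or.inr (by positivity))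
  have hRS : ∀ p, ∀ x ∈ S, R p x = Real.exp (logHom x (A.lift p)) := by
    intro p x hx
    have hn : (0 : ℝ) < c p := by exact_mod_cast hc p
    have h1 : logHom x (A.lift p) * c p =
        logHom x (A.lift (A.ψ (toGrp (q p)))) + logHom x (A.lift (t p)) := by
      have h2 : c p • (p : Fin m → ℤ) = A.ψ (toGrp (q p)) + (t p : Fin m → ℤ) := by
        have := congrArg (fun z : A.monoid => (z : Fin m → ℤ)) (hp p)
        simpa using this
      rw [← map_add, ← map_add, ← h2, map_nsmul, map_nsmul, nsmul_eq_mul, mul_comm]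
    simp only [R]
    rw [← exp_logHom hx.1, ← Real.exp_mul, ← Real.exp_add, hκ x hx, hκ x hx,
      A.ψ_lift_of_mem (t p).2, map_zero, map_zero, sub_zero]
    congr 1
    field_simp
    linarith
  have hX : ∀ x ∈ faceOpen r u ∩ closure S, ∀ f g : ModelSpace Q → ℝ, ContinuousAt f x →
      ContinuousAt g x → (∀ y ∈ S, f y = g y) → f x = g x := fun x hx f g hf hg h =>
    eq_of_mem_closure hx.2 hf hg (Eventually.of_forall h)
  have h1 : ∀ x ∈ faceOpen r u ∩ closure S, R 0 x = 1 := fun x hx =>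
    hX x hx _ _ (hRc 0 x hx.1) continuousAt_const fun y hy => by
      rw [hRS 0 y hy]
      simp
  have hadd : ∀ x ∈ faceOpen r u ∩ closure S, ∀ p p', R (p + p') x = R p x * R p' x :=
    fun x hx p p' => hX x hx _ _ (hRc _ x hx.1) ((hRc p x hx.1).mul (hRc p' x hx.1)) fun y hy => by
      rw [Pi.mul_apply, hRS _ y hy, hRS _ y hy, hRS _ y hy, ← Real.exp_add, AddSubmonoid.coe_add, map_add,
        map_add]
  let J : ModelSpace Q → ModelSpace A.monoid := fun x =>
    if hx : x ∈ faceOpen r u ∩ closure S then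
      ofFun (fun p => R p x) (fun p => hR0 p x) (h1 x hx) (hadd x hx)
    else expPt 0
  have hJ : ∀ x ∈ faceOpen r u ∩ closure S, ∀ p, lam p (J x) = R p x := by
    intro x hx p
    simp only [J, dif_pos hx]
    rfl
  refine ⟨J, fun x hx => ?_, fun x hx p => ?_⟩
  · rw [ContinuousWithinAt, tendsto_nhds_iff]
    intro p
    rw [hJ x hx p]
    refine ((hRc p x hx.1).continuousWithinAt (s := faceOpen r u ∩ closure S)).congr' ?_
    filter_upwards [self_mem_nhdsWithin] with y hy
    rw [hJ y hy]
  · have hx' : x ∈ faceOpen r u ∩ closure S := ⟨fun i => (hx.1 _).ne', subset_closure hx⟩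
    rw [hJ x hx', hRS p x hx]

end

section

variable {K N k l m n : ℕ} {Q : AddSubmonoid (Fin K → ℤ)}
  {r : Fin N → Q} {u : ModelSpace Q} {d : Fin k → Grp Q} {C : Fin k → (Fin N → ℝ) → ℝ}
  {H : Fin l → (Fin N → ℝ) → ℝ}

/-- Near a point of the closure, the closure of a nondegenerate solution set is parametrized by an
open subset of a model space. -/
theorem exists_local_parametrization (hQ : IsWeaklyToric Q)
    (b : Module.Basis (Fin n) ℤ (Grp Q)) (hm : m + k + l = n)
    (hC : ∀ i, ContDiff ℝ ∞ (C i)) (hH : ∀ j, ContDiff ℝ ∞ (H j))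
    (hu : u ∈ closure (localSolution r d C H))
    (A : AdaptedFrame (fun i => toGrp (faceGen r u i)) d m)
    (hdet : ∀ δ : Grp Q →+ ℝ,
      (∀ i, δ (d i) + fderiv ℝ (C i) (lamv r u) (fun j => lam (r j) u * δ (toGrp (r j))) = 0) →
      (∀ j, fderiv ℝ (H j) (lamv r u) (fun j => lam (r j) u * δ (toGrp (r j))) = 0) →
      (∀ μ, δ (A.e μ) = 0) → δ = 0) :
    ∃ (Ψ : ModelSpace A.monoid → ModelSpace Q) (J : ModelSpace Q → ModelSpace A.monoid)
      (W : Set (ModelSpace A.monoid)) (O : Set (ModelSpace Q)),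
      IsOpen W ∧ IsOpen O ∧ u ∈ O ∧ O ⊆ faceOpen r u ∧
      (∀ q, ∃ c : ModelSpace A.monoid → ℝ, (∀ w, SmoothAt c w) ∧
        ∀ w, lam q (Ψ w) = lam (A.ψQ q) w * Real.exp (c w)) ∧
      (∀ w ∈ W, Ψ w ∈ O ∩ closure (localSolution r d C H) ∧ J (Ψ w) = w) ∧
      (∀ x ∈ O ∩ closure (localSolution r d C H), J x ∈ W ∧ Ψ (J x) = x) ∧
      ContinuousOn J (O ∩ closure (localSolution r d C H)) ∧
      ∀ x ∈ localSolution r d C H, ∀ p, lam p (J x) = Real.exp (logHom x (A.lift p)) := by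
  classical
  have hCc : ∀ i, Continuous (C i) := fun i => (hC i).continuous
  have hHc : ∀ i, Continuous (H i) := fun i => (hH i).continuous
  obtain ⟨κ, hκc, hκ⟩ := exists_correction (H := H) A hCc
  obtain ⟨J, hJc, hJ⟩ := exists_retraction (H := H) A hCc
  have hP := A.isWeaklyToric_monoid hQ.1
  set S := localSolution r d C H
  set X := faceOpen r u ∩ closure S
  have huX : u ∈ X := ⟨mem_faceOpen r u, hu⟩
  have hSX : S ⊆ X := fun x hx => ⟨fun i => (hx.1 _).ne', subset_closure hx⟩
  have hX : ∀ x ∈ X, ∀ f g : ModelSpace Q → ℝ, ContinuousWithinAt f X x →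
      ContinuousWithinAt g X x → (∀ y ∈ S, f y = g y) → f x = g x := fun x hx f g hf hg h => by
    have : (𝓝[S] x).NeBot := mem_closure_iff_nhdsWithin_neBot.1 hx.2
    exact tendsto_nhds_unique_of_eventuallyEq (hf.mono_left (nhdsWithin_mono x hSX))
      (hg.mono_left (nhdsWithin_mono x hSX)) (by filter_upwards [self_mem_nhdsWithin] using h)
  have hκw : ∀ x ∈ X, ∀ g, ContinuousWithinAt (fun x => κ x g) X x := fun x hx g =>
    (hκc x hx.1 g).continuousWithinAt
  have hlamw : ∀ (q : Q) (x : ModelSpace Q), ContinuousWithinAt (lam q) X x := fun q x =>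
    (continuous_lam q).continuousWithinAt
  have hJw : ∀ x ∈ X, ∀ p, ContinuousWithinAt (fun x => lam p (J x)) X x := fun x hx p =>
    tendsto_nhds_iff.1 (hJc x hx) p
  -- the equations satisfied by `κ`
  have hκlam : ∀ x ∈ X, ∀ q, lam (A.ψQ q) (J x) * Real.exp (κ x (toGrp q)) = lam q x := by
    intro x hx q
    refine hX x hx (fun x => lam (A.ψQ q) (J x) * Real.exp (κ x (toGrp q))) (lam q)
      ((hJw x hx _).mul (Real.continuous_exp.continuousAt.comp_continuousWithinAt (hκw x hx _)))
      (hlamw q x) fun y hy => ?_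
    rw [hJ y hy, hκ y hy, ← Real.exp_add, A.coe_ψQ, add_sub_cancel, exp_logHom hy.1]
  have hCX : ∀ i, ∀ x, ContinuousWithinAt (fun x => C i (lamv r x)) X x := fun i x =>
    ((hCc i).comp (continuous_lamv r)).continuousWithinAt
  have hκd : ∀ x ∈ X, ∀ i, κ x (d i) + C i (lamv r x) = 0 := by
    intro x hx i
    refine hX x hx (fun x => κ x (d i) + C i (lamv r x)) (fun _ => 0)
      ((hκw x hx _).add (hCX i x)) continuousWithinAt_const fun y hy => ?_
    rw [hκ y hy, A.ψ_d, map_zero, map_zero, sub_zero]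
    exact hy.2.1 i
  have hHX : ∀ x ∈ X, ∀ j, H j (lamv r x) = 0 := fun x hx j =>
    hX x hx (fun x => H j (lamv r x)) (fun _ => 0)
      ((hHc j).comp (continuous_lamv r)).continuousWithinAt continuousWithinAt_const
      fun y hy => hy.2.2 j
  -- For `μ ∈ T` the value of `κ` at `e μ` is the logarithm of a unit coordinate of the chart; for
  -- `μ ∉ T` it is zero. The choice `σ μ = 0`, with `λ_0 = 1`, treats both cases by one formula.
  let σ : Fin m → A.monoid := fun μ =>
    if hμ : μ ∈ A.T then A.unit ⟨_, A.single_mem_unitGroup hμ⟩ else 0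
  have hσT : ∀ μ, (hμ : μ ∈ A.T) → ((σ μ : A.monoid) : Fin m → ℤ) = Pi.single μ 1 := fun μ hμ => by
    simp [σ, hμ]
  have hσ0 : ∀ μ ∉ A.T, σ μ = 0 := fun μ hμ => by simp [σ, hμ]
  have hσpos : ∀ μ w, 0 < lam (σ μ) w := fun μ w => by
    by_cases hμ : μ ∈ A.T
    · simp only [σ, dif_pos hμ]
      exact A.lam_unit_pos _ w
    · rw [hσ0 μ hμ, lam_zero]
      exact one_pos
  have hκe : ∀ x ∈ X, ∀ μ, κ x (A.e μ) = Real.log (lam (σ μ) (J x)) := by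
    intro x hx μ
    have h1 : Real.exp (κ x (A.e μ)) = lam (σ μ) (J x) := by
      refine hX x hx (fun x => Real.exp (κ x (A.e μ))) (fun x => lam (σ μ) (J x))
        (Real.continuous_exp.continuousAt.comp_continuousWithinAt (hκw x hx _)) (hJw x hx _)
        fun y hy => ?_
      rw [hJ y hy, hκ y hy]
      by_cases hμ : μ ∈ A.T
      · rw [hσT μ hμ, A.lift_single, A.ψ_e_of_mem hμ, map_zero, map_zero, sub_zero]
      · rw [hσ0 μ hμ, A.ψ_e μ hμ, A.lift_single]
        simp
    rw [← h1, Real.log_exp]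
  -- the implicit function
  let ι := Fin k ⊕ Fin l ⊕ Fin m
  let D : ι → Grp Q := Sum.elim d (Sum.elim (fun _ => 0) A.e)
  let E : ι → (Fin N → ℝ) → ℝ := Sum.elim C (Sum.elim H fun _ _ => 0)
  have hE : ∀ i, ContDiff ℝ ∞ (E i) := by
    rintro (i | i | i)
    exacts [hC i, hH i, contDiff_const]
  let z : ModelSpace A.monoid → Fin N → ℝ := fun w j => lam (A.ψQ (r j)) w
  let τ : ModelSpace A.monoid → ι → ℝ := fun w =>
    Sum.elim (fun _ => 0) (Sum.elim (fun _ => 0) fun μ => Real.log (lam (σ μ) w))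
  have hzr : ∀ x ∈ X, (fun j => z (J x) j * Real.exp (κ x (toGrp (r j)))) = lamv r x :=
    fun x hx => funext fun j => hκlam x hx (r j)
  have heq : ∀ x ∈ X, ∀ i, κ x (D i) + E i (fun j => z (J x) j * Real.exp (κ x (toGrp (r j)))) =
      τ (J x) i := by
    intro x hx i
    rw [hzr x hx]
    rcases i with i | i | i
    · exact hκd x hx i
    · simpa [D, E, τ] using hHX x hx i
    · simpa [D, E, τ] using hκe x hx i
  obtain ⟨Θ, hΘs, hΘ0, hΘu, hΘe⟩ := exists_implicit_hom b (fun j => toGrp (r j)) D E hE (z (J u))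
    (τ (J u)) (κ u) (heq u huX) (by
      intro δ hδ
      have hz : (fun j => z (J u) j * Real.exp (κ u (toGrp (r j))) * δ (toGrp (r j))) =
          fun j => lam (r j) u * δ (toGrp (r j)) :=
        funext fun j => by rw [congrFun (hzr u huX) j]; rfl
      rw [hzr u huX, hz] at hδ
      refine hdet δ (fun i => hδ (Sum.inl i)) (fun j => ?_) fun μ => ?_
      · simpa [D, E] using hδ (Sum.inr (Sum.inl j))
      · simpa [D, E] using hδ (Sum.inr (Sum.inr μ)))
  have hcard : Fintype.card ι = n := by
    simp only [ι, Fintype.card_sum, Fintype.card_fin]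
    omega
  have hzs : ∀ j w, SmoothAt (fun w => z w j) w := fun j w => smoothAt_lam _ w
  have hτs : ∀ i w, SmoothAt (fun w => τ w i) w := by
    rintro (i | i | i) w
    · exact smoothAt_const 0 w
    · exact smoothAt_const 0 w
    · exact (smoothAt_lam _ w).log (hσpos i w).ne'
  let θ : ModelSpace A.monoid → (Grp Q →+ ℝ) := fun w => Θ (z w, τ w)
  have hθs : ∀ g w, SmoothAt (fun w => θ w g) w := fun g w =>
    SmoothAt.comp_prod (f := fun j w => z w j) (f' := fun i w => τ w i) (fun j => hzs j w)
      (fun i => hτs i w) (hΘs g)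
  -- The relation `λ_q(x) = λ_{ψ q}(J x) · exp κ(q)`, valid on the closure, is inverted by replacing
  -- `κ` with the implicit function `θ`.
  let Ψ : ModelSpace A.monoid → ModelSpace Q := fun w =>
    ofFun (fun q => lam (A.ψQ q) w * Real.exp (θ w (toGrp q)))
      (fun q => mul_nonneg (lam_nonneg _ _) (Real.exp_pos _).le) (by simp [lam_zero])
      (fun p q => by simp only [map_add, lam_add, Real.exp_add]; ring)
  have hΨ : ∀ w q, lam q (Ψ w) = lam (A.ψQ q) w * Real.exp (θ w (toGrp q)) := fun _ _ => rfl
  have hΨs : ∀ w q, SmoothAt (fun w => lam q (Ψ w)) w := fun w q =>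
    (smoothAt_lam _ w).mul (hθs _ w).exp
  have hΨc : Continuous Ψ := continuous_iff_continuousAt.2 fun w =>
    continuousAt_iff.2 fun q => (hΨs w q).continuousAt
  have hzτ : Continuous fun w => (z w, τ w) :=
    (continuous_pi fun j => continuous_iff_continuousAt.2 fun w => (hzs j w).continuousAt).prodMk
      (continuous_pi fun i => continuous_iff_continuousAt.2 fun w => (hτs i w).continuousAt)
  have hzτJ : Tendsto (fun x => (z (J x), τ (J x))) (𝓝[X] u) (𝓝 (z (J u), τ (J u))) :=
    (hzτ.tendsto (J u)).comp (hJc u huX)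
  -- On the closure `κ x` solves the system with parameters taken at `J x`, so uniqueness of the
  -- implicit solution identifies it with `θ (J x)`.
  have hΨJ : ∀ᶠ x in 𝓝[X] u, Ψ (J x) = x := by
    have h1 := hΘu (hzτJ.fst_nhds) (hzτJ.snd_nhds) (fun g => hκw u huX g)
      (by filter_upwards [self_mem_nhdsWithin] with x hx using heq x hx)
    filter_upwards [h1, self_mem_nhdsWithin] with x h2 hx
    refine ModelSpace.ext fun q => ?_
    change lam (A.ψQ q) (J x) * Real.exp (Θ (z (J x), τ (J x)) (toGrp q)) = _
    rw [← h2, hκlam x hx]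
  -- That `θ w` really solves the system uses the count `hcard`; this places `Ψ w` in the solution
  -- set when `w` is interior, and in its closure otherwise.
  have hW₁ : ∀ᶠ w in 𝓝 (J u), ∀ i, θ w (D i) +
      E i (fun j => z w j * Real.exp (θ w (toGrp (r j)))) = τ w i :=
    (hzτ.tendsto (J u)).eventually (hΘe hcard)
  obtain ⟨W₁, hW₁e, hW₁o, huW₁⟩ := eventually_nhds_iff.1 hW₁
  have hint : ∀ w ∈ interior A.monoid, Ψ w ∈ interior Q := fun w hw q =>
    mul_pos (hw _) (Real.exp_pos _)
  have hlog : ∀ w ∈ interior A.monoid, ∀ q : Q,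
      logHom (Ψ w) (toGrp q) = logHom w (toGrp (A.ψQ q)) + θ w (toGrp q) := by
    intro w hw q
    rw [logHom_toGrp (hint w hw), hΨ, Real.log_mul (hw _).ne' (Real.exp_pos _).ne', Real.log_exp,
      logHom_toGrp hw]
  let ψG : Grp Q →+ Grp A.monoid :=
    { toFun := fun g => ⟨A.ψ g, by rw [A.grp_monoid_eq_top]; trivial⟩
      map_zero' := Subtype.ext (map_zero _)
      map_add' := fun _ _ => Subtype.ext (map_add _ _ _) }
  have hlog' : ∀ w ∈ interior A.monoid, ∀ g, logHom (Ψ w) g = logHom w (ψG g) + θ w g := by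
    intro w hw g
    have : logHom (Ψ w) = (logHom w).comp ψG + θ w := grp_hom_ext (hlog w hw)
    rw [this]
    rfl
  have hψG0 : ∀ g, A.ψ g = 0 → ψG g = 0 := fun g hg => Subtype.ext hg
  have hΨr : ∀ w, lamv r (Ψ w) = fun j => z w j * Real.exp (θ w (toGrp (r j))) := fun _ => rfl
  have hΨS : ∀ w ∈ W₁, w ∈ interior A.monoid → Ψ w ∈ S := by
    intro w hw hwi
    have h1 := hW₁e w hw
    simp only [← hΨr] at h1
    refine ⟨hint w hwi, fun i => ?_, fun j => ?_⟩
    · rw [hlog' w hwi, hψG0 _ (A.ψ_d i), map_zero, zero_add]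
      exact h1 (Sum.inl i)
    · simpa [D, E, τ] using h1 (Sum.inr (Sum.inl j))
  have hΨX : ∀ w ∈ W₁, Ψ w ∈ closure S := by
    intro w hw
    have := nhdsWithin_interior_neBot hP w
    refine mem_closure_of_tendsto (b := 𝓝[interior A.monoid] w)
      (hΨc.continuousAt.mono_left nhdsWithin_le_nhds) ?_
    rw [eventually_nhdsWithin_iff]
    filter_upwards [hW₁o.mem_nhds hw] with w' hw' hi
    exact hΨS w' hw' hi
  have hτe : ∀ w ∈ W₁, ∀ μ, θ w (A.e μ) = Real.log (lam (σ μ) w) := by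
    intro w hw μ
    simpa [D, E, τ] using hW₁e w hw (Sum.inr (Sum.inr μ))
  have hJΨi : ∀ w ∈ W₁, w ∈ interior A.monoid → J (Ψ w) = w := by
    intro w hw hwi
    refine ModelSpace.ext fun p => ?_
    rw [hJ _ (hΨS w hw hwi), ← exp_logHom hwi p, hlog' w hwi]
    congr 1
    -- Coordinates of `p` outside `T` are recovered by `ψ ∘ lift`, those in `T` by the units `σ μ`.
    have h1 : (toGrp p : Grp A.monoid) = ψG (A.lift p) + ∑ μ, (p : Fin m → ℤ) μ • toGrp (σ μ) := by
      refine Subtype.ext (funext fun ν => ?_)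
      rw [AddSubgroup.coe_add, AddSubgroup.val_finsetSum, Pi.add_apply, Finset.sum_apply]
      have h2 : ((ψG (A.lift p) : Grp A.monoid) : Fin m → ℤ) = A.ψ (A.lift p) := rfl
      rw [h2, coe_toGrp, Finset.sum_eq_single ν]
      · by_cases hν : ν ∈ A.T
        · rw [A.ψ_T _ ν hν, AddSubgroup.coe_zsmul, coe_toGrp, hσT ν hν]
          simp
        · rw [A.ψ_lift_of_notMem _ hν, hσ0 ν hν]
          simp
      · intro μ _ hμ
        rw [AddSubgroup.coe_zsmul, coe_toGrp]
        by_cases hμT : μ ∈ A.T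
        · rw [hσT μ hμT, Pi.smul_apply, Pi.single_eq_of_ne hμ.symm, smul_zero]
        · rw [hσ0 μ hμT]
          simp
      · simp
    rw [h1, map_add, map_sum, A.lift_apply, map_sum (θ w)]
    congr 1
    refine Finset.sum_congr rfl fun μ _ => ?_
    rw [map_zsmul, map_zsmul, hτe w hw, logHom_toGrp hwi]
  -- `J` is known to be continuous only on the closure inside `faceOpen r u`. There `J ∘ Ψ = id`
  -- extends from interior points by density.
  let W₂ : Set (ModelSpace A.monoid) := W₁ ∩ Ψ ⁻¹' faceOpen r u
  have hW₂o : IsOpen W₂ := hW₁o.inter ((isOpen_faceOpen r u).preimage hΨc)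
  have hJΨ : ∀ w ∈ W₂, J (Ψ w) = w := by
    intro w hw
    refine ModelSpace.ext fun p => ?_
    have hc : ∀ᶠ w' in 𝓝 w, ContinuousAt (fun w => lam p (J (Ψ w))) w' := by
      filter_upwards [hW₂o.mem_nhds hw] with w' hw'
      have h1 := hJw (Ψ w') ⟨hw'.2, hΨX w' hw'.1⟩ p
      have h2 : Tendsto Ψ (𝓝 w') (𝓝[X] (Ψ w')) := tendsto_nhdsWithin_iff.2
        ⟨hΨc.continuousAt, by
          filter_upwards [hW₂o.mem_nhds hw'] with w'' hw''
          exact ⟨hw''.2, hΨX w'' hw''.1⟩⟩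
      exact Tendsto.comp (g := fun x => lam p (J x)) h1 h2
    refine (eventuallyEq_of_interior hP hc (Eventually.of_forall fun _ =>
      (continuous_lam p).continuousAt) ?_).self_of_nhds
    filter_upwards [hW₂o.mem_nhds hw] with w' hw' hi
    rw [hJΨi w' hw'.1 hi]
  have hΨJu : Ψ (J u) = u := hΨJ.self_of_nhdsWithin huX
  have huW₂ : J u ∈ W₂ := ⟨huW₁, by
    change Ψ (J u) ∈ faceOpen r u
    rw [hΨJu]; exact mem_faceOpen r u⟩
  obtain ⟨O₁, hO₁o, huO₁, hO₁⟩ := mem_nhdsWithin.1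
    (hΨJ.and ((hJc u huX).eventually (hW₂o.mem_nhds huW₂)))
  have hsub : (O₁ ∩ faceOpen r u) ∩ closure S ⊆ X := fun x hx => ⟨hx.1.2, hx.2⟩
  refine ⟨Ψ, J, W₂ ∩ Ψ ⁻¹' (O₁ ∩ faceOpen r u), O₁ ∩ faceOpen r u,
    hW₂o.inter ((hO₁o.inter (isOpen_faceOpen r u)).preimage hΨc),
    hO₁o.inter (isOpen_faceOpen r u), ⟨huO₁, mem_faceOpen r u⟩, Set.inter_subset_right,
    fun q => ⟨fun w => θ w (toGrp q), hθs _, fun w => hΨ w q⟩,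
    fun w hw => ⟨⟨hw.2, hΨX w hw.1.1⟩, hJΨ w hw.1⟩, fun x hx => ?_, hJc.mono hsub, hJ⟩
  obtain ⟨h1, h2⟩ := hO₁ ⟨hx.1.1, hsub hx⟩
  exact ⟨⟨h2, by rw [Set.mem_preimage, h1]; exact hx.1⟩, h1⟩

/-- The functions `λ_p` on the chart are quotients of functions `λ_q` of the ambient space. -/
theorem AdaptedFrame.exists_eq_lift
    (A : AdaptedFrame (fun i => toGrp (faceGen r u i)) d m) (p : A.monoid) :
    ∃ q₁ q₂ : Q, A.lift p = toGrp q₁ - toGrp q₂ ∧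
      ((p : Fin m → ℤ) ∈ A.unitGroup → lam q₁ u ≠ 0 ∧ lam q₂ u ≠ 0) := by
  by_cases hp : (p : Fin m → ℤ) ∈ A.unitGroup
  · let F : AddSubmonoid (Grp Q) := (supp u).comap (Grp Q).subtype
    have hF : ∀ g ∈ F, ∃ q : Q, g = toGrp q ∧ lam q u ≠ 0 := by
      rintro g ⟨q, hq, hqu⟩
      exact ⟨q, Subtype.ext hq.symm, hqu⟩
    have h1 : A.lift p ∈ AddSubgroup.closure (F : Set (Grp Q)) := by
      rw [A.lift_apply]
      refine sum_mem fun μ _ => ?_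
      by_cases hμ : μ ∈ A.T
      · obtain ⟨i, hi⟩ := A.e_mem μ hμ
        rw [hi]
        refine zsmul_mem (AddSubgroup.subset_closure ?_) _
        exact mem_supp.2 (lam_faceGen_ne_zero r u i)
      · rw [hp μ hμ, zero_smul]
        exact zero_mem _
    obtain ⟨a, ha, b, hb, h⟩ := mem_addSubgroupClosure_iff.1 h1
    obtain ⟨q₁, rfl, h₁⟩ := hF a ha
    obtain ⟨q₂, rfl, h₂⟩ := hF b hb
    exact ⟨q₁, q₂, h, fun _ => ⟨h₁, h₂⟩⟩
  · obtain ⟨q₁, q₂, h⟩ := exists_eq_toGrp_sub (A.lift p)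
    exact ⟨q₁, q₂, h, fun h' => (hp h').elim⟩

end

/-! ### Transition maps, and independence of the chart for smooth and interior functions -/

section

variable {n : ℕ} {X : Type*} [TopologicalSpace X]

theorem GChart.Compatible.symm {c d : GChart n X} (h : c.Compatible d) : d.Compatible c :=
  ⟨h.2, h.1⟩

theorem GChart.tendsto_transition {m n : ℕ} {c : GChart m X} {d : GChart n X} {u : ModelSpace c.P}
    {v : ModelSpace d.P} (hu : u ∈ c.φ.source) (hv : v ∈ d.φ.source) (h : d.φ v = c.φ u) :
    Tendsto (fun y => c.φ.symm (d.φ y)) (𝓝 v) (𝓝 u) := by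
  have h1 : ContinuousAt c.φ.symm (d.φ v) :=
    c.φ.continuousAt_symm (by rw [h]; exact c.φ.map_source hu)
  have h2 := (h1.comp (d.φ.continuousAt hv)).tendsto
  rwa [Function.comp_apply, h, c.φ.left_inv hu] at h2

theorem GChart.eventually_mem_target {m n : ℕ} {c : GChart m X} {d : GChart n X}
    {u : ModelSpace c.P} {v : ModelSpace d.P} (hu : u ∈ c.φ.source) (hv : v ∈ d.φ.source)
    (h : d.φ v = c.φ u) : ∀ᶠ y in 𝓝 v, d.φ y ∈ c.φ.target :=
  (d.φ.continuousAt hv).eventually (c.φ.open_target.mem_nhds (by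
    rw [h]; exact c.φ.map_source hu))

/-- If `λ_q` of the transition map vanished near `u`, then composing with the inverse transition
would make `λ_q` itself vanish on an open set, contradicting density of the interior. -/
theorem GChart.Compatible.interiorAt {c d : GChart n X} (h : c.Compatible d) {u : ModelSpace c.P}
    (hu : u ∈ c.φ.source) (hud : c.φ u ∈ d.φ.target) (q : d.P) :
    ModelSpace.InteriorAt (fun z => lam q (d.φ.symm (c.φ z))) u := by
  rcases h.1 u hu hud q with h0 | h0
  · exact h0
  exfalso
  set v := d.φ.symm (c.φ u)
  have hv : v ∈ d.φ.source := d.φ.map_target hud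
  have hdv : d.φ v = c.φ u := d.φ.right_inv hud
  refine (interiorAt_lam q v).not_eventually_zero d.weaklyToric ?_
  filter_upwards [(GChart.tendsto_transition hu hv hdv).eventually h0,
    d.φ.open_source.mem_nhds hv, GChart.eventually_mem_target hu hv hdv] with y h1 h2 h3
  rwa [c.φ.right_inv h3, d.φ.left_inv h2] at h1

namespace GCornersStructure

variable {S : GCornersStructure n X} {c : GChart n X} {u : ModelSpace c.P} {a : X → ℝ}

theorem smoothAt_iff (hc : c ∈ S.charts) (hu : u ∈ c.φ.source) :
    S.SmoothAt a (c.φ u) ↔ ModelSpace.SmoothAt (fun z => a (c.φ z)) u := by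
  refine ⟨fun h => h c hc u hu rfl, fun h d hd v hv hvu => ?_⟩
  have hvc : d.φ v ∈ c.φ.target := by rw [hvu]; exact c.φ.map_source hu
  have h1 := (S.compatible d hd c hc).1 v hv hvc
  refine (ModelSpace.SmoothAt.comp_smoothMapAt (f := fun z => a (c.φ z)) h1 ?_).congr ?_
  · rwa [hvu, c.φ.left_inv hu]
  · filter_upwards [GChart.eventually_mem_target hu hv hvu] with y hy
    rw [c.φ.right_inv hy]

theorem interiorAt_iff (hc : c ∈ S.charts) (hu : u ∈ c.φ.source) :
    S.InteriorAt a (c.φ u) ↔ ModelSpace.InteriorAt (fun z => a (c.φ z)) u := by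
  refine ⟨fun h => h c hc u hu rfl, fun h d hd v hv hvu => ?_⟩
  have hvc : d.φ v ∈ c.φ.target := by rw [hvu]; exact c.φ.map_source hu
  have h1 := (S.compatible d hd c hc).interiorAt hv hvc
  refine (ModelSpace.InteriorAt.comp_interior (f := fun z => a (c.φ z)) h1 ?_).congr ?_
  · rwa [hvu, c.φ.left_inv hu]
  · filter_upwards [GChart.eventually_mem_target hu hv hvu] with y hy
    rw [c.φ.right_inv hy]

theorem interiorAt_lam_symm (hc : c ∈ S.charts) (hu : u ∈ c.φ.source) (p : c.P) :
    S.InteriorAt (fun x => lam p (c.φ.symm x)) (c.φ u) := by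
  rw [interiorAt_iff hc hu]
  refine (interiorAt_lam p u).congr ?_
  filter_upwards [c.φ.open_source.mem_nhds hu] with z hz
  rw [c.φ.left_inv hz]

theorem mem_interior_iff (hc : c ∈ S.charts) (hu : u ∈ c.φ.source) :
    c.φ u ∈ S.interior ↔ u ∈ ModelSpace.interior c.P := by
  refine ⟨?_, fun h => ⟨c, hc, u, hu, rfl, h⟩⟩
  rintro ⟨d, hd, v, hv, hvu, hvi⟩ p
  have hvc : d.φ v ∈ c.φ.target := by rw [hvu]; exact c.φ.map_source hu
  have := ((S.compatible d hd c hc).interiorAt hv hvc p).eventually_pos.self_of_nhds hvi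
  rwa [hvu, c.φ.left_inv hu] at this

/-- A map is smooth if it pulls back the functions `λ_q` of suitable charts to interior maps. -/
theorem isSmoothMap_of_interiorAt {m : ℕ} {Y : Type*} [TopologicalSpace Y]
    {T : GCornersStructure m Y} {f : X → Y} (hf : Continuous f)
    (h : ∀ x, ∃ d ∈ T.charts, f x ∈ d.φ.target ∧
      ∀ q, S.InteriorAt (fun z => lam q (d.φ.symm (f z))) x) : S.IsSmoothMap T f := by
  refine ⟨hf, fun c hc d hd u hu hud q => Or.inl ?_⟩
  obtain ⟨e, he, hue, h⟩ := h (c.φ u)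
  set v := e.φ.symm (f (c.φ u)) with hv
  have hve : v ∈ e.φ.source := e.φ.map_target hue
  have hev : e.φ v = f (c.φ u) := e.φ.right_inv hue
  have h1 := (T.compatible e he d hd).interiorAt hve (by rwa [hev]) q
  refine (ModelSpace.InteriorAt.comp_interior (F := fun z => e.φ.symm (f (c.φ z)))
    (f := fun z => lam q (d.φ.symm (e.φ z))) (fun q => h q c hc u hu rfl) h1).congr ?_
  filter_upwards [(hf.continuousAt.comp (c.φ.continuousAt hu)).eventually
    (e.φ.open_target.mem_nhds hue)] with z hz
  have hz' : e.φ (e.φ.symm (f (c.φ z))) = f (c.φ z) := e.φ.right_inv hz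
  rw [hz']

end GCornersStructure

/-! ### Germs in a chart -/

namespace GCornersStructure

variable {S : GCornersStructure n X} {c : GChart n X} {u : ModelSpace c.P} {a b : X → ℝ} {x : X}

theorem germ_value_mul (s t : Germ (𝓝 x) ℝ) : (s * t).value = s.value * t.value := by
  induction s, t using Germ.inductionOn₂
  rfl

theorem germ_eq_iff (hu : u ∈ c.φ.source) :
    (a : Germ (𝓝 (c.φ u)) ℝ) = (b : Germ (𝓝 (c.φ u)) ℝ) ↔
      ∀ᶠ z in 𝓝 u, a (c.φ z) = b (c.φ z) := by
  rw [Germ.coe_eq, ← c.φ.map_nhds_eq hu]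
  rfl

/-- The germ of an interior map, as an element of the monoid of germs of interior maps. -/
def interiorGerm (S : GCornersStructure n X) (b : X → ℝ) (hb : S.InteriorAt b x) :
    S.interiorGerms x := ⟨(b : Germ (𝓝 x) ℝ), b, hb, rfl⟩

/-- The germ of a smooth function, as an element of the algebra of germs of smooth functions. -/
def smoothGerm (S : GCornersStructure n X) (a : X → ℝ) (ha : S.SmoothAt a x) :
    S.smoothGerms x := ⟨(a : Germ (𝓝 x) ℝ), a, ha, rfl⟩

theorem smoothGerm_congr {ha : S.SmoothAt a x} {hb : S.SmoothAt b x} (h : ∀ᶠ z in 𝓝 x, a z = b z) :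
    S.smoothGerm a ha = S.smoothGerm b hb := Subtype.ext (Germ.coe_eq.2 h)

theorem SmoothAt.mul (ha : S.SmoothAt a x) (hb : S.SmoothAt b x) :
    S.SmoothAt (fun z => a z * b z) x := fun c hc u hu h => (ha c hc u hu h).mul (hb c hc u hu h)

theorem SmoothAt.sub (ha : S.SmoothAt a x) (hb : S.SmoothAt b x) :
    S.SmoothAt (fun z => a z - b z) x := fun c hc u hu h => (ha c hc u hu h).sub (hb c hc u hu h)

/-- The germ of `λ_p`, as an element of the monoid of germs of interior maps. -/
def germLam (hc : c ∈ S.charts) (hu : u ∈ c.φ.source) (p : c.P) : S.interiorGerms (c.φ u) :=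
  S.interiorGerm _ (interiorAt_lam_symm hc hu p)

theorem germLam_add (hc : c ∈ S.charts) (hu : u ∈ c.φ.source) (p q : c.P) :
    germLam hc hu (p + q) = germLam hc hu p * germLam hc hu q :=
  Subtype.ext (Germ.coe_eq.2 (Eventually.of_forall fun _ => lam_add _ _ _))

theorem value_germLam (hc : c ∈ S.charts) (hu : u ∈ c.φ.source) (p : c.P) :
    (germLam hc hu p : Germ (𝓝 (c.φ u)) ℝ).value = lam p u := by
  change lam p (c.φ.symm (c.φ u)) = _
  rw [c.φ.left_inv hu]

theorem value_germLam_pos (hc : c ∈ S.charts) (hu : u ∈ c.φ.source) {p : c.P} (hp : lam p u ≠ 0) :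
    0 < (germLam hc hu p : Germ (𝓝 (c.φ u)) ℝ).value := by
  rw [value_germLam]
  exact (lam_nonneg p u).lt_of_ne' hp

theorem exists_eq_germLam_mul_exp (hc : c ∈ S.charts) (hu : u ∈ c.φ.source)
    (b : S.interiorGerms (c.φ u)) :
    ∃ (p : c.P) (a : S.smoothGerms (c.φ u)), b = germLam hc hu p * S.expGerm _ a := by
  obtain ⟨_, f, hf, rfl⟩ := b
  obtain ⟨p, a, ha, h⟩ := (hf c hc u hu rfl).exists_logHom
  have hs : S.SmoothAt (fun x => a (c.φ.symm x)) (c.φ u) := by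
    rw [smoothAt_iff hc hu]
    refine ha.congr ?_
    filter_upwards [c.φ.open_source.mem_nhds hu] with z hz
    rw [c.φ.left_inv hz]
  refine ⟨p, S.smoothGerm _ hs, Subtype.ext ((germ_eq_iff hu).2 ?_)⟩
  filter_upwards [h, c.φ.open_source.mem_nhds hu] with z hz hz'
  simp only [Function.comp_apply, c.φ.left_inv hz', hz]

theorem expGerm_value_pos (a : S.smoothGerms x) :
    0 < (S.expGerm x a : Germ (𝓝 x) ℝ).value := by
  obtain ⟨_, f, hf, rfl⟩ := a
  exact Real.exp_pos _

/-- The class in `P / supp u` of a germ of an interior map is well defined. -/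
theorem germLam_mul_eq (hc : c ∈ S.charts) (hu : u ∈ c.φ.source) {p q : c.P}
    {e e' : S.interiorGerms (c.φ u)} (he : 0 < (e : Germ (𝓝 (c.φ u)) ℝ).value)
    (he' : 0 < (e' : Germ (𝓝 (c.φ u)) ℝ).value)
    (h : germLam hc hu p * e = germLam hc hu q * e') :
    ∃ f g : c.P, lam f u ≠ 0 ∧ lam g u ≠ 0 ∧ p + f = q + g := by
  obtain ⟨_, a, ha, rfl⟩ := e
  obtain ⟨_, b, hb, rfl⟩ := e'
  have h1 := (germ_eq_iff hu).1 (congrArg Subtype.val h)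
  refine add_eq_add_of_eventuallyEq c.weaklyToric (ha c hc u hu rfl).smoothAt.continuousAt
    (hb c hc u hu rfl).smoothAt.continuousAt he he' ?_
  filter_upwards [h1, c.φ.open_source.mem_nhds hu] with z hz hz' _
  simpa only [c.φ.left_inv hz'] using hz

variable {B : Type*} [AddCommMonoid B]

/-- Morphisms on germs of interior maps that vanish on the positive germs are determined by their
values on the germs of the functions `λ_p`. -/
theorem hom_ext_germLam (hc : c ∈ S.charts) (hu : u ∈ c.φ.source)
    {α α' : Additive (S.interiorGerms (c.φ u)) →+ B}
    (h : ∀ b : S.interiorGerms (c.φ u), 0 < (b : Germ (𝓝 (c.φ u)) ℝ).value →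
      α (Additive.ofMul b) = 0)
    (h' : ∀ b : S.interiorGerms (c.φ u), 0 < (b : Germ (𝓝 (c.φ u)) ℝ).value →
      α' (Additive.ofMul b) = 0)
    (hp : ∀ p, α (Additive.ofMul (germLam hc hu p)) = α' (Additive.ofMul (germLam hc hu p))) :
    α = α' := by
  refine AddMonoidHom.ext fun b => ?_
  obtain ⟨p, a, hb⟩ := exists_eq_germLam_mul_exp hc hu b.toMul
  obtain rfl : b = Additive.ofMul _ := hb
  change α (Additive.ofMul (germLam hc hu p * _)) = α' (Additive.ofMul (germLam hc hu p * _))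
  rw [ofMul_mul, map_add, map_add, h _ (expGerm_value_pos a), h' _ (expGerm_value_pos a), hp]

/-- An element of `P` representing the class of a germ of an interior map. -/
def germClass (hc : c ∈ S.charts) (hu : u ∈ c.φ.source) (b : S.interiorGerms (c.φ u)) : c.P :=
  (exists_eq_germLam_mul_exp hc hu b).choose

theorem exists_eq_germClass_mul (hc : c ∈ S.charts) (hu : u ∈ c.φ.source)
    (b : S.interiorGerms (c.φ u)) :
    ∃ e : S.interiorGerms (c.φ u), 0 < (e : Germ (𝓝 (c.φ u)) ℝ).value ∧
      b = germLam hc hu (germClass hc hu b) * e := by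
  obtain ⟨a, h⟩ := (exists_eq_germLam_mul_exp hc hu b).choose_spec
  exact ⟨_, expGerm_value_pos a, h⟩

theorem map_germClass (hc : c ∈ S.charts) (hu : u ∈ c.φ.source) (β : c.P →+ B)
    (hβ : ∀ p, lam p u ≠ 0 → β p = 0) (p : c.P) {e : S.interiorGerms (c.φ u)}
    (he : 0 < (e : Germ (𝓝 (c.φ u)) ℝ).value) :
    β (germClass hc hu (germLam hc hu p * e)) = β p := by
  obtain ⟨e', he', h⟩ := exists_eq_germClass_mul hc hu (germLam hc hu p * e)
  obtain ⟨f, g, hf, hg, hfg⟩ := germLam_mul_eq hc hu he he' h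
  have := congrArg β hfg
  rw [map_add, map_add, hβ f hf, hβ g hg, add_zero, add_zero] at this
  exact this.symm

theorem germLam_zero (hc : c ∈ S.charts) (hu : u ∈ c.φ.source) :
    (germLam hc hu 0 : S.interiorGerms (c.φ u)) = 1 :=
  Subtype.ext (Germ.coe_eq.2 (Eventually.of_forall fun _ => lam_zero _))

/-- A morphism on `P` vanishing on the support of `u` induces one on the germs of interior maps. -/
def germHom (hc : c ∈ S.charts) (hu : u ∈ c.φ.source) (β : c.P →+ B)
    (hβ : ∀ p, lam p u ≠ 0 → β p = 0) : Additive (S.interiorGerms (c.φ u)) →+ B where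
  toFun b := β (germClass hc hu b.toMul)
  map_zero' := by
    have := map_germClass hc hu β hβ 0 (e := 1) one_pos
    rwa [germLam_zero, one_mul, map_zero] at this
  map_add' a b := by
    obtain ⟨e, he, ha⟩ := exists_eq_germClass_mul hc hu a.toMul
    obtain ⟨e', he', hb⟩ := exists_eq_germClass_mul hc hu b.toMul
    have h := map_germClass hc hu β hβ (germClass hc hu a.toMul + germClass hc hu b.toMul)
      (e := e * e') ((mul_pos he he').trans_eq (germ_value_mul _ _).symm)
    rw [germLam_add, mul_mul_mul_comm, ← ha, ← hb] at h
    rw [toMul_add, h, map_add]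

theorem germHom_germLam_mul (hc : c ∈ S.charts) (hu : u ∈ c.φ.source) (β : c.P →+ B)
    (hβ : ∀ p, lam p u ≠ 0 → β p = 0) (p : c.P) {e : S.interiorGerms (c.φ u)}
    (he : 0 < (e : Germ (𝓝 (c.φ u)) ℝ).value) :
    germHom hc hu β hβ (Additive.ofMul (germLam hc hu p * e)) = β p :=
  map_germClass hc hu β hβ p he

theorem germHom_germLam (hc : c ∈ S.charts) (hu : u ∈ c.φ.source) (β : c.P →+ B)
    (hβ : ∀ p, lam p u ≠ 0 → β p = 0) (p : c.P) :
    germHom hc hu β hβ (Additive.ofMul (germLam hc hu p)) = β p := by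
  have := germHom_germLam_mul hc hu β hβ p (e := 1) one_pos
  rwa [mul_one] at this

theorem germHom_of_pos (hc : c ∈ S.charts) (hu : u ∈ c.φ.source) (β : c.P →+ B)
    (hβ : ∀ p, lam p u ≠ 0 → β p = 0) {e : S.interiorGerms (c.φ u)}
    (he : 0 < (e : Germ (𝓝 (c.φ u)) ℝ).value) :
    germHom hc hu β hβ (Additive.ofMul e) = 0 := by
  have := germHom_germLam_mul hc hu β hβ 0 he
  rwa [germLam_zero, one_mul, map_zero] at this

end GCornersStructure

end

/-! ### Ranks of supports -/

section

variable {k : ℕ} {P : AddSubmonoid (Fin k → ℤ)}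

/-- The real functionals on the group of `P` that vanish on the support of `u`. -/
def annihilator (u : ModelSpace P) : Submodule ℝ (Grp P →+ ℝ) where
  carrier := {δ | ∀ p, lam p u ≠ 0 → δ (toGrp p) = 0}
  zero_mem' := fun _ _ => rfl
  add_mem' := fun h h' p hp => by simp [h p hp, h' p hp]
  smul_mem' := fun t _ h p hp => by simp [h p hp]

theorem mem_annihilator {u : ModelSpace P} {δ : Grp P →+ ℝ} :
    δ ∈ annihilator u ↔ ∀ p, lam p u ≠ 0 → δ (toGrp p) = 0 := Iff.rfl

instance finiteDimensional_grp_hom : FiniteDimensional ℝ (Grp P →+ ℝ) := by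
  obtain ⟨b⟩ := nonempty_basis_grp (P := P) rfl
  exact (homEquiv b).finiteDimensional

theorem finrank_grp_hom : Module.finrank ℝ (Grp P →+ ℝ) = monoidRank P := by
  obtain ⟨b⟩ := nonempty_basis_grp (P := P) rfl
  rw [← (homEquiv b).finrank_eq, Module.finrank_fin_fun]

/-- The restriction of functionals to the support of a point. -/
def restrictSupp (u : ModelSpace P) : (Grp P →+ ℝ) →ₗ[ℝ] (Grp (supp u) →+ ℝ) where
  toFun δ := δ.comp (AddSubgroup.inclusion (AddSubgroup.closure_mono (supp_le u)))
  map_add' _ _ := rfl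
  map_smul' _ _ := rfl

theorem finrank_annihilator (u : ModelSpace P) :
    monoidRank (supp u) + Module.finrank ℝ (annihilator u) = monoidRank P := by
  have hk : LinearMap.ker (restrictSupp u) = annihilator u := by
    ext δ
    rw [LinearMap.mem_ker, mem_annihilator]
    refine ⟨fun h p hp => ?_, fun h => grp_hom_ext fun ⟨p, hp⟩ => ?_⟩
    · exact DFunLike.congr_fun h (toGrp (⟨p, mem_supp.2 hp⟩ : supp u))
    · have hp' := supp_le u hp
      exact h ⟨p, hp'⟩ ((mem_supp (p := ⟨p, hp'⟩)).1 hp)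
  have hs : LinearMap.range (restrictSupp u) = ⊤ := by
    rw [LinearMap.range_eq_top]
    intro ε
    obtain ⟨g, hg⟩ := exists_real_extension (ε.comp toGrp)
    exact ⟨g.comp (Grp P).subtype, grp_hom_ext hg⟩
  rw [← finrank_grp_hom, ← finrank_grp_hom, ← (restrictSupp u).finrank_range_add_finrank_ker, hk,
    hs, finrank_top]

/-- A point whose support contains that of `u` and has the same rank has the same support. -/
theorem lam_eq_zero_of_rank_eq (hP : IsWeaklyToric P) {u z : ModelSpace P}
    (h : ∀ p, lam p u ≠ 0 → lam p z ≠ 0) (hr : monoidRank (supp z) = monoidRank (supp u)) {p : P}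
    (hp : lam p u = 0) : lam p z = 0 := by
  by_contra hpz
  have hle : annihilator z ≤ annihilator u := fun δ hδ p hp => hδ p (h p hp)
  have heq := Submodule.eq_of_le_of_finrank_eq hle (by
    have h1 := finrank_annihilator u
    have h2 := finrank_annihilator z
    omega)
  -- Equal ranks make the two annihilators equal. A functional that vanishes on the support of `u`
  -- and is positive at `p` then also vanishes on the support of `z`, so `p` cannot lie there.
  obtain ⟨α, h0, h1⟩ := (isFace_supp u).exists_pos_functional hP
  have h2 : realHom P α ∈ annihilator z := by
    rw [heq]
    intro q hq
    rw [realHom_apply, coe_toGrp, h0 q (mem_supp.2 hq), Int.cast_zero]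
  have h3 := h2 p hpz
  rw [realHom_apply, coe_toGrp, Int.cast_eq_zero] at h3
  exact (h1 p p.2 fun hp' => mem_supp.1 hp' hp).ne' h3

end

namespace GCornersStructure

variable {n : ℕ} {X : Type*} [TopologicalSpace X] {S : GCornersStructure n X} {c : GChart n X}
  {u : ModelSpace c.P} {a b : X → ℝ} {x : X}

/-- The real functionals on germs of interior maps that vanish on positive germs. -/
def normalSpace (S : GCornersStructure n X) (x : X) :
    Submodule ℝ (Additive (S.interiorGerms x) →+ ℝ) where
  carrier := {α | ∀ b : S.interiorGerms x, 0 < (b : Germ (𝓝 x) ℝ).value →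
    α (Additive.ofMul b) = 0}
  zero_mem' := fun _ _ => rfl
  add_mem' := fun h h' b hb => by simp [h b hb, h' b hb]
  smul_mem' := fun t _ h b hb => by simp [h b hb]

theorem exists_extend_germLam (hc : c ∈ S.charts) (hu : u ∈ c.φ.source)
    (α : Additive (S.interiorGerms (c.φ u)) →+ ℝ) :
    ∃ δ : Grp c.P →+ ℝ, ∀ p, δ (toGrp p) = α (Additive.ofMul (germLam hc hu p)) := by
  refine exists_toGrp_extension
    { toFun := fun p => α (Additive.ofMul (germLam hc hu p))
      map_zero' := by rw [germLam_zero, ofMul_one, map_zero]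
      map_add' := fun p q => by rw [germLam_add, ofMul_mul, map_add] }

/-- The space of normal functionals, computed in a chart. -/
def normalSpaceEquiv (hc : c ∈ S.charts) (hu : u ∈ c.φ.source) :
    annihilator u ≃ₗ[ℝ] S.normalSpace (c.φ u) :=
  LinearEquiv.ofBijective
    { toFun := fun δ => ⟨germHom hc hu (δ.1.comp toGrp) δ.2,
        fun _ hb => germHom_of_pos hc hu (δ.1.comp toGrp) δ.2 hb⟩
      map_add' := fun _ _ => rfl
      map_smul' := fun _ _ => rfl } (by
    constructor
    · intro δ δ' h
      refine Subtype.ext (grp_hom_ext fun p => ?_)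
      have := DFunLike.congr_fun (congrArg Subtype.val h) (Additive.ofMul (germLam hc hu p))
      exact (germHom_germLam hc hu (δ.1.comp toGrp) δ.2 p).symm.trans
        (this.trans (germHom_germLam hc hu (δ'.1.comp toGrp) δ'.2 p))
    · intro α
      obtain ⟨δ, hδ⟩ := exists_extend_germLam hc hu α.1
      have hδ' : δ ∈ annihilator u := fun p hp => by
        rw [hδ]
        exact α.2 _ (value_germLam_pos hc hu hp)
      refine ⟨⟨δ, hδ'⟩, Subtype.ext ?_⟩
      refine hom_ext_germLam hc hu (fun _ hb => germHom_of_pos hc hu (δ.comp toGrp) hδ' hb) α.2 fun p => ?_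
      exact (germHom_germLam hc hu (δ.comp toGrp) hδ' p).trans (hδ p))

/-- The normal space is defined without a chart, so the rank of the support is the same in all
charts; this makes depth strata computable in any one of them. -/
theorem rank_supp_add_finrank_normalSpace (hc : c ∈ S.charts) (hu : u ∈ c.φ.source) :
    monoidRank (supp u) + Module.finrank ℝ (S.normalSpace (c.φ u)) = n := by
  rw [← (normalSpaceEquiv hc hu).finrank_eq, finrank_annihilator, c.rank_eq]

theorem mem_stratum_iff (hc : c ∈ S.charts) (hu : u ∈ c.φ.source) {k : ℕ} :
    c.φ u ∈ S.stratum k ↔ monoidRank (supp u) + k = n := by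
  refine ⟨?_, fun h => ⟨c, hc, u, hu, rfl, h⟩⟩
  rintro ⟨d, hd, v, hv, hvu, h⟩
  have h1 := rank_supp_add_finrank_normalSpace hc hu
  have h2 := rank_supp_add_finrank_normalSpace hd hv
  rw [hvu] at h2
  omega

/-! ### Derivations in a chart -/

theorem IsDerivation.map_const {v : S.smoothGerms x →ₗ[ℝ] ℝ} (hv : S.IsDerivation x v) (t : ℝ)
    (ht : S.SmoothAt (fun _ => t) x) : v (S.smoothGerm (fun _ => t) ht) = 0 := by
  have h1s : S.SmoothAt (fun _ => 1) x := fun _ _ _ _ _ => smoothAt_const 1 _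
  have h1 := hv (S.smoothGerm _ h1s) (S.smoothGerm _ h1s)
  have h2 : (⟨(S.smoothGerm _ h1s : Germ (𝓝 x) ℝ) * S.smoothGerm _ h1s,
      S.mul_mem_smoothGerms x (S.smoothGerm _ h1s).2 (S.smoothGerm _ h1s).2⟩ : S.smoothGerms x) =
      S.smoothGerm _ h1s := Subtype.ext (Germ.coe_eq.2 (Eventually.of_forall fun _ => one_mul 1))
  have h3 : (S.smoothGerm _ h1s : Germ (𝓝 x) ℝ).value = 1 := rfl
  rw [h2, h3] at h1
  have h4 : S.smoothGerm _ ht = t • S.smoothGerm _ h1s :=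
    Subtype.ext (Germ.coe_eq.2 (Eventually.of_forall fun _ => (mul_one t).symm))
  rw [h4, map_smul]
  have : v (S.smoothGerm _ h1s) = 0 := by linarith
  rw [this, smul_zero]

theorem IsDerivation.map_mul {v : S.smoothGerms x →ₗ[ℝ] ℝ} (hv : S.IsDerivation x v)
    (ha : S.SmoothAt a x) (hb : S.SmoothAt b x) :
    v (S.smoothGerm _ (ha.mul hb)) = v (S.smoothGerm a ha) * b x + a x * v (S.smoothGerm b hb) :=
  hv (S.smoothGerm a ha) (S.smoothGerm b hb)

theorem smoothAt_symm (hc : c ∈ S.charts) (hu : u ∈ c.φ.source) {f : ModelSpace c.P → ℝ}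
    (hf : ModelSpace.SmoothAt f u) : S.SmoothAt (fun x => f (c.φ.symm x)) (c.φ u) := by
  rw [smoothAt_iff hc hu]
  refine hf.congr ?_
  filter_upwards [c.φ.open_source.mem_nhds hu] with z hz
  rw [c.φ.left_inv hz]

/-- A derivation is determined by its values on the functions `λ_r`, for generators `r`. -/
theorem IsDerivation.map_eq_fderiv (hc : c ∈ S.charts) (hu : u ∈ c.φ.source)
    {v : S.smoothGerms (c.φ u) →ₗ[ℝ] ℝ} (hv : S.IsDerivation (c.φ u) v) {N : ℕ} (r : Fin N → c.P)
    {g : (Fin N → ℝ) → ℝ} (hg : ContDiff ℝ ∞ g) (ha : S.SmoothAt a (c.φ u))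
    (h : ∀ᶠ z in 𝓝 u, a (c.φ z) = g (lamv r z)) :
    v (S.smoothGerm a ha) = fderiv ℝ g (lamv r u) fun i =>
      v (S.smoothGerm _ (interiorAt_lam_symm hc hu (r i)).smoothAt) := by
  -- A derivation sees only the first-order term of Hadamard's expansion: in `(λ_r - λ_r(u)) · H`
  -- the first factor vanishes at `u`, so the Leibniz rule leaves `H` at `u`, a partial derivative.
  obtain ⟨H, hH, hH0, hHe⟩ := exists_hadamard hg (lamv r u)
  have hl : ∀ i, S.SmoothAt (fun x => lam (r i) (c.φ.symm x)) (c.φ u) := fun i =>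
    (interiorAt_lam_symm hc hu (r i)).smoothAt
  have hconst : ∀ t : ℝ, S.SmoothAt (fun _ => t) (c.φ u) := fun t _ _ _ _ _ => smoothAt_const t _
  have hHs : ∀ i, S.SmoothAt (fun x => H i (lamv r (c.φ.symm x))) (c.φ u) := fun i =>
    smoothAt_symm hc hu (SmoothAt.of_comp_lamv (hH i) (Eventually.of_forall fun _ => rfl))
  have hterm : ∀ i, S.SmoothAt
      (fun x => (lam (r i) (c.φ.symm x) - lam (r i) u) * H i (lamv r (c.φ.symm x))) (c.φ u) :=
    fun i => ((hl i).sub (hconst _)).mul (hHs i)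
  have h1 : S.smoothGerm a ha =
      S.smoothGerm _ (hconst (g (lamv r u))) + ∑ i, S.smoothGerm _ (hterm i) := by
    have hsum : ((∑ i, S.smoothGerm _ (hterm i) : S.smoothGerms (c.φ u)) : Germ (𝓝 (c.φ u)) ℝ) =
        ((fun x => ∑ i, (lam (r i) (c.φ.symm x) - lam (r i) u) * H i (lamv r (c.φ.symm x)) :
          X → ℝ) : Germ (𝓝 (c.φ u)) ℝ) := by
      rw [AddSubmonoidClass.coe_finsetSum]
      have := map_sum (Germ.coeAddHom (𝓝 (c.φ u)) : (X → ℝ) →+ Germ (𝓝 (c.φ u)) ℝ)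
        (fun i x => (lam (r i) (c.φ.symm x) - lam (r i) u) * H i (lamv r (c.φ.symm x)))
        Finset.univ
      refine this.symm.trans (Germ.coe_eq.2 (Eventually.of_forall fun x => ?_))
      simp
    refine Subtype.ext ?_
    rw [Submodule.coe_add, hsum]
    refine (germ_eq_iff hu).2 ?_
    filter_upwards [h, c.φ.open_source.mem_nhds hu] with z hz hz'
    rw [hz, hHe]
    simp only [c.φ.left_inv hz']
    rfl
  have h2 : ∀ i, v (S.smoothGerm _ (hterm i)) =
      fderiv ℝ g (lamv r u) (Pi.single i 1) * v (S.smoothGerm _ (hl i)) := by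
    intro i
    rw [hv.map_mul ((hl i).sub (hconst _)) (hHs i)]
    have h3 : S.smoothGerm _ ((hl i).sub (hconst (lam (r i) u))) =
        S.smoothGerm _ (hl i) - S.smoothGerm _ (hconst (lam (r i) u)) := rfl
    rw [h3, map_sub, hv.map_const, sub_zero, c.φ.left_inv hu, sub_self, zero_mul, add_zero, hH0,
      mul_comm]
  rw [h1, map_add, map_sum, hv.map_const, zero_add, Finset.sum_congr rfl fun i _ => h2 i]
  conv_rhs => rw [← Finset.univ_sum_single
    (fun i => v (S.smoothGerm _ (interiorAt_lam_symm hc hu (r i)).smoothAt)), map_sum]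
  refine Finset.sum_congr rfl fun i _ => ?_
  rw [mul_comm, ← smul_eq_mul, ← map_smul, ← Pi.single_smul, smul_eq_mul, mul_one]

theorem IsDerivation.eq_zero (hc : c ∈ S.charts) (hu : u ∈ c.φ.source)
    {v : S.smoothGerms (c.φ u) →ₗ[ℝ] ℝ} (hv : S.IsDerivation (c.φ u) v) {N : ℕ} {r : Fin N → c.P}
    (hr : Generates r)
    (h : ∀ i, v (S.smoothGerm _ (interiorAt_lam_symm hc hu (r i)).smoothAt) = 0) : v = 0 := by
  ext ⟨_, a, ha, rfl⟩
  obtain ⟨g, hg, he⟩ := (ha c hc u hu rfl).exists_eq_comp_lamv hr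
  have := hv.map_eq_fderiv hc hu r hg ha he
  simp only [h] at this
  exact this.trans (map_zero _)

end GCornersStructure

/-! ### Differentials of the equations in logarithmic coordinates -/

section

variable {K N : ℕ} {Q : AddSubmonoid (Fin K → ℤ)}

theorem ModelSpace.InteriorAt.exists_eq_lam_mul_exp {r : Fin N → Q} (hr : Generates r)
    {f : ModelSpace Q → ℝ} {u : ModelSpace Q} (hf : ModelSpace.InteriorAt f u) :
    ∃ (q : Q) (C : (Fin N → ℝ) → ℝ), ContDiff ℝ ∞ C ∧
      ∀ᶠ z in 𝓝 u, f z = lam q z * Real.exp (C (lamv r z)) := by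
  obtain ⟨q, c, hc, h⟩ := hf.exists_logHom
  obtain ⟨C, hC, hCe⟩ := hc.exists_eq_comp_lamv hr
  refine ⟨q, C, hC, ?_⟩
  filter_upwards [h, hCe] with z h1 h2
  rw [h1, h2]

/-- Evaluation at an element of the group of `Q`. -/
def evalDual (g : Grp Q) : Module.Dual ℝ (Grp Q →+ ℝ) where
  toFun δ := δ g
  map_add' _ _ := rfl
  map_smul' _ _ := rfl

/-- The logarithmic differential of `g(λ_r)`. -/
def fderivDual (r : Fin N → Q) (g : (Fin N → ℝ) → ℝ) (u : ModelSpace Q) :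
    Module.Dual ℝ (Grp Q →+ ℝ) :=
  (fderiv ℝ g (lamv r u)).toLinearMap ∘ₗ LinearMap.pi fun i => lam (r i) u • evalDual (toGrp (r i))

theorem fderivDual_apply (r : Fin N → Q) (g : (Fin N → ℝ) → ℝ) (u : ModelSpace Q)
    (δ : Grp Q →+ ℝ) :
    fderivDual r g u δ = fderiv ℝ g (lamv r u) fun i => lam (r i) u * δ (toGrp (r i)) := rfl

/-- Each entry `λ_{r_i}(u) δ(r_i)` vanishes, through the first factor if `r_i` is zero at `u` and
through the second if it is a unit. -/
theorem fderivDual_eq_zero {r : Fin N → Q} (hr : Generates r) (g : (Fin N → ℝ) → ℝ)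
    {u : ModelSpace Q} {δ : Grp Q →+ ℝ} (h : ∀ i, δ (toGrp (faceGen r u i)) = 0) :
    fderivDual r g u δ = 0 := by
  have h0 : (fun i => lam (r i) u * δ (toGrp (r i))) = 0 := by
    funext i
    by_cases hi : lam (r i) u = 0
    · simp [hi]
    · simp [eq_zero_of_faceGen hr h hi]
  rw [fderivDual_apply, h0, map_zero]

end

namespace GCornersStructure

section

variable {n N k l : ℕ} {Y : Type*} [TopologicalSpace Y] {S : GCornersStructure n Y}
  {c : GChart n Y} {u : ModelSpace c.P} {r : Fin N → c.P}

/-- The condition `v [b] = b(y) v' [b]` gives `v [λ_r] = λ_r(u) δ(r)`, so `v` is the derivative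
along the flow of the functional `δ` induced by `v'`. -/
theorem map_smoothGerm_eq_fderivDual (hc : c ∈ S.charts) (hu : u ∈ c.φ.source)
    {w : (S.smoothGerms (c.φ u) →ₗ[ℝ] ℝ) × (Additive (S.interiorGerms (c.φ u)) →+ ℝ)}
    (hw : w ∈ S.bTangentSpace (c.φ u)) {δ : Grp c.P →+ ℝ}
    (hδ : ∀ p, δ (toGrp p) = w.2 (Additive.ofMul (germLam hc hu p))) {a : Y → ℝ}
    (ha : S.SmoothAt a (c.φ u)) {g : (Fin N → ℝ) → ℝ} (hg : ContDiff ℝ ∞ g)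
    (h : ∀ᶠ z in 𝓝 u, a (c.φ z) = g (lamv r z)) :
    w.1 (S.smoothGerm a ha) = fderivDual r g u δ := by
  rw [IsDerivation.map_eq_fderiv hc hu hw.1 r hg ha h, fderivDual_apply]
  congr 1
  funext i
  rw [hδ, ← value_germLam hc hu]
  exact hw.2.2 (germLam hc hu (r i))

theorem map_interiorGerm_eq_fderivDual (hc : c ∈ S.charts) (hu : u ∈ c.φ.source)
    {w : (S.smoothGerms (c.φ u) →ₗ[ℝ] ℝ) × (Additive (S.interiorGerms (c.φ u)) →+ ℝ)}
    (hw : w ∈ S.bTangentSpace (c.φ u)) {δ : Grp c.P →+ ℝ}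
    (hδ : ∀ p, δ (toGrp p) = w.2 (Additive.ofMul (germLam hc hu p))) {b : Y → ℝ}
    (hb : S.InteriorAt b (c.φ u)) {q : c.P} {g : (Fin N → ℝ) → ℝ} (hg : ContDiff ℝ ∞ g)
    (h : ∀ᶠ z in 𝓝 u, b (c.φ z) = lam q z * Real.exp (g (lamv r z))) :
    w.2 (Additive.ofMul (S.interiorGerm b hb)) = δ (toGrp q) + fderivDual r g u δ := by
  have hs : S.SmoothAt (fun x => g (lamv r (c.φ.symm x))) (c.φ u) :=
    smoothAt_symm hc hu (SmoothAt.of_comp_lamv hg (Eventually.of_forall fun _ => rfl))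
  have h1 : S.interiorGerm b hb = germLam hc hu q * S.expGerm _ (S.smoothGerm _ hs) := by
    refine Subtype.ext ((germ_eq_iff hu).2 ?_)
    filter_upwards [h, c.φ.open_source.mem_nhds hu] with z hz hz'
    simp only [Function.comp_apply, hz, c.φ.left_inv hz']
  rw [h1, ofMul_mul, map_add, hw.2.1, hδ]
  congr 1
  refine map_smoothGerm_eq_fderivDual hc hu hw hδ hs hg ?_
  filter_upwards [c.φ.open_source.mem_nhds hu] with z hz
  rw [c.φ.left_inv hz]

/-- Linear independence in the b-cotangent space, transferred to the model space. -/
theorem linearIndependent_dual (hc : c ∈ S.charts) (hu : u ∈ c.φ.source)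
    {f g : Fin k → Y → ℝ} {hf : ∀ i, S.IsInterior (f i)} {hg : ∀ i, S.IsInterior (g i)}
    {h : Fin l → Y → ℝ} {hh : ∀ j, S.IsSmooth (h j)}
    (hind : LinearIndependent ℝ (Sum.elim
      (fun i => S.bd (f i) (hf i) (c.φ u) - S.bd (g i) (hg i) (c.φ u))
      (fun j => S.d (h j) (hh j) (c.φ u))))
    {q₁ q₂ : Fin k → c.P} {C₁ C₂ : Fin k → (Fin N → ℝ) → ℝ} {H : Fin l → (Fin N → ℝ) → ℝ}
    (hC₁ : ∀ i, ContDiff ℝ ∞ (C₁ i)) (hC₂ : ∀ i, ContDiff ℝ ∞ (C₂ i))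
    (hH : ∀ j, ContDiff ℝ ∞ (H j))
    (h₁ : ∀ i, ∀ᶠ z in 𝓝 u, f i (c.φ z) = lam (q₁ i) z * Real.exp (C₁ i (lamv r z)))
    (h₂ : ∀ i, ∀ᶠ z in 𝓝 u, g i (c.φ z) = lam (q₂ i) z * Real.exp (C₂ i (lamv r z)))
    (h₃ : ∀ j, ∀ᶠ z in 𝓝 u, h j (c.φ z) = H j (lamv r z)) :
    LinearIndependent ℝ (Sum.elim
      (fun i => evalDual (toGrp (q₁ i) - toGrp (q₂ i)) +
        fderivDual r (fun z => C₁ i z - C₂ i z) u)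
      (fun j => fderivDual r (H j) u)) := by
  rw [Fintype.linearIndependent_iff] at hind ⊢
  intro t ht
  refine hind t (LinearMap.ext fun w => ?_)
  -- Each b-tangent vector pairs with the given differentials as its functional `δ` pairs with the
  -- model forms. A relation among the model forms thus transfers to the b-cotangent space;
  -- surjectivity of `w ↦ δ` is not needed.
  obtain ⟨δ, hδ⟩ := exists_extend_germLam hc hu w.1.2
  have h0 := LinearMap.congr_fun ht δ
  rw [LinearMap.sum_apply] at h0 ⊢
  refine Eq.trans ?_ h0
  refine Finset.sum_congr rfl fun i _ => ?_
  rw [LinearMap.smul_apply, LinearMap.smul_apply]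
  congr 1
  rcases i with i | j
  · have hd : fderivDual r (fun z => C₁ i z - C₂ i z) u δ =
        fderivDual r (C₁ i) u δ - fderivDual r (C₂ i) u δ := by
      simp only [fderivDual_apply]
      rw [fderiv_fun_sub ((hC₁ i).differentiable (by simp) _)
        ((hC₂ i).differentiable (by simp) _)]
      rfl
    have e₁ := map_interiorGerm_eq_fderivDual hc hu w.2 hδ (hf i _) (hC₁ i) (h₁ i)
    have e₂ := map_interiorGerm_eq_fderivDual hc hu w.2 hδ (hg i _) (hC₂ i) (h₂ i)
    simp only [Sum.elim_inl, LinearMap.sub_apply, LinearMap.add_apply, hd]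
    refine (congrArg₂ (· - ·) e₁ e₂).trans ?_
    change _ = δ (toGrp (q₁ i) - toGrp (q₂ i)) + _
    rw [map_sub]
    ring
  · exact map_smoothGerm_eq_fderivDual hc hu w.2 hδ (hh j _) (hH j) (h₃ j)

/-- In a chart, the solution set is a local solution set in the model space. -/
theorem eventually_mem_solutionSet_iff (hc : c ∈ S.charts) (hu : u ∈ c.φ.source)
    {f g : Fin k → Y → ℝ} {h : Fin l → Y → ℝ}
    {q₁ q₂ : Fin k → c.P} {C₁ C₂ : Fin k → (Fin N → ℝ) → ℝ} {H : Fin l → (Fin N → ℝ) → ℝ}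
    (h₁ : ∀ i, ∀ᶠ z in 𝓝 u, f i (c.φ z) = lam (q₁ i) z * Real.exp (C₁ i (lamv r z)))
    (h₂ : ∀ i, ∀ᶠ z in 𝓝 u, g i (c.φ z) = lam (q₂ i) z * Real.exp (C₂ i (lamv r z)))
    (h₃ : ∀ j, ∀ᶠ z in 𝓝 u, h j (c.φ z) = H j (lamv r z)) :
    ∀ᶠ z in 𝓝 u, c.φ z ∈ solutionSet S f g h ↔
      z ∈ localSolution r (fun i => toGrp (q₁ i) - toGrp (q₂ i))
        (fun i z => C₁ i z - C₂ i z) H := by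
  filter_upwards [eventually_all.2 h₁, eventually_all.2 h₂, eventually_all.2 h₃,
    c.φ.open_source.mem_nhds hu] with z e₁ e₂ e₃ hz
  change (_ ∧ _ ∧ _) ↔ (_ ∧ _ ∧ _)
  rw [mem_interior_iff hc hz]
  refine and_congr_right fun hi => and_congr (forall_congr' fun i => ?_)
    (forall_congr' fun j => by rw [e₃])
  -- At an interior point both sides are exponentials, so equality becomes the additive equation of
  -- their exponents.
  rw [e₁, e₂, ← exp_logHom hi, ← exp_logHom hi, ← Real.exp_add, ← Real.exp_add,
    Real.exp_injective.eq_iff, map_sub]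
  constructor <;> intro h <;> linarith

theorem exists_mem_closure_iff {s : Set Y} {t : Set (ModelSpace c.P)} (hu : u ∈ c.φ.source)
    (h : ∀ᶠ z in 𝓝 u, c.φ z ∈ s ↔ z ∈ t) :
    ∃ O : Set (ModelSpace c.P), IsOpen O ∧ u ∈ O ∧ O ⊆ c.φ.source ∧
      ∀ z ∈ O, c.φ z ∈ closure s ↔ z ∈ closure t := by
  obtain ⟨O, hO, hOo, huO⟩ := eventually_nhds_iff.1 (h.and (c.φ.open_source.mem_nhds hu))
  refine ⟨O, hOo, huO, fun z hz => (hO z hz).2, fun z hz => ?_⟩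
  rw [mem_closure_iff_frequently, mem_closure_iff_frequently, ← c.φ.map_nhds_eq (hO z hz).2,
    frequently_map]
  refine frequently_congr ?_
  filter_upwards [hOo.mem_nhds hz] with y hy
  exact (hO y hy).1

end

end GCornersStructure

/-! ### Charts on the closure of the solution set -/

/-- A parametrization of a closed set in a chart, as a chart of the closed set. -/
theorem exists_openPartialHomeomorph_closure {A B Y : Type*} [TopologicalSpace A]
    [TopologicalSpace B] [TopologicalSpace Y] (φ : OpenPartialHomeomorph B Y) {s : Set Y}
    {t : Set B} {u : B} {Ψ : A → B} {J : B → A} {W : Set A} {O O' : Set B} (hW : IsOpen W)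
    (hO : IsOpen O) (huO : u ∈ O) (hO' : IsOpen O') (huO' : u ∈ O') (hO's : O' ⊆ φ.source)
    (hst : ∀ z ∈ O', φ z ∈ closure s ↔ z ∈ closure t) (hut : u ∈ closure t) (hΨ : Continuous Ψ)
    (hΨW : ∀ w ∈ W, Ψ w ∈ O ∩ closure t ∧ J (Ψ w) = w)
    (hJ : ∀ x ∈ O ∩ closure t, J x ∈ W ∧ Ψ (J x) = x) (hJc : ContinuousOn J (O ∩ closure t)) :
    ∃ e : OpenPartialHomeomorph A (closure s), J u ∈ e.source ∧
      ∀ w ∈ e.source, w ∈ W ∧ Ψ w ∈ O' ∧ (e w : Y) = φ (Ψ w) := by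
  classical
  -- Outside the source the value is the dummy point `φ u`, which lies in the closure.
  let F : A → closure s := fun w =>
    if h : φ (Ψ w) ∈ closure s then ⟨_, h⟩ else ⟨φ u, (hst u huO').2 hut⟩
  have hF : ∀ w ∈ W ∩ Ψ ⁻¹' O', (F w : Y) = φ (Ψ w) := fun w hw => by
    have h : φ (Ψ w) ∈ closure s := (hst _ hw.2).2 (hΨW w hw.1).1.2
    simp [F, h]
  have ht : ∀ y ∈ (Subtype.val ⁻¹' (φ.target ∩ φ.symm ⁻¹' (O ∩ O')) : Set (closure s)),
      φ.symm y ∈ O ∩ closure t := fun y hy =>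
    ⟨hy.2.1, (hst _ hy.2.2).1 (by rw [φ.right_inv hy.1]; exact y.2)⟩
  refine ⟨{
    toFun := F
    invFun := fun y => J (φ.symm y)
    source := W ∩ Ψ ⁻¹' O'
    target := Subtype.val ⁻¹' (φ.target ∩ φ.symm ⁻¹' (O ∩ O'))
    map_source' := fun w hw => ?_
    map_target' := fun y hy => ?_
    left_inv' := fun w hw => ?_
    right_inv' := fun y hy => ?_
    open_source := hW.inter (hO'.preimage hΨ)
    open_target := (φ.isOpen_inter_preimage_symm (hO.inter hO')).preimage continuous_subtype_val
    continuousOn_toFun := ?_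
    continuousOn_invFun := ?_ }, ⟨(hJ u ⟨huO, hut⟩).1, ?_⟩, fun w hw => ⟨hw.1, hw.2, hF w hw⟩⟩
  · rw [Set.mem_preimage, hF w hw]
    refine ⟨φ.map_source (hO's hw.2), ?_⟩
    rw [Set.mem_preimage, φ.left_inv (hO's hw.2)]
    exact ⟨(hΨW w hw.1).1.1, hw.2⟩
  · have h := hJ _ (ht y hy)
    refine ⟨h.1, ?_⟩
    rw [Set.mem_preimage, h.2]
    exact hy.2.2
  · rw [hF w hw, φ.left_inv (hO's hw.2)]
    exact (hΨW w hw.1).2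
  · have h := hJ _ (ht y hy)
    refine Subtype.ext ?_
    rw [hF _ ⟨h.1, by rw [Set.mem_preimage, h.2]; exact hy.2.2⟩, h.2, φ.right_inv hy.1]
  · rw [Topology.IsInducing.subtypeVal.continuousOn_iff]
    exact (φ.continuousOn.comp hΨ.continuousOn fun w hw => hO's hw.2).congr hF
  · exact hJc.comp ((φ.continuousOn_symm.comp continuous_subtype_val.continuousOn
      fun y hy => hy.1)) ht
  · rw [Set.mem_preimage, (hJ u ⟨huO, hut⟩).2]
    exact huO'

namespace GCornersStructure

section

variable {m n k l : ℕ} {X Y : Type*} [TopologicalSpace X] [TopologicalSpace Y]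

/-- In the chart `e`, the map `i` pulls interior maps back to interior maps. -/
def PullsBack (S : GCornersStructure n Y) (i : X → Y) (e : GChart m X) : Prop :=
  ∀ w ∈ e.φ.source, ∀ b, S.InteriorAt b (i (e.φ w)) →
    ModelSpace.InteriorAt (fun z => b (i (e.φ z))) w

/-- Near `x`, the function `a` is a quotient of pullbacks of interior maps. -/
def IsQuotientAt (S : GCornersStructure n Y) (i : X → Y) (a : X → ℝ) (x : X) : Prop :=
  ∃ b₁ b₂, S.InteriorAt b₁ (i x) ∧ S.InteriorAt b₂ (i x) ∧ ∀ᶠ z in 𝓝 x, a z * b₂ (i z) = b₁ (i z)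

end

section

variable {m n k l : ℕ} {Y : Type*} [TopologicalSpace Y] {S : GCornersStructure n Y}
  {f g : Fin k → Y → ℝ} {h : Fin l → Y → ℝ}

theorem add_le_of_linearIndependent {hf : ∀ i, S.IsInterior (f i)} {hg : ∀ i, S.IsInterior (g i)}
    {hh : ∀ j, S.IsSmooth (h j)} {x : Y}
    (hind : LinearIndependent ℝ (Sum.elim (fun i => S.bd (f i) (hf i) x - S.bd (g i) (hg i) x)
      (fun j => S.d (h j) (hh j) x))) : k + l ≤ n := by
  obtain ⟨c, hc, hx⟩ := S.cover x
  obtain ⟨u, hu, rfl⟩ : ∃ u ∈ c.φ.source, c.φ u = x := ⟨_, c.φ.map_target hx, c.φ.right_inv hx⟩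
  obtain ⟨N, r, hr⟩ := exists_generates c.weaklyToric.1
  choose q₁ C₁ hC₁ h₁ using fun i => (hf i _ c hc u hu rfl).exists_eq_lam_mul_exp hr
  choose q₂ C₂ hC₂ h₂ using fun i => (hg i _ c hc u hu rfl).exists_eq_lam_mul_exp hr
  choose H hH h₃ using fun j => (hh j _ c hc u hu rfl).exists_eq_comp_lamv hr
  have := (linearIndependent_dual hc hu hind hC₁ hC₂ hH h₁ h₂ h₃).fintype_card_le_finrank
  rwa [Subspace.dual_finrank_eq, finrank_grp_hom, c.rank_eq, Fintype.card_sum, Fintype.card_fin,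
    Fintype.card_fin] at this

/-- The local parametrization with the properties used for gluing and for the immersion conditions.
The last clause gives coordinates nonzero at `x` a denominator that is positive there, so that
derivations can be evaluated on them by the Leibniz rule. -/
theorem exists_solution_chart (hf : ∀ i, S.IsInterior (f i)) (hg : ∀ i, S.IsInterior (g i))
    (hh : ∀ j, S.IsSmooth (h j)) (hm : m + k + l = n) (x : closure (solutionSet S f g h))
    (hind : LinearIndependent ℝ (Sum.elim (fun i => S.bd (f i) (hf i) x - S.bd (g i) (hg i) x)
      (fun j => S.d (h j) (hh j) x))) :
    ∃ (e : GChart m (closure (solutionSet S f g h))) (w : ModelSpace e.P),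
      w ∈ e.φ.source ∧ e.φ w = x ∧ S.PullsBack Subtype.val e ∧
      (∀ z ∈ e.φ.source, ∀ p, S.IsQuotientAt Subtype.val (fun y => lam p (e.φ.symm y)) (e.φ z)) ∧
      ∀ p, lam p w ≠ 0 → ∃ b₁ b₂, S.InteriorAt b₁ (x : Y) ∧ S.InteriorAt b₂ (x : Y) ∧ 0 < b₂ x ∧
        ∀ᶠ y in 𝓝 x, lam p (e.φ.symm y) * b₂ y = b₁ y := by
  obtain ⟨x, hx⟩ := x
  obtain ⟨c, hc, hxc⟩ := S.cover x
  obtain ⟨u, hu, rfl⟩ : ∃ u ∈ c.φ.source, c.φ u = x := ⟨_, c.φ.map_target hxc, c.φ.right_inv hxc⟩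
  obtain ⟨N, r, hr⟩ := exists_generates c.weaklyToric.1
  obtain ⟨b⟩ := nonempty_basis_grp c.rank_eq
  choose q₁ C₁ hC₁ h₁ using fun i => (hf i _ c hc u hu rfl).exists_eq_lam_mul_exp hr
  choose q₂ C₂ hC₂ h₂ using fun i => (hg i _ c hc u hu rfl).exists_eq_lam_mul_exp hr
  choose H hH h₃ using fun j => (hh j _ c hc u hu rfl).exists_eq_comp_lamv hr
  have hΛ := linearIndependent_dual hc hu hind hC₁ hC₂ hH h₁ h₂ h₃
  obtain ⟨O', hO', huO', hO's, hst⟩ := exists_mem_closure_iff hu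
    (eventually_mem_solutionSet_iff (S := S) hc hu h₁ h₂ h₃)
  set d : Fin k → Grp c.P := fun i => toGrp (q₁ i) - toGrp (q₂ i) with hd
  set C : Fin k → (Fin N → ℝ) → ℝ := fun i z => C₁ i z - C₂ i z with hC
  obtain ⟨A, hA⟩ := exists_adaptedFrame (m := m) b (fun i => toGrp (faceGen r u i)) d _ hΛ
    (fun δ hδ h0 i => by
      have := h0 (Sum.inl i)
      rw [Sum.elim_inl, LinearMap.add_apply, fderivDual_eq_zero hr _ hδ, add_zero] at this
      exact this)
    (fun δ hδ h0 i => by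
      rcases i with i | j
      · rw [Sum.elim_inl, LinearMap.add_apply, fderivDual_eq_zero hr _ hδ, add_zero]
        exact h0 i
      · exact fderivDual_eq_zero hr _ hδ)
    (by rw [Fintype.card_sum, Fintype.card_fin, Fintype.card_fin]; omega)
  have hut : u ∈ closure (localSolution r d C H) := (hst u huO').1 hx
  obtain ⟨Ψ, J, W, O, hWo, hOo, huO, -, hΨ, hΨW, hJ, hJc, hJl⟩ :=
    exists_local_parametrization (m := m) c.weaklyToric b hm
      (fun i => (hC₁ i).sub (hC₂ i)) hH hut A (fun δ e₁ e₂ e₃ => hA δ (fun i => by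
        rcases i with i | j
        exacts [e₁ i, e₂ j]) e₃)
  choose a ha hΨa using hΨ
  have hΨs : ∀ w q, ModelSpace.InteriorAt (fun w => lam q (Ψ w)) w := fun w q =>
    ((interiorAt_lam (A.ψQ q) w).mul (interiorAt_of_pos (ha q w).exp (Real.exp_pos _))).congr
      (Eventually.of_forall fun z => hΨa q z)
  have hΨc : Continuous Ψ := continuous_iff_continuousAt.2 fun w =>
    continuousAt_iff.2 fun q => (hΨs w q).smoothAt.continuousAt
  obtain ⟨e, hue, he⟩ := exists_openPartialHomeomorph_closure c.φ hWo hOo huO hO' huO' hO's hst hut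
    hΨc hΨW hJ hJc
  have hΨu : Ψ (J u) = u := (hJ u ⟨huO, hut⟩).2
  -- the quotient formula
  have hquot : ∀ (p : A.monoid) (s₁ s₂ : c.P), A.lift p = toGrp s₁ - toGrp s₂ → ∀ w ∈ e.source,
      ∀ᶠ y in 𝓝 (e w), lam p (e.symm y) * lam s₂ (c.φ.symm (y : Y)) =
        lam s₁ (c.φ.symm (y : Y)) := by
    intro p s₁ s₂ hs w hw
    filter_upwards [e.open_target.mem_nhds (e.map_source hw)] with y hy
    obtain ⟨z, hz, rfl⟩ : ∃ z ∈ e.source, e z = y := ⟨_, e.map_target hy, e.right_inv hy⟩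
    obtain ⟨hzW, hzO, hze⟩ := he z hz
    rw [e.left_inv hz, hze, c.φ.left_inv (hO's hzO)]
    obtain ⟨hx, hJz⟩ := hΨW z hzW
    set v := Ψ z
    -- On solutions the identity is `exp log x (s₁ - s₂) · λ_{s₂} = λ_{s₁}`; it is carried to `v` by
    -- approximating with solutions.
    have hne : (𝓝[O ∩ localSolution r d C H] v).NeBot := by
      rw [Set.inter_comm, nhdsWithin_inter_of_mem' (mem_nhdsWithin_of_mem_nhds (hOo.mem_nhds hx.1))]
      exact mem_closure_iff_nhdsWithin_neBot.1 hx.2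
    have hmono : O ∩ localSolution r d C H ⊆ O ∩ closure (localSolution r d C H) :=
      Set.inter_subset_inter_right _ subset_closure
    have h1 : Tendsto (fun x => lam p (J x) * lam s₂ x) (𝓝[O ∩ localSolution r d C H] v)
        (𝓝 (lam p z * lam s₂ v)) := by
      have h2 := tendsto_nhds_iff.1 ((hJc v hx).mono_left (nhdsWithin_mono _ hmono)) p
      rw [hJz] at h2
      exact h2.mul ((continuous_lam s₂).continuousAt.mono_left nhdsWithin_le_nhds)
    refine tendsto_nhds_unique_of_eventuallyEq h1
      ((continuous_lam s₁).continuousAt.mono_left nhdsWithin_le_nhds) ?_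
    filter_upwards [self_mem_nhdsWithin] with x hx'
    rw [hJl x hx'.2, hs, ← exp_logHom hx'.2.1, ← exp_logHom hx'.2.1, ← Real.exp_add, map_sub,
      sub_add_cancel]
  refine ⟨⟨m, A.monoid, A.isWeaklyToric_monoid c.weaklyToric.1, A.monoidRank_monoid, e⟩, J u, hue,
    ?_, ?_, ?_, ?_⟩
  · refine Subtype.ext ?_
    rw [(he _ hue).2.2, hΨu]
  · intro w hw β hβ
    obtain ⟨hwW, hwO, hwe⟩ := he w hw
    simp only [hwe] at hβ
    refine (ModelSpace.InteriorAt.comp_interior (hΨs w) ((interiorAt_iff hc (hO's hwO)).1 hβ)).congr ?_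
    filter_upwards [e.open_source.mem_nhds hw] with z hz
    exact congrArg β (he z hz).2.2
  · intro w hw p
    obtain ⟨hwW, hwO, hwe⟩ := he w hw
    obtain ⟨s₁, s₂, hs, -⟩ := A.exists_eq_lift p
    refine ⟨fun y => lam s₁ (c.φ.symm y), fun y => lam s₂ (c.φ.symm y), ?_, ?_, hquot p s₁ s₂ hs w hw⟩
    · simp only [hwe]
      exact interiorAt_lam_symm hc (hO's hwO) s₁
    · simp only [hwe]
      exact interiorAt_lam_symm hc (hO's hwO) s₂
  · intro p hp
    -- A multiple of `p` is `ψ q + t` with `λ_q` nonzero at `u`. Then `q` is a unit there and `ψ q =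
    -- 0`, so the multiple, and with it `p`, is supported in `T`.
    have hpu : (p : Fin m → ℤ) ∈ A.unitGroup := by
      obtain ⟨j, hj, q, t, hqt⟩ := A.exists_nsmul_eq p
      have h1 : lam (A.ψQ q) (J u) ≠ 0 := by
        intro h0
        have := congrArg (fun p => lam p (J u)) hqt
        simp only [lam_nsmul, lam_add, h0, zero_mul] at this
        exact hp (pow_eq_zero_iff hj.ne' |>.1 this)
      have h2 : lam q u ≠ 0 := by
        rw [← hΨu, hΨa]
        exact mul_ne_zero h1 (Real.exp_pos _).ne'
      have h3 : A.ψ (toGrp q) = 0 := eq_zero_of_faceGen hr A.ψ_φ h2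
      intro ν hν
      have h4 := congrFun (congrArg Subtype.val hqt) ν
      have h5 : ((A.ψQ q : A.monoid) : Fin m → ℤ) = 0 := h3
      rw [AddSubmonoid.coe_add, h5, zero_add, A.coe_unit, t.2 ν hν, AddSubmonoidClass.coe_nsmul,
        Pi.smul_apply, nsmul_eq_mul, mul_eq_zero] at h4
      exact h4.resolve_left (by exact_mod_cast hj.ne')
    obtain ⟨s₁, s₂, hs, hs'⟩ := A.exists_eq_lift p
    obtain ⟨-, hs₂⟩ := hs' hpu
    have hq := hquot p s₁ s₂ hs (J u) hue
    have hex : e (J u) = ⟨c.φ u, hx⟩ := Subtype.ext (by rw [(he _ hue).2.2, hΨu])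
    rw [hex] at hq
    refine ⟨fun y => lam s₁ (c.φ.symm y), fun y => lam s₂ (c.φ.symm y),
      interiorAt_lam_symm hc hu s₁, interiorAt_lam_symm hc hu s₂, ?_, hq⟩
    simp only [c.φ.left_inv hu]
    exact (lam_nonneg _ _).lt_of_ne' hs₂

end

end GCornersStructure

/-! ### Admissible charts: gluing and rigidity -/

namespace GCornersStructure

variable {m n : ℕ} {X Y : Type*} [TopologicalSpace X] [TopologicalSpace Y]
  {S : GCornersStructure n Y} {i : X → Y}

/-- The function `a` is interior near `x` in every chart in which `i` pulls interior maps back to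
interior maps. -/
def IsUniversallyInteriorAt (m : ℕ) (S : GCornersStructure n Y) (i : X → Y) (a : X → ℝ) (x : X) :
    Prop :=
  ∀ c : GChart m X, S.PullsBack i c → ∀ w ∈ c.φ.source, c.φ w = x →
    ModelSpace.InteriorAt (fun z => a (c.φ z)) w

/-- Numerator and denominator pull back to `λ_{p₁} exp c₁` and `λ_{p₂} exp c₂`, so on the interior
the quotient is `λ_{p₁-p₂} exp (c₁-c₂)`; its continuity brings the exponent into the monoid up to
units. No compatibility between charts is presupposed. -/
theorem IsQuotientAt.isUniversallyInteriorAt {a : X → ℝ} {x : X} (h : S.IsQuotientAt i a x)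
    (ha : ∀ᶠ z in 𝓝 x, ContinuousAt a z) : S.IsUniversallyInteriorAt m i a x := by
  rintro c hc w hw rfl
  obtain ⟨b₁, b₂, h₁, h₂, he⟩ := h
  obtain ⟨p₁, c₁, hc₁, e₁⟩ := (hc w hw b₁ h₁).exists_logHom
  obtain ⟨p₂, c₂, hc₂, e₂⟩ := (hc w hw b₂ h₂).exists_logHom
  refine interiorAt_of_logHom c.weaklyToric (e := toGrp p₁ - toGrp p₂) ?_ (hc₁.sub hc₂) ?_
  · filter_upwards [(c.φ.continuousAt hw).eventually ha, c.φ.open_source.mem_nhds hw] with z hz hz'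
    exact ContinuousAt.comp (g := a) hz (c.φ.continuousAt hz')
  · filter_upwards [(c.φ.continuousAt hw).eventually he, e₁, e₂] with z hz hz₁ hz₂ hi
    rw [hz₁, hz₂] at hz
    have h0 : lam p₂ z * Real.exp (c₂ z) ≠ 0 := mul_ne_zero (hi _).ne' (Real.exp_pos _).ne'
    rw [eq_div_of_mul_eq h0 hz, map_sub, ← exp_logHom hi, ← exp_logHom hi, ← Real.exp_add,
      ← Real.exp_add, ← Real.exp_sub]
    congr 1
    ring

/-- Charts in which interior maps pull back to interior maps, and whose coordinates are determined
by the ambient manifold. -/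
structure IsAdmissible (S : GCornersStructure n Y) (i : X → Y) (c : GChart m X) : Prop where
  pullsBack : S.PullsBack i c
  universal : ∀ w ∈ c.φ.source, ∀ p,
    S.IsUniversallyInteriorAt m i (fun y => lam p (c.φ.symm y)) (c.φ w)

theorem IsAdmissible.compatible {c d : GChart m X} (hc : S.IsAdmissible i c)
    (hd : S.IsAdmissible i d) : c.Compatible d := by
  have key : ∀ {c d : GChart m X}, S.IsAdmissible i c → S.IsAdmissible i d →
      ∀ u ∈ c.φ.source, c.φ u ∈ d.φ.target → SmoothMapAt (fun x => d.φ.symm (c.φ x)) u :=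
    fun {c d} hc hd u hu hud q => Or.inl (hd.universal _ (d.φ.map_target hud) q c hc.pullsBack u hu
      (d.φ.right_inv hud).symm)
  exact ⟨key hc hd, key hd hc⟩

theorem IsQuotientAt.isAdmissible {c : GChart m X} (hc : S.PullsBack i c)
    (h : ∀ z ∈ c.φ.source, ∀ p, S.IsQuotientAt i (fun y => lam p (c.φ.symm y)) (c.φ z)) :
    S.IsAdmissible i c := by
  refine ⟨hc, fun w hw p => (h w hw p).isUniversallyInteriorAt ?_⟩
  filter_upwards [c.φ.open_target.mem_nhds (c.φ.map_source hw)] with y hy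
  exact (continuous_lam p).continuousAt.comp (c.φ.continuousAt_symm hy)

/-- Compatibility composes only at points covered by the middle chart; admissible charts will supply
one at every point. -/
theorem _root_.GCorners.GChart.Compatible.trans_of_mem {c d e : GChart m X} (h : c.Compatible e)
    (h' : e.Compatible d) {u : ModelSpace c.P} (hu : u ∈ c.φ.source) (hud : c.φ u ∈ d.φ.target)
    (hue : c.φ u ∈ e.φ.target) : SmoothMapAt (fun x => d.φ.symm (c.φ x)) u := by
  have h1 := h.1 u hu hue
  have hv := e.φ.map_target hue
  have hev := e.φ.right_inv hue
  refine (SmoothMapAt.comp (G := fun y => d.φ.symm (e.φ y))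
    (h'.1 _ hv (by rwa [hev])) h1).congr ?_
  filter_upwards [(c.φ.continuousAt hu).eventually (e.φ.open_target.mem_nhds hue)] with z hz
  rw [e.φ.right_inv hz]

/-- Admissible charts covering a space define a structure of a manifold with g-corners. -/
theorem exists_structure (h2 : T2Space X) (hsc : SecondCountableTopology X)
    (h : ∀ x, ∃ c : GChart m X, S.IsAdmissible i c ∧ x ∈ c.φ.target) :
    ∃ T : GCornersStructure m X, ∀ c, S.IsAdmissible i c → c ∈ T.charts := by
  refine ⟨{
    t2 := h2
    secondCountable := hsc
    -- The maximal atlas: all charts compatible with every admissible one.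
    charts := {c | ∀ d, S.IsAdmissible i d → c.Compatible d}
    compatible := fun c hc d hd => ⟨fun u hu hud => ?_, fun u hu hud => ?_⟩
    cover := fun x => ?_
    maximal := fun c hc d hd => hc d fun e he => hd.compatible he },
    fun c hc d hd => hc.compatible hd⟩
  · obtain ⟨e, he, hue⟩ := h (c.φ u)
    exact (hc e he).trans_of_mem (hd e he).symm hu hud hue
  · obtain ⟨e, he, hue⟩ := h (d.φ u)
    exact (hd e he).trans_of_mem (hc e he).symm hu hud hue
  · obtain ⟨c, hc, hx⟩ := h x
    exact ⟨c, fun d hd => hc.compatible hd, hx⟩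

/-- Structures all of whose charts are admissible coincide. -/
theorem eq_of_isAdmissible {T T' : GCornersStructure m X} (h : ∀ c ∈ T.charts, S.IsAdmissible i c)
    (h' : ∀ c ∈ T'.charts, S.IsAdmissible i c) : T = T' := by
  have hc : T.charts = T'.charts := Set.Subset.antisymm
    (fun c hc => T'.maximal c fun d hd => (h c hc).compatible (h' d hd))
    (fun c hc => T.maximal c fun d hd => (h' c hc).compatible (h d hd))
  cases T
  cases T'
  cases hc
  rfl

end GCornersStructure

/-! ### Torsion-free quotients -/

section

variable {M : Type*} [AddCommMonoid M]

theorem quotientCon_mk_eq {N : AddSubmonoid M} {a b : M} :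
    ((a : (GCornersStructure.quotientCon N).Quotient) = b) ↔
      ∃ q ∈ N, ∃ q' ∈ N, a + q = b + q' := AddCon.eq _

/-- Cancellation passes to the quotient, which therefore embeds in the group it generates. Elements
of that group are differences, so torsion can be tested on pairs in the monoid. -/
theorem isTorsionFreeMonoid_quotient_iff (hM : ∀ a b c : M, a + c = b + c → a = b)
    (N : AddSubmonoid M) :
    GCornersStructure.IsTorsionFreeMonoid (GCornersStructure.quotientCon N).Quotient ↔
      ∀ j : ℕ, j ≠ 0 → ∀ a b, (∃ q ∈ N, ∃ q' ∈ N, j • a + q = j • b + q') →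
        ∃ q ∈ N, ∃ q' ∈ N, a + q = b + q' := by
  have hcancel : IsCancelAdd (GCornersStructure.quotientCon N).Quotient := by
    have : IsRightCancelAdd (GCornersStructure.quotientCon N).Quotient := ⟨fun c a b => by
      induction a, b using AddCon.induction_on₂ with | _ a b
      induction c using AddCon.induction_on with | _ c
      intro h
      obtain ⟨q, hq, q', hq', h⟩ := quotientCon_mk_eq.1 h
      refine quotientCon_mk_eq.2 ⟨q, hq, q', hq', hM _ _ c ?_⟩
      rw [add_right_comm, h, add_right_comm]⟩
    exact AddCommMagma.IsRightCancelAdd.toIsCancelAdd _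
  have hinj := Algebra.GrothendieckAddGroup.of_injective
    (M := (GCornersStructure.quotientCon N).Quotient)
  constructor
  · intro h j hj a b hab
    have h1 : (j • (a : (GCornersStructure.quotientCon N).Quotient)) = j • b :=
      quotientCon_mk_eq.2 hab
    refine quotientCon_mk_eq.1 (hinj (h.nsmul_right_injective hj ?_))
    simp only
    rw [← map_nsmul, h1, map_nsmul]
  · intro h
    refine ⟨fun j hj z z' hz => ?_⟩
    obtain ⟨⟨a, b, hb⟩, hab⟩ := (AddLocalization.addMonoidOf
      (⊤ : AddSubmonoid (GCornersStructure.quotientCon N).Quotient)).surj (z - z')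
    have hab' : z - z' + Algebra.GrothendieckAddGroup.of b = Algebra.GrothendieckAddGroup.of a := hab
    have h0 : j • (z - z') = 0 := by rw [smul_sub, sub_eq_zero]; exact hz
    have h1 : j • a = j • b := hinj (by
      rw [map_nsmul, map_nsmul, ← hab', smul_add, h0, zero_add])
    have h2 : a = b := by
      induction a, b using AddCon.induction_on₂ with | _ a b
      exact quotientCon_mk_eq.2 (h j hj a b (quotientCon_mk_eq.1 h1))
    rw [h2, add_eq_right] at hab'
    exact sub_eq_zero.1 hab'

end

/-! ### Immersions from quotient descriptions of coordinates -/

namespace GCornersStructure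

variable {m n : ℕ} {X Y : Type*} [TopologicalSpace X] [TopologicalSpace Y]
  {S : GCornersStructure n Y} {T : GCornersStructure m X} {i : X → Y}

theorem dualMonoid_cancel {x : X} {J : Submonoid (Germ (𝓝 x) ℝ)} (a b c : dualMonoid J)
    (h : a + c = b + c) : a = b := by
  refine Subtype.ext (AddMonoidHom.ext fun z => ?_)
  have := DFunLike.congr_fun (congrArg Subtype.val h) z
  exact Nat.add_right_cancel this

/-- On the stratum of `x` near `x`, the coordinates vanishing at `x` vanish. -/
theorem eventually_lam_eq_zero_of_mem_stratum {c : GChart m X} (hc : c ∈ T.charts)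
    {w : ModelSpace c.P} (hw : w ∈ c.φ.source) {k : ℕ} (hk : c.φ w ∈ T.stratum k) {p : c.P}
    (hp : lam p w = 0) :
    ∀ᶠ y in 𝓝 (c.φ w), y ∈ T.stratum k → lam p (c.φ.symm y) = 0 := by
  obtain ⟨N, r, hr⟩ := exists_generates c.weaklyToric.1
  rw [← c.φ.map_nhds_eq hw, eventually_map]
  filter_upwards [c.φ.open_source.mem_nhds hw, (isOpen_faceOpen r w).mem_nhds (mem_faceOpen r w)]
    with z hz hzf hzk
  rw [c.φ.left_inv hz]
  have h1 := (mem_stratum_iff hc hw).1 hk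
  have h2 := (mem_stratum_iff hc hz).1 hzk
  refine lam_eq_zero_of_rank_eq c.weaklyToric (fun q hq => ?_) (by omega) hp
  obtain ⟨a, rfl⟩ := exists_eq_sum_faceGen hr hq
  rw [lam_sum]
  refine Finset.prod_ne_zero_iff.2 fun j _ => ?_
  rw [lam_nsmul]
  exact pow_ne_zero _ (hzf j)

/-- The data that make the inclusion of a solution set an immersion at a point. -/
theorem isImmersion_of_charts (hi : Continuous i)
    (h : ∀ x, ∃ e ∈ T.charts, ∃ w ∈ e.φ.source, e.φ w = x ∧ S.PullsBack i e ∧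
      (∀ p, S.IsQuotientAt i (fun y => lam p (e.φ.symm y)) x) ∧
      ∀ p, lam p w ≠ 0 → ∃ b₁ b₂, S.InteriorAt b₁ (i x) ∧ S.InteriorAt b₂ (i x) ∧ 0 < b₂ (i x) ∧
        ∀ᶠ y in 𝓝 x, lam p (e.φ.symm y) * b₂ (i y) = b₁ (i y)) : T.IsImmersion S i := by
  have hint : ∀ x b, S.InteriorAt b (i x) → T.InteriorAt (fun z => b (i z)) x := by
    intro x b hb
    obtain ⟨e, he, w, hw, rfl, hp, -⟩ := h x
    exact (interiorAt_iff he hw).2 (hp w hw b hb)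
  have hsm : T.IsSmoothMap S i := isSmoothMap_of_interiorAt hi fun x => by
    obtain ⟨d, hd, hx⟩ := S.cover (i x)
    refine ⟨d, hd, hx, fun q => hint x (fun y => lam q (d.φ.symm y)) ?_⟩
    have := interiorAt_lam_symm hd (d.φ.map_target hx) q
    rwa [d.φ.right_inv hx] at this
  refine ⟨hsm, fun x => ?_⟩
  obtain ⟨e, he, w, hw, rfl, hpb, hq, hq'⟩ := h x
  have hpull : ∀ b, b ∈ S.interiorGerms (i (e.φ w)) → b ∈ T.pulledGerms S i hsm.1 (e.φ w) := by
    rintro _ ⟨b, hb, rfl⟩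
    exact ⟨⟨b, hb, rfl⟩, _, hint _ b hb, rfl⟩
  let ι : S.interiorGerms (i (e.φ w)) → T.pulledGerms S i hsm.1 (e.φ w) := fun b => ⟨b, hpull b b.2⟩
  -- differences of values on the image determine the values
  have hkey : ∀ p : e.P, ∃ s₁ s₂ : T.pulledGerms S i hsm.1 (e.φ w),
      germLam he hw p * T.interiorPullback S i hsm.1 (e.φ w) s₂ =
        T.interiorPullback S i hsm.1 (e.φ w) s₁ := by
    intro p
    obtain ⟨b₁, b₂, h₁, h₂, heq⟩ := hq p
    exact ⟨ι (S.interiorGerm b₁ h₁), ι (S.interiorGerm b₂ h₂), Subtype.ext (Germ.coe_eq.2 heq)⟩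
  refine ⟨fun k hk v hv v' hv' hvv => ?_, fun α α' hαα => ?_, ?_⟩
  · have hD := Submodule.sub_mem _ hv hv'
    set D := v - v'
    have hD0 : ∀ b : S.smoothGerms (i (e.φ w)), D (T.smoothPullback S i hsm (e.φ w) b) = 0 := by
      intro b
      have := LinearMap.congr_fun hvv b
      exact sub_eq_zero.2 this
    obtain ⟨N, r, hr⟩ := exists_generates e.weaklyToric.1
    refine sub_eq_zero.1 (IsDerivation.eq_zero he hw hD.1 hr fun j => ?_)
    -- Coordinates vanishing at `w` vanish on the stratum near it, so `D` kills them. For the others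
    -- the Leibniz rule on `λ_r · b₂ = b₁`, with `D` zero on ambient functions and `b₂` positive,
    -- gives the claim.
    by_cases hj : lam (r j) w = 0
    · exact hD.2 _ (interiorAt_lam_symm he hw (r j)).smoothAt
        (eventually_lam_eq_zero_of_mem_stratum he hw hk hj)
    · obtain ⟨b₁, b₂, h₁, h₂, h0, heq⟩ := hq' (r j) hj
      have hl := (interiorAt_lam_symm he hw (r j)).smoothAt
      have h2 := (hint _ b₂ h₂).smoothAt
      have e1 := IsDerivation.map_mul hD.1 hl h2
      rw [smoothGerm_congr (hb := (hint _ b₁ h₁).smoothAt) heq] at e1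
      have e2 : D (T.smoothGerm _ (hint _ b₁ h₁).smoothAt) = 0 :=
        hD0 (S.smoothGerm b₁ h₁.smoothAt)
      have e3 : D (T.smoothGerm _ h2) = 0 := hD0 (S.smoothGerm b₂ h₂.smoothAt)
      rw [e2, e3, mul_zero, add_zero] at e1
      exact (mul_eq_zero.1 e1.symm).resolve_right h0.ne'
  · refine Subtype.ext (hom_ext_germLam he hw α.2 α'.2 fun p => ?_)
    obtain ⟨s₁, s₂, hs⟩ := hkey p
    have h1 := congrArg (fun b => α.1 (Additive.ofMul b)) hs
    have h2 := congrArg (fun b => α'.1 (Additive.ofMul b)) hs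
    have e1 := DFunLike.congr_fun (congrArg Subtype.val hαα) (Additive.ofMul s₁)
    have e2 := DFunLike.congr_fun (congrArg Subtype.val hαα) (Additive.ofMul s₂)
    change α.1 (Additive.ofMul (T.interiorPullback S i hsm.1 (e.φ w) s₁)) =
      α'.1 (Additive.ofMul (T.interiorPullback S i hsm.1 (e.φ w) s₁)) at e1
    change α.1 (Additive.ofMul (T.interiorPullback S i hsm.1 (e.φ w) s₂)) =
      α'.1 (Additive.ofMul (T.interiorPullback S i hsm.1 (e.φ w) s₂)) at e2
    simp only [ofMul_mul, map_add] at h1 h2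
    omega
  · rw [isTorsionFreeMonoid_quotient_iff dualMonoid_cancel]
    rintro j hj β β' ⟨_, ⟨α₁, rfl⟩, _, ⟨α₂, rfl⟩, heq⟩
    have heq' : ∀ s : T.pulledGerms S i hsm.1 (e.φ w),
        j * β.1 (Additive.ofMul s) +
          α₁.1 (Additive.ofMul (T.interiorPullback S i hsm.1 (e.φ w) s)) =
        j * β'.1 (Additive.ofMul s) +
          α₂.1 (Additive.ofMul (T.interiorPullback S i hsm.1 (e.φ w) s)) := fun s =>
      DFunLike.congr_fun (congrArg Subtype.val heq) (Additive.ofMul s)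
    obtain ⟨j, rfl⟩ := Nat.exists_eq_succ_of_ne_zero hj
    -- With the multiplier now `j + 1`, this is `α₂ - α₁` shifted by `(j + 1) α₁` to stay in `ℕ`.
    -- Writing `λ_p` as an ambient quotient turns `heq'` into divisibility of `γ` by `j + 1`, and `γ
    -- / (j + 1)` is the missing element of the image.
    set γ : Additive (T.interiorGerms (e.φ w)) →+ ℕ := α₂.1 + j • α₁.1 with hγ
    have hγ0 : ∀ b : T.interiorGerms (e.φ w), 0 < (b : Germ (𝓝 (e.φ w)) ℝ).value →
        γ (Additive.ofMul b) = 0 := fun b hb => by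
      rw [hγ, AddMonoidHom.add_apply, AddMonoidHom.nsmul_apply, α₂.2 b hb, α₁.2 b hb]
      rfl
    have hdvd : ∀ b, j.succ ∣ γ b := by
      intro b
      obtain ⟨p, a, hb⟩ := exists_eq_germLam_mul_exp he hw b.toMul
      obtain rfl : b = Additive.ofMul _ := hb
      change j.succ ∣ γ (Additive.ofMul (germLam he hw p * T.expGerm _ a))
      rw [ofMul_mul, map_add, hγ0 _ (expGerm_value_pos a), add_zero]
      obtain ⟨s₁, s₂, hs⟩ := hkey p
      have h1 := congrArg (fun b => α₁.1 (Additive.ofMul b)) hs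
      have h2 := congrArg (fun b => α₂.1 (Additive.ofMul b)) hs
      have e1 := heq' s₁
      have e2 := heq' s₂
      simp only [ofMul_mul, map_add] at h1 h2
      rw [hγ, AddMonoidHom.add_apply, AddMonoidHom.nsmul_apply, smul_eq_mul]
      rw [← Int.natCast_dvd_natCast]
      refine ⟨β.1 (Additive.ofMul s₁) - β'.1 (Additive.ofMul s₁) - (β.1 (Additive.ofMul s₂) -
        β'.1 (Additive.ofMul s₂)) + α₁.1 (Additive.ofMul (germLam he hw p)), ?_⟩
      zify at h1 h2 e1 e2
      push_cast
      linear_combination h2 - h1 + e2 - e1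
    let γ' : T.MTilde (e.φ w) := ⟨
      { toFun := fun b => γ b / j.succ
        map_zero' := by rw [map_zero, Nat.zero_div]
        map_add' := fun a b => by rw [map_add, Nat.add_div_of_dvd_right (hdvd a)] },
      fun b hb => by
        change γ (Additive.ofMul b) / j.succ = 0
        rw [hγ0 b hb, Nat.zero_div]⟩
    refine ⟨_, ⟨α₁, rfl⟩, _, ⟨γ', rfl⟩, Subtype.ext (AddMonoidHom.ext fun s => ?_)⟩
    have e1 := heq' s.toMul
    obtain ⟨t, ht⟩ := hdvd (Additive.ofMul (T.interiorPullback S i hsm.1 (e.φ w) s.toMul))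
    change β.1 (Additive.ofMul s.toMul) +
        α₁.1 (Additive.ofMul (T.interiorPullback S i hsm.1 (e.φ w) s.toMul)) =
      β'.1 (Additive.ofMul s.toMul) +
        γ (Additive.ofMul (T.interiorPullback S i hsm.1 (e.φ w) s.toMul)) / j.succ
    rw [ht, Nat.mul_div_cancel_left _ j.succ_pos]
    rw [hγ, AddMonoidHom.add_apply, AddMonoidHom.nsmul_apply, smul_eq_mul] at ht
    refine Nat.eq_of_mul_eq_mul_left j.succ_pos ?_
    zify at e1 ht ⊢
    linear_combination e1 + ht

end GCornersStructure

/-! ### Groups of units and the lattice part of interior maps -/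

section

variable {k : ℕ} {P : AddSubmonoid (Fin k → ℤ)}

/-- The subgroup generated by the support of a point. -/
def faceGroup (w : ModelSpace P) : AddSubgroup (Grp P) :=
  AddSubgroup.closure (((supp w).comap (Grp P).subtype : AddSubmonoid (Grp P)) : Set (Grp P))

theorem mem_faceGroup {w : ModelSpace P} {g : Grp P} :
    g ∈ faceGroup w ↔ ∃ f f' : P, lam f w ≠ 0 ∧ lam f' w ≠ 0 ∧ g = toGrp f - toGrp f' := by
  rw [faceGroup, mem_addSubgroupClosure_iff]
  constructor
  · rintro ⟨a, ⟨f, hf, hfw⟩, b, ⟨f', hf', hfw'⟩, rfl⟩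
    obtain rfl : toGrp f = a := Subtype.ext hf
    obtain rfl : toGrp f' = b := Subtype.ext hf'
    exact ⟨f, f', hfw, hfw', rfl⟩
  · rintro ⟨f, f', hf, hf', rfl⟩
    exact ⟨toGrp f, mem_supp.2 hf, toGrp f', mem_supp.2 hf', rfl⟩

theorem toGrp_mem_faceGroup {w : ModelSpace P} {f : P} (hf : lam f w ≠ 0) :
    toGrp f ∈ faceGroup w :=
  mem_faceGroup.2 ⟨f, 0, hf, by rw [lam_zero]; exact one_ne_zero, by simp⟩

/-- After adding a unit to `g`, a multiple of it lies in `P`; saturation puts the sum itself in `P`,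
and the face property puts it in the support. -/
theorem mem_faceGroup_of_nsmul (hP : IsWeaklyToric P) {w : ModelSpace P} {j : ℕ} {g : Grp P}
    (hj : 0 < j) (h : j • g ∈ faceGroup w) : g ∈ faceGroup w := by
  obtain ⟨f, f', hf, hf', hg⟩ := mem_faceGroup.1 h
  obtain ⟨j, rfl⟩ := Nat.exists_eq_succ_of_ne_zero hj.ne'
  have h1 : j.succ • (g + toGrp f') = toGrp (f + j • f') := by
    rw [smul_add, hg, map_add, map_nsmul, succ_nsmul (toGrp f')]
    abel
  have h2 : j.succ • ((g + toGrp f' : Grp P) : Fin k → ℤ) = ((f + j • f' : P) : Fin k → ℤ) :=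
    congrArg Subtype.val h1
  have h3 : ((g + toGrp f' : Grp P) : Fin k → ℤ) ∈ P :=
    hP.2 j.succ hj _ (g + toGrp f').2 (by rw [h2]; exact (f + j • f').2)
  have h4 : lam (⟨_, h3⟩ : P) w ≠ 0 := by
    refine mem_supp.1 ((isFace_supp w).mem_of_nsmul h3 hj ?_)
    rw [h2, mem_supp, lam_add, lam_nsmul]
    exact mul_ne_zero hf (pow_ne_zero _ hf')
  refine mem_faceGroup.2 ⟨⟨_, h3⟩, f', h4, hf', ?_⟩
  rw [eq_sub_iff_add_eq]
  rfl

/-- If a monomial is smooth and positive near `w`, its exponent lies in the group of the support. -/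
theorem mem_faceGroup_of_logHom (hP : IsWeaklyToric P) {w : ModelSpace P} {e : Grp P}
    {c : ModelSpace P → ℝ} (hc : ContinuousAt c w)
    (h : ∀ᶠ z in 𝓝 w, z ∈ interior P → logHom z e = c z) : e ∈ faceGroup w := by
  have h1 : ∀ᶠ z in 𝓝[interior P] w, Real.exp (logHom z e) ≤ Real.exp (c w + 1) ∧
      Real.exp (c w - 1) ≤ Real.exp (logHom z e) := by
    rw [eventually_nhdsWithin_iff]
    filter_upwards [h, hc.eventually (lt_mem_nhds (sub_one_lt (c w))),
      hc.eventually (gt_mem_nhds (lt_add_one (c w)))] with z h1 h2 h3 hz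
    rw [h1 hz]
    exact ⟨Real.exp_le_exp.2 h3.le, Real.exp_le_exp.2 h2.le⟩
  obtain ⟨f, p, hf, hp, hfp⟩ := exists_add_eq_of_bounded_below hP (Real.exp_pos _) h1
  exact mem_faceGroup.2 ⟨p, f, hp, hf, eq_sub_of_add_eq hfp⟩

/-- Smooth maps are log-linear modulo smooth functions. -/
theorem exists_logHom_comp_eq {l : ℕ} {Q : AddSubmonoid (Fin l → ℤ)} (hQ : Q.FG)
    {F : ModelSpace P → ModelSpace Q} {w : ModelSpace P}
    (hF : ∀ q, ModelSpace.InteriorAt (fun z => lam q (F z)) w) :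
    ∃ (φ : Grp Q →+ Grp P) (C : ModelSpace P → (Grp Q →+ ℝ)),
      (∀ g, ModelSpace.SmoothAt (fun z => C z g) w) ∧
      ∀ᶠ z in 𝓝 w, z ∈ interior P →
        F z ∈ interior Q ∧ ∀ g, logHom (F z) g = logHom z (φ g) + C z g := by
  obtain ⟨b⟩ := nonempty_basis_grp (P := Q) rfl
  choose q₁ q₂ hq using fun j => exists_eq_toGrp_sub (b j)
  choose p c hc hpc using fun q => (hF q).exists_logHom
  let φ : Grp Q →+ Grp P :=
    (b.constr ℤ fun j => toGrp (p (q₁ j)) - toGrp (p (q₂ j))).toAddMonoidHom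
  have hφ : ∀ j, φ (b j) = toGrp (p (q₁ j)) - toGrp (p (q₂ j)) := fun j => b.constr_basis ℤ _ j
  let C : ModelSpace P → (Grp Q →+ ℝ) := fun z =>
    homEquiv b fun j => c (q₁ j) z - c (q₂ j) z
  have hC : ∀ z j, C z (b j) = c (q₁ j) z - c (q₂ j) z := fun z j => by
    rw [← homEquiv_symm_apply, LinearEquiv.symm_apply_apply]
  obtain ⟨N, r, hr⟩ := exists_generates hQ
  refine ⟨φ, C, fun g => ?_, ?_⟩
  · simp only [C, homEquiv_apply]
    exact SmoothAt.sum _ fun j _ => (smoothAt_const _ _).mul ((hc _).sub (hc _))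
  · filter_upwards [eventually_all.2 fun j => (hF (r j)).eventually_pos,
      eventually_all.2 fun j => hpc (q₁ j), eventually_all.2 fun j => hpc (q₂ j)]
      with z hz h₁ h₂ hi
    have hFi : F z ∈ interior Q := fun q => by
      obtain ⟨a, rfl⟩ := hr q
      rw [lam_sum]
      refine Finset.prod_pos fun j _ => ?_
      rw [lam_nsmul]
      exact pow_pos (hz j hi) _
    refine ⟨hFi, fun g => ?_⟩
    have hlog : ∀ q, lam q (F z) = lam (p q) z * Real.exp (c q z) →
        logHom (F z) (toGrp q) = logHom z (toGrp (p q)) + c q z := fun q hq => by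
      rw [logHom_toGrp hFi, logHom_toGrp hi, hq, Real.log_mul (hi _).ne' (Real.exp_pos _).ne',
        Real.log_exp]
    have : (logHom (F z)).toIntLinearMap = ((logHom z).comp φ + C z).toIntLinearMap := by
      refine b.ext fun j => ?_
      change logHom (F z) (b j) = logHom z (φ (b j)) + C z (b j)
      rw [hφ, hC, map_sub, hq j, map_sub, hlog _ (h₁ j), hlog _ (h₂ j)]
      ring
    exact LinearMap.congr_fun this g

/-- A functional on the group of `P` vanishing on a face becomes nonnegative on `P` after adding a
multiple of `j` times another one. -/
theorem exists_nonneg_functional (hP : IsWeaklyToric P) {w : ModelSpace P} (β : Grp P →+ ℤ)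
    (hβ : ∀ f, lam f w ≠ 0 → β (toGrp f) = 0) {j : ℕ} (hj : j ≠ 0) :
    ∃ (β' : P →+ ℕ) (γ : Grp P →+ ℤ), (∀ f, lam f w ≠ 0 → β' f = 0) ∧
      ∀ p, (β' p : ℤ) = β (toGrp p) + j * γ (toGrp p) := by
  obtain ⟨N, r, hr⟩ := exists_generates hP.1
  obtain ⟨α, h0, h1⟩ := (isFace_supp w).exists_pos_functional hP
  -- On each generator off the support `α` is at least `1`, so this multiple of `α` outweighs every
  -- negative value of `β`.
  let γ : Grp P →+ ℤ := (∑ i, |β (toGrp (r i))|) • α.comp (Grp P).subtype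
  have hγ : ∀ p : P, γ (toGrp p) = (∑ i, |β (toGrp (r i))|) * α p := fun _ => rfl
  let η : Grp P →+ ℤ := β + (j : ℤ) • γ
  have hη : ∀ p : P, η (toGrp p) = β (toGrp p) + j * γ (toGrp p) := fun _ => rfl
  have hηf : ∀ f, lam f w ≠ 0 → η (toGrp f) = 0 := fun f hf => by
    rw [hη, hγ, hβ f hf, h0 f (mem_supp.2 hf), mul_zero, mul_zero, zero_add]
  have hηr : ∀ i, 0 ≤ η (toGrp (r i)) := fun i => by
    by_cases hi : lam (r i) w = 0
    · have h2 : 1 ≤ α (r i) := h1 _ (r i).2 fun h => mem_supp.1 h hi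
      have h3 : |β (toGrp (r i))| ≤ ∑ i, |β (toGrp (r i))| :=
        Finset.single_le_sum (f := fun i => |β (toGrp (r i))|) (fun _ _ => abs_nonneg _)
          (Finset.mem_univ i)
      have h4 : (1 : ℤ) ≤ j := by exact_mod_cast Nat.one_le_iff_ne_zero.2 hj
      have h5 := neg_abs_le (β (toGrp (r i)))
      have h6 : |β (toGrp (r i))| ≤ γ (toGrp (r i)) := by
        rw [hγ]
        exact h3.trans (le_mul_of_one_le_right ((abs_nonneg _).trans h3) h2)
      have h7 := le_mul_of_one_le_left ((abs_nonneg _).trans h6) h4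
      rw [hη]
      linarith
    · rw [hηf _ hi]
  have hηp : ∀ p : P, 0 ≤ η (toGrp p) := fun p => by
    obtain ⟨a, rfl⟩ := hr p
    rw [map_sum, map_sum]
    refine Finset.sum_nonneg fun i _ => ?_
    rw [map_nsmul, map_nsmul]
    exact nsmul_nonneg (hηr i) _
  refine ⟨{ toFun := fun p => (η (toGrp p)).toNat
            map_zero' := by rw [map_zero, map_zero, Int.toNat_zero]
            map_add' := fun p q => by rw [map_add, map_add, Int.toNat_add (hηp p) (hηp q)] }, γ,
    fun f hf => ?_, fun p => ?_⟩
  · change (η (toGrp f)).toNat = 0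
    rw [hηf f hf, Int.toNat_zero]
  · exact (Int.toNat_of_nonneg (hηp p)).trans (hη p)

end

/-- A proper subgroup `K` of a free group of finite rank that contains a saturated subgroup `F` is
detected, modulo some integer, by a functional that vanishes on `F`. -/
theorem exists_functional_of_ne_top {G : Type} [AddCommGroup G] {n : ℕ}
    (b : Module.Basis (Fin n) ℤ G) {F K : AddSubgroup G} (hFK : F ≤ K)
    (hF : ∀ (m : ℕ) (g : G), 0 < m → m • g ∈ F → g ∈ F) (hK : K ≠ ⊤) :
    ∃ j : ℕ, j ≠ 0 ∧ ∃ β : G →+ ℤ, (∀ g ∈ F, β g = 0) ∧ (∀ g ∈ K, (j : ℤ) ∣ β g) ∧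
      ∃ g, ¬ (j : ℤ) ∣ β g := by
  obtain ⟨a, π, σ, hσ, hπ, hsub⟩ := exists_basis_quotient b F hF
  have hfin : Module.Finite ℤ G := Module.Finite.of_basis b
  have hK' : AddSubgroup.toIntSubmodule K ≠ ⊤ := fun h => hK (by simpa using h)
  -- The quotient by a maximal subgroup containing `K` is a simple `ℤ`-module, hence `ℤ/j`; here `j
  -- ≠ 0` because `ℤ` is not a field.
  obtain ⟨M, hM, hKM⟩ := (eq_top_or_exists_le_coatom (AddSubgroup.toIntSubmodule K)).resolve_left hK'
  have hsimple : IsSimpleModule ℤ (G ⧸ M) := isSimpleModule_iff_isCoatom.2 hM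
  obtain ⟨I, hI, ⟨ε⟩⟩ := isSimpleModule_iff_quot_maximal.1 hsimple
  obtain ⟨j, rfl⟩ : ∃ j : ℕ, I = Ideal.span {(j : ℤ)} := by
    obtain ⟨t, rfl⟩ := IsPrincipalIdealRing.principal I
    exact ⟨t.natAbs, (Int.span_natAbs t).symm⟩
  have hj : j ≠ 0 := by
    rintro rfl
    have : (⊥ : Ideal ℤ).IsMaximal := by simpa using hI
    exact Int.not_isField (Ring.isField_iff_maximal_bot.2 this)
  let χ : G →ₗ[ℤ] ℤ ⧸ Ideal.span {(j : ℤ)} := ε.toLinearMap ∘ₗ M.mkQ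
  have hχ : ∀ g, χ g = 0 ↔ g ∈ M := fun g => by
    simp [χ]
  -- The character with kernel `M` is lifted to `ℤ` on a basis of `G / F`. Defining the lift through
  -- `π` makes it vanish exactly on `F`, and not merely modulo `j`.
  choose t ht using fun μ => Ideal.Quotient.mk_surjective (χ (σ μ))
  let β : G →+ ℤ :=
    { toFun := fun g => ∑ μ, π g μ * t μ
      map_zero' := by simp
      map_add' := fun g h => by simp [add_mul, Finset.sum_add_distrib] }
  have hβ : ∀ g, β g = ∑ μ, π g μ * t μ := fun _ => rfl
  have hβχ : ∀ g, (Ideal.Quotient.mk (Ideal.span {(j : ℤ)}) (β g)) = χ g := by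
    intro g
    have h1 : χ (g - ∑ μ, π g μ • σ μ) = 0 := (hχ _).2 (hKM (hFK (hsub g)))
    rw [map_sub, sub_eq_zero, map_sum] at h1
    rw [h1, hβ, map_sum]
    refine Finset.sum_congr rfl fun μ _ => ?_
    rw [map_mul, ht, map_zsmul, zsmul_eq_mul]
    rfl
  have hdvd : ∀ g, (j : ℤ) ∣ β g ↔ g ∈ M := fun g => by
    rw [← hχ, ← hβχ, Ideal.Quotient.eq_zero_iff_mem, Ideal.mem_span_singleton]
  refine ⟨j, hj, β, fun g hg => ?_, fun g hg => (hdvd g).2 (hKM hg), ?_⟩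
  · rw [hβ, (hπ g).2 hg]
    simp
  · by_contra! h
    exact hM.1 (eq_top_iff.2 fun g _ => (hdvd g).1 (h g))

/-! ### The lattice condition in the definition of an immersion -/

namespace GCornersStructure

variable {m n : ℕ} {X Y : Type*} [TopologicalSpace X] [TopologicalSpace Y]
  {S : GCornersStructure n Y} {T : GCornersStructure m X} {i : X → Y}

/-- Smooth maps sending a dense set to the interior pull interior maps back to interior maps. -/
theorem IsSmoothMap.pullsBack (hi : T.IsSmoothMap S i)
    (hd : ∀ x, ∃ᶠ z in 𝓝 x, i z ∈ S.interior) {c : GChart m X} (hc : c ∈ T.charts) :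
    S.PullsBack i c := by
  intro w hw b hb
  obtain ⟨d, hd', hx⟩ := S.cover (i (c.φ w))
  have hv := d.φ.map_target hx
  have hdv := d.φ.right_inv hx
  have hnear : ∀ᶠ z in 𝓝 w, i (c.φ z) ∈ d.φ.target :=
    (hi.1.continuousAt.comp (c.φ.continuousAt hw)).eventually (d.φ.open_target.mem_nhds hx)
  have hint : ∀ q, ModelSpace.InteriorAt (fun z => lam q (d.φ.symm (i (c.φ z)))) w := by
    intro q
    -- The alternative that `λ_q` pulls back to zero is excluded, since points mapping to the
    -- interior of `Y` are dense.
    refine (hi.2 c hc d hd' w hw hx q).resolve_right fun h0 => ?_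
    have hf := hd (c.φ w)
    rw [← c.φ.map_nhds_eq hw, frequently_map] at hf
    obtain ⟨z, hz, h1, h2⟩ := (hf.and_eventually (h0.and hnear)).exists
    rw [← d.φ.right_inv h2, mem_interior_iff hd' (d.φ.map_target h2)] at hz
    exact (hz q).ne' h1
  refine (ModelSpace.InteriorAt.comp_interior (F := fun z => d.φ.symm (i (c.φ z)))
    (f := fun y => b (d.φ y)) hint (hb d hd' _ hv hdv)).congr ?_
  filter_upwards [hnear] with z hz
  rw [d.φ.right_inv hz]

theorem germHom_interiorGerm {B : Type*} [AddCommMonoid B] {c : GChart m X} (hc : c ∈ T.charts)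
    {w : ModelSpace c.P} (hw : w ∈ c.φ.source) (β : c.P →+ B) (hβ : ∀ p, lam p w ≠ 0 → β p = 0)
    {b : X → ℝ} (hb : T.InteriorAt b (c.φ w)) {p : c.P} {a : ModelSpace c.P → ℝ}
    (ha : ModelSpace.SmoothAt a w) (h : ∀ᶠ z in 𝓝 w, b (c.φ z) = lam p z * Real.exp (a z)) :
    germHom hc hw β hβ (Additive.ofMul (T.interiorGerm b hb)) = β p := by
  have hs := smoothAt_symm (S := T) hc hw ha
  have h1 : T.interiorGerm b hb = germLam hc hw p * T.expGerm _ (T.smoothGerm _ hs) := by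
    refine Subtype.ext ((germ_eq_iff hw).2 ?_)
    filter_upwards [h, c.φ.open_source.mem_nhds hw] with z hz hz'
    simp only [Function.comp_apply, hz, c.φ.left_inv hz']
  rw [h1]
  exact germHom_germLam_mul hc hw β hβ p (expGerm_value_pos _)

/-- For an immersion, the pullback of monomials is surjective modulo units. -/
theorem IsImmersion.exists_sub_mem_faceGroup (hi : T.IsImmersion S i)
    (hdense : ∀ x, ∃ᶠ z in 𝓝 x, i z ∈ S.interior) {c : GChart m X} (hc : c ∈ T.charts)
    {w : ModelSpace c.P} (hw : w ∈ c.φ.source) {d : GChart n Y} (hd : d ∈ S.charts)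
    (hx : i (c.φ w) ∈ d.φ.target) {φ : Grp d.P →+ Grp c.P} {C : ModelSpace c.P → (Grp d.P →+ ℝ)}
    (hC : ∀ g, ModelSpace.SmoothAt (fun z => C z g) w)
    (hφ : ∀ᶠ z in 𝓝 w, z ∈ ModelSpace.interior c.P →
      d.φ.symm (i (c.φ z)) ∈ ModelSpace.interior d.P ∧
        ∀ g, logHom (d.φ.symm (i (c.φ z))) g = logHom z (φ g) + C z g) (g : Grp c.P) :
    ∃ ℓ, g - φ ℓ ∈ faceGroup w := by
  obtain ⟨hsm, himm⟩ := hi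
  obtain ⟨-, hinj, htf⟩ := himm (c.φ w)
  have hpb := hsm.pullsBack hdense hc
  obtain ⟨b⟩ := nonempty_basis_grp c.rank_eq
  have hv := d.φ.map_target hx
  have hdv := d.φ.right_inv hx
  have hnear : ∀ᶠ z in 𝓝 w, i (c.φ z) ∈ d.φ.target :=
    (hsm.1.continuousAt.comp (c.φ.continuousAt hw)).eventually (d.φ.open_target.mem_nhds hx)
  have hcont : Tendsto (fun z => d.φ.symm (i (c.φ z))) (𝓝 w) (𝓝 (d.φ.symm (i (c.φ w)))) :=
    ContinuousAt.comp (g := d.φ.symm) (f := fun z => i (c.φ z)) (d.φ.continuousAt_symm hx)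
      (hsm.1.continuousAt.comp (c.φ.continuousAt hw))
  let K : AddSubgroup (Grp c.P) := φ.range ⊔ faceGroup w
  suffices hK : K = ⊤ by
    have hg : g ∈ K := hK ▸ AddSubgroup.mem_top g
    obtain ⟨_, ⟨ℓ, rfl⟩, f, hf, rfl⟩ := AddSubgroup.mem_sup.1 hg
    exact ⟨ℓ, by rwa [add_sub_cancel_left]⟩
  by_contra hK
  -- If `φ` and the units do not generate, some `β` vanishes on units and is divisible by `j` on the
  -- image of `φ` but not everywhere. Made nonnegative without changing residues modulo `j`, it
  -- defines an element `α` of `M̃`.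
  obtain ⟨j, hj, β, hβ0, hβK, g₀, hg₀⟩ := exists_functional_of_ne_top b (F := faceGroup w) (K := K)
    le_sup_right (fun _ _ => mem_faceGroup_of_nsmul c.weaklyToric) hK
  obtain ⟨β', γ, hβ'0, hβ'⟩ := exists_nonneg_functional c.weaklyToric β
    (fun f hf => hβ0 _ (toGrp_mem_faceGroup hf)) hj
  let α : T.MTilde (c.φ w) := ⟨germHom hc hw β' hβ'0, fun _ h => germHom_of_pos hc hw β' hβ'0 h⟩
  have hdvd : ∀ s : T.pulledGerms S i hsm.1 (c.φ w),
      j ∣ α.1 (Additive.ofMul (T.interiorPullback S i hsm.1 (c.φ w) s)) := by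
    rintro ⟨_, ⟨f, hf, rfl⟩, hs⟩
    have hfi := hpb w hw f hf
    obtain ⟨p, a, ha, hpa⟩ := hfi.exists_logHom
    obtain ⟨q, a', ha', hqa⟩ := (hf d hd _ hv hdv).exists_logHom
    have h1 : α.1 (Additive.ofMul (T.interiorPullback S i hsm.1 (c.φ w)
        ⟨_, ⟨f, hf, rfl⟩, hs⟩)) = β' p :=
      germHom_interiorGerm hc hw β' hβ'0 ((interiorAt_iff hc hw).2 hfi) ha hpa
    have h2 : toGrp p - φ (toGrp q) ∈ faceGroup w := by
      refine mem_faceGroup_of_logHom c.weaklyToric (c := fun z => C z (toGrp q) +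
        a' (d.φ.symm (i (c.φ z))) - a z) (((hC _).continuousAt.add
          (ha'.continuousAt.tendsto.comp hcont)).sub ha.continuousAt) ?_
      filter_upwards [hpa, hcont.eventually hqa, hφ, hnear] with z e₁ e₂ e₃ e₄ hz
      obtain ⟨e₅, e₆⟩ := e₃ hz
      rw [d.φ.right_inv e₄, e₁, ← exp_logHom hz, ← exp_logHom e₅, ← Real.exp_add, ← Real.exp_add,
        Real.exp_injective.eq_iff, e₆] at e₂
      rw [map_sub]
      linarith
    rw [h1, ← Int.natCast_dvd_natCast, hβ']
    refine dvd_add ?_ (dvd_mul_right _ _)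
    have h3 := hβ0 _ h2
    rw [map_sub, sub_eq_zero] at h3
    rw [h3]
    exact hβK _ (le_sup_left (a := φ.range) ⟨_, rfl⟩)
  -- The image of `α` is divisible by `j`, so `η` is a `j`-torsion class in the quotient.
  -- Torsion-freeness puts it in the group of the image, injectivity makes `α` divisible by `j` in
  -- the group of `M̃`, and this contradicts the choice of `β`.
  let η : dualMonoid (T.pulledGerms S i hsm.1 (c.φ w)) := ⟨
    { toFun := fun s => α.1 (Additive.ofMul (T.interiorPullback S i hsm.1 (c.φ w) s.toMul)) / j
      map_zero' := by rw [toMul_zero, map_one, ofMul_one, map_zero, Nat.zero_div]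
      map_add' := fun s t => by
        rw [toMul_add, map_mul, ofMul_mul, map_add, Nat.add_div_of_dvd_right (hdvd s.toMul)] },
    fun s hs => by
      have h0 : α.1 (Additive.ofMul (T.interiorPullback S i hsm.1 (c.φ w) s)) = 0 :=
        (T.mTildeMap S i hsm.1 (c.φ w) α).2 s hs
      change α.1 (Additive.ofMul (T.interiorPullback S i hsm.1 (c.φ w) s)) / j = 0
      rw [h0, Nat.zero_div]⟩
  have hjη : j • η = T.mTildeMap S i hsm.1 (c.φ w) α :=
    Subtype.ext (AddMonoidHom.ext fun s => Nat.mul_div_cancel' (hdvd s.toMul))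
  obtain ⟨_, ⟨γ₁, rfl⟩, _, ⟨γ₂, rfl⟩, h1⟩ :=
    (isTorsionFreeMonoid_quotient_iff dualMonoid_cancel _).1 htf j hj η 0
      ⟨_, ⟨0, rfl⟩, _, ⟨α, rfl⟩, by rw [map_zero, add_zero, smul_zero, zero_add, hjη]⟩
  have h2 : α + j • γ₁ = j • γ₂ := hinj (by
    rw [map_add, map_nsmul, map_nsmul, ← hjη, ← smul_add, h1, zero_add])
  have h3 : ∀ p, (j : ℤ) ∣ β (toGrp p) := fun p => by
    have h4 : β' p + j * γ₁.1 (Additive.ofMul (germLam hc hw p)) =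
        j * γ₂.1 (Additive.ofMul (germLam hc hw p)) := by
      rw [← germHom_germLam hc hw β' hβ'0 p]
      exact DFunLike.congr_fun (congrArg Subtype.val h2) (Additive.ofMul (germLam hc hw p))
    have h5 : j ∣ β' p := (Nat.dvd_add_left (dvd_mul_right _ _)).1 (h4 ▸ dvd_mul_right _ _)
    rw [← Int.natCast_dvd_natCast, hβ'] at h5
    exact (Int.dvd_add_left (dvd_mul_right _ _)).1 h5
  obtain ⟨p, q, rfl⟩ := exists_eq_toGrp_sub g₀
  exact hg₀ (by rw [map_sub]; exact dvd_sub (h3 p) (h3 q))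

end GCornersStructure

/-! ### Derivatives along the flow and tangent vectors of strata -/

namespace ModelSpace

variable {k : ℕ} {P : AddSubmonoid (Fin k → ℤ)} {u : ModelSpace P} {f g : ModelSpace P → ℝ}

theorem SmoothAt.hasDerivAt_flow (hf : SmoothAt f u) (δ : Grp P →+ ℝ) (hP : P.FG) :
    HasDerivAt (fun s : ℝ => f (flow (s • δ) u)) (bder f u δ) 0 := by
  obtain ⟨N, r, hr⟩ := exists_generates hP
  obtain ⟨C, hC, h⟩ := hf.exists_eq_comp_lamv hr
  rw [bder_eq_fderiv hC h]
  exact hasDerivAt_comp_lamv_flow hC h δ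

theorem bder_congr (h : ∀ᶠ z in 𝓝 u, f z = g z) (δ : Grp P →+ ℝ) : bder f u δ = bder g u δ :=
  Filter.EventuallyEq.deriv_eq ((tendsto_flow u δ).eventually h)

theorem bder_lam (p : P) (δ : Grp P →+ ℝ) : bder (lam p) u δ = lam p u * δ (toGrp p) :=
  (hasDerivAt_lam_flow p u δ).deriv

theorem bder_add (hP : P.FG) (hf : SmoothAt f u) (hg : SmoothAt g u) (δ : Grp P →+ ℝ) :
    bder (fun z => f z + g z) u δ = bder f u δ + bder g u δ :=
  ((hf.hasDerivAt_flow δ hP).add (hg.hasDerivAt_flow δ hP)).deriv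

theorem bder_sub (hP : P.FG) (hf : SmoothAt f u) (hg : SmoothAt g u) (δ : Grp P →+ ℝ) :
    bder (fun z => f z - g z) u δ = bder f u δ - bder g u δ :=
  ((hf.hasDerivAt_flow δ hP).sub (hg.hasDerivAt_flow δ hP)).deriv

theorem bder_mul (hP : P.FG) (hf : SmoothAt f u) (hg : SmoothAt g u) (δ : Grp P →+ ℝ) :
    bder (fun z => f z * g z) u δ = bder f u δ * g u + f u * bder g u δ := by
  have h := ((hf.hasDerivAt_flow δ hP).mul (hg.hasDerivAt_flow δ hP)).deriv
  rwa [zero_smul, flow_zero] at h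

theorem bder_const_mul (t : ℝ) (δ : Grp P →+ ℝ) :
    bder (fun z => t * f z) u δ = t * bder f u δ := deriv_const_mul_field t

theorem bder_log (hP : P.FG) (hf : SmoothAt f u) (h0 : f u ≠ 0) (δ : Grp P →+ ℝ) :
    bder (fun z => Real.log (f z)) u δ = bder f u δ / f u := by
  have h0' : f (flow ((0 : ℝ) • δ) u) ≠ 0 := by rwa [zero_smul, flow_zero]
  have h := ((hf.hasDerivAt_flow δ hP).log h0').deriv
  rwa [zero_smul, flow_zero] at h

theorem supp_flow (δ : Grp P →+ ℝ) (u : ModelSpace P) : supp (flow δ u) = supp u := by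
  ext a
  refine exists_congr fun p => and_congr_right fun _ => ?_
  rw [lam_flow]
  exact mul_ne_zero_iff_left (Real.exp_pos _).ne'

/-- The logarithm of a monomial with exponent in the group of the support is smooth. -/
theorem exists_smoothAt_logHom (hP : P.FG) {e : Grp P} (he : e ∈ faceGroup u) :
    ∃ c : ModelSpace P → ℝ, SmoothAt c u ∧ (∀ z ∈ interior P, logHom z e = c z) ∧
      ∀ δ, bder c u δ = δ e := by
  obtain ⟨f, f', hf, hf', rfl⟩ := mem_faceGroup.1 he
  refine ⟨fun z => Real.log (lam f z) - Real.log (lam f' z),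
    ((smoothAt_lam f u).log hf).sub ((smoothAt_lam f' u).log hf'), fun z hz => ?_, fun δ => ?_⟩
  · rw [map_sub, logHom_toGrp hz, logHom_toGrp hz]
  · rw [bder_sub hP ((smoothAt_lam f u).log hf) ((smoothAt_lam f' u).log hf'),
      bder_log hP (smoothAt_lam f u) hf, bder_log hP (smoothAt_lam f' u) hf', bder_lam, bder_lam,
      mul_div_cancel_left₀ _ hf, mul_div_cancel_left₀ _ hf', map_sub]

end ModelSpace

/-- Sections modulo a saturated subgroup. -/
theorem exists_section_mod {G L : Type} [AddCommGroup G] [AddCommGroup L] {n : ℕ}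
    (b : Module.Basis (Fin n) ℤ G) {F : AddSubgroup G}
    (hF : ∀ (m : ℕ) (g : G), 0 < m → m • g ∈ F → g ∈ F) (φ : L →+ G)
    (hφ : ∀ g, ∃ ℓ, g - φ ℓ ∈ F) :
    ∃ ψ : G →+ L, (∀ g ∈ F, ψ g = 0) ∧ ∀ g, g - φ (ψ g) ∈ F := by
  obtain ⟨a, π, σ, hσ, hπ, hsub⟩ := exists_basis_quotient b F hF
  choose ℓ hℓ using fun μ => hφ (σ μ)
  refine ⟨
    { toFun := fun g => ∑ μ, π g μ • ℓ μ
      map_zero' := by simp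
      map_add' := fun g h => by simp [add_smul, Finset.sum_add_distrib] }, fun g hg => ?_,
    fun g => ?_⟩
  · change ∑ μ, π g μ • ℓ μ = 0
    rw [(hπ g).2 hg]
    simp
  · change g - φ (∑ μ, π g μ • ℓ μ) ∈ F
    have h : g - φ (∑ μ, π g μ • ℓ μ) =
        (g - ∑ μ, π g μ • σ μ) + ∑ μ, π g μ • (σ μ - φ (ℓ μ)) := by
      simp only [map_sum, map_zsmul, smul_sub, Finset.sum_sub_distrib]
      abel
    rw [h]
    exact F.add_mem (hsub g) (F.sum_mem fun μ _ => F.zsmul_mem (hℓ μ) _)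

namespace GCornersStructure

variable {m n : ℕ} {X Y : Type*} [TopologicalSpace X] [TopologicalSpace Y]
  {S : GCornersStructure n Y} {T : GCornersStructure m X} {i : X → Y} {c : GChart m X}
  {w : ModelSpace c.P}

/-- The derivation at `w` along the flow of `δ`. -/
def flowDerivation (hw : w ∈ c.φ.source) (hc : c ∈ T.charts) (δ : Grp c.P →+ ℝ) :
    T.smoothGerms (c.φ w) →ₗ[ℝ] ℝ :=
  have key : ∀ (a : T.smoothGerms (c.φ w)) (f : X → ℝ), (f : Germ (𝓝 (c.φ w)) ℝ) = a →
      bder (fun z => a.2.choose (c.φ z)) w δ = bder (fun z => f (c.φ z)) w δ := fun a f hf =>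
    bder_congr ((germ_eq_iff hw).1 (a.2.choose_spec.2.trans hf.symm)) δ
  { toFun := fun a => bder (fun z => a.2.choose (c.φ z)) w δ
    map_add' := fun a b => by
      rw [key (a + b) (a.2.choose + b.2.choose) (by
        rw [Germ.coe_add, a.2.choose_spec.2, b.2.choose_spec.2]; rfl)]
      exact bder_add c.weaklyToric.1 (a.2.choose_spec.1 c hc w hw rfl)
        (b.2.choose_spec.1 c hc w hw rfl) δ
    map_smul' := fun t a => by
      rw [key (t • a) (t • a.2.choose) (by rw [Germ.coe_smul, a.2.choose_spec.2]; rfl)]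
      exact bder_const_mul t δ }

theorem flowDerivation_apply (hw : w ∈ c.φ.source) (hc : c ∈ T.charts) (δ : Grp c.P →+ ℝ)
    {a : X → ℝ} (ha : T.SmoothAt a (c.φ w)) :
    flowDerivation hw hc δ (T.smoothGerm a ha) = bder (fun z => a (c.φ z)) w δ :=
  bder_congr ((germ_eq_iff hw).1 (T.smoothGerm a ha).2.choose_spec.2) δ

theorem isDerivation_flowDerivation (hw : w ∈ c.φ.source) (hc : c ∈ T.charts)
    (δ : Grp c.P →+ ℝ) : T.IsDerivation (c.φ w) (flowDerivation hw hc δ) := by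
  rintro ⟨_, a, ha, rfl⟩ ⟨_, b, hb, rfl⟩
  have h1 := flowDerivation_apply hw hc δ (ha.mul hb)
  have h2 := flowDerivation_apply hw hc δ ha
  have h3 := flowDerivation_apply hw hc δ hb
  rw [bder_mul c.weaklyToric.1 (ha c hc w hw rfl) (hb c hc w hw rfl), ← h2, ← h3] at h1
  exact h1

/-- The flow multiplies each `λ_p` by a positive number, so it preserves supports and does not leave
the stratum. These tangent vectors are the ones on which the injectivity of the differential is
tested. -/
theorem flowDerivation_mem (hw : w ∈ c.φ.source) (hc : c ∈ T.charts) (δ : Grp c.P →+ ℝ) {k : ℕ}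
    (hk : c.φ w ∈ T.stratum k) : flowDerivation hw hc δ ∈ T.stratumTangentSpace k (c.φ w) := by
  refine ⟨isDerivation_flowDerivation hw hc δ, fun a ha h => ?_⟩
  refine (flowDerivation_apply hw hc δ ha).trans ?_
  have h0 : ∀ᶠ s in 𝓝 (0 : ℝ), a (c.φ (flow (s • δ) w)) = 0 := by
    filter_upwards [(tendsto_flow w δ).eventually (eventually_chart hw h),
      (tendsto_flow w δ).eventually (c.φ.open_source.mem_nhds hw)] with s h1 h2
    refine h1 ((mem_stratum_iff hc h2).2 ?_)
    rw [supp_flow]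
    exact (mem_stratum_iff hc hw).1 hk
  exact (Filter.EventuallyEq.deriv_eq (f := fun _ => (0 : ℝ)) h0).trans (deriv_const _ _)

theorem IsDerivation.eq_zero_of_mem_target {d : GChart n Y} (hd : d ∈ S.charts) {y : Y}
    (hy : y ∈ d.φ.target) {v : S.smoothGerms y →ₗ[ℝ] ℝ} (hv : S.IsDerivation y v) {N : ℕ}
    {r : Fin N → d.P} (hr : Generates r)
    (h : ∀ (j : Fin N) (hs : S.SmoothAt (fun y => lam (r j) (d.φ.symm y)) y),
      v (S.smoothGerm _ hs) = 0) : v = 0 := by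
  obtain ⟨u, hu, rfl⟩ : ∃ u ∈ d.φ.source, d.φ u = y := ⟨_, d.φ.map_target hy, d.φ.right_inv hy⟩
  exact hv.eq_zero hd hu hr fun j => h j _

theorem IsDerivation.comp_smoothPullback (hi : T.IsSmoothMap S i) {x : X}
    {v : T.smoothGerms x →ₗ[ℝ] ℝ} (hv : T.IsDerivation x v) :
    S.IsDerivation (i x) (v.comp (T.smoothPullback S i hi x)) := by
  rintro ⟨_, a, ha, rfl⟩ ⟨_, b, hb, rfl⟩
  exact hv (T.smoothGerm _ (ha.comp_map hi)) (T.smoothGerm _ (hb.comp_map hi))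

end GCornersStructure

/-! ### Charts of an embedded structure are admissible -/

namespace GCornersStructure

variable {m n : ℕ} {X Y : Type*} [TopologicalSpace X] [TopologicalSpace Y]
  {S : GCornersStructure n Y} {T : GCornersStructure m X} {i : X → Y} {c : GChart m X}
  {w : ModelSpace c.P} {d : GChart n Y}

theorem PullsBack.interiorAt_lam (hpb : S.PullsBack i c) (hw : w ∈ c.φ.source) (hd : d ∈ S.charts)
    (hx : i (c.φ w) ∈ d.φ.target) (q : d.P) :
    ModelSpace.InteriorAt (fun z => lam q (d.φ.symm (i (c.φ z)))) w := by
  refine hpb w hw (fun y => lam q (d.φ.symm y)) ?_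
  have := interiorAt_lam_symm hd (d.φ.map_target hx) q
  rwa [d.φ.right_inv hx] at this

/-- For an immersion, a functional along which the pulled back units are constant vanishes on the
support. -/
theorem IsImmersion.eq_zero_of_bder_log (hi : T.IsImmersion S i) (hpb : S.PullsBack i c)
    (hc : c ∈ T.charts) (hw : w ∈ c.φ.source) (hd : d ∈ S.charts) (hx : i (c.φ w) ∈ d.φ.target)
    {N : ℕ} {t : Fin N → d.P} (ht : Generates t) {δ : Grp c.P →+ ℝ}
    (hδ : ∀ s, lam (t s) (d.φ.symm (i (c.φ w))) ≠ 0 →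
      bder (fun z => Real.log (lam (t s) (d.φ.symm (i (c.φ z))))) w δ = 0)
    {f : c.P} (hf : lam f w ≠ 0) : δ (toGrp f) = 0 := by
  obtain ⟨hsm, himm⟩ := hi
  have hk : c.φ w ∈ T.stratum (Module.finrank ℝ (T.normalSpace (c.φ w))) :=
    (mem_stratum_iff hc hw).2 (rank_supp_add_finrank_normalSpace hc hw)
  have hP := c.weaklyToric.1
  have h0 : (flowDerivation hw hc δ).comp (T.smoothPullback S i hsm (c.φ w)) = 0 := by
    refine ((isDerivation_flowDerivation hw hc δ).comp_smoothPullback hsm).eq_zero_of_mem_target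
      hd hx ht fun s hs => ?_
    refine (flowDerivation_apply hw hc δ (hs.comp_map hsm)).trans ?_
    have hint := hpb.interiorAt_lam hw hd hx (t s)
    -- If the ambient coordinate vanishes, its pullback is `λ_p · exp a` with `λ_p` zero at `w`, and
    -- the derivative along the flow is zero for every `δ`.
    by_cases hts : lam (t s) (d.φ.symm (i (c.φ w))) = 0
    · obtain ⟨p, a, ha, hpa⟩ := hint.exists_logHom
      have hp : lam p w = 0 := by
        have := hpa.self_of_nhds
        rw [hts] at this
        exact (mul_eq_zero.1 this.symm).resolve_right (Real.exp_pos _).ne'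
      rw [bder_congr hpa, bder_mul hP (smoothAt_lam p w) ha.exp, bder_lam, hp]
      ring
    · have h1 := bder_log hP hint.smoothAt hts δ
      rw [hδ s hts, eq_comm, div_eq_zero_iff] at h1
      exact h1.resolve_right hts
  have h1 := (himm (c.φ w)).1 _ hk (flowDerivation_mem hw hc δ hk) (Submodule.zero_mem _)
    (h0.trans (LinearMap.zero_comp _).symm)
  have h2 := flowDerivation_apply hw hc δ (interiorAt_lam_symm hc hw f).smoothAt
  rw [h1, LinearMap.zero_apply, bder_congr (g := lam f) (by
    filter_upwards [c.φ.open_source.mem_nhds hw] with z hz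
    rw [c.φ.left_inv hz]), bder_lam] at h2
  exact (mul_eq_zero.1 h2.symm).resolve_left hf

/-- The coordinates of an embedded chart, expressed through quotients of ambient interior maps and
ambient smooth functions. -/
theorem IsImmersion.exists_eq_quotient_mul_exp (hi : T.IsImmersion S i)
    (hdense : ∀ x, ∃ᶠ z in 𝓝 x, i z ∈ S.interior) (hc : c ∈ T.charts) (hw : w ∈ c.φ.source)
    (hd : d ∈ S.charts) (hx : i (c.φ w) ∈ d.φ.target) {N M : ℕ} {r : Fin N → c.P}
    (hr : Generates r) {t : Fin M → d.P} (ht : Generates t) :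
    ∃ (E : c.P → ModelSpace c.P → ℝ) (Θ : (Fin N → ℝ) × (Fin m ⊕ Fin M → ℝ) → (Grp c.P →+ ℝ)),
      (∀ p, ∀ᶠ z in 𝓝 w, ContinuousAt (E p) z) ∧
      (∀ p, ∃ q₁ q₂ : d.P, ∀ᶠ z in 𝓝 w,
        E p z * lam q₂ (d.φ.symm (i (c.φ z))) = lam q₁ (d.φ.symm (i (c.φ z)))) ∧
      (∀ g, ContDiff ℝ ∞ fun v => Θ v g) ∧
      ∀ᶠ z in 𝓝 w, ∀ p, lam p z = E p z * Real.exp (Θ (fun j => E (r j) z,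
        Sum.elim (fun _ => 0) fun s => Real.log
          (lam (faceGen t (d.φ.symm (i (c.φ w))) s) (d.φ.symm (i (c.φ z))))) (toGrp p)) := by
  have hpb := hi.choose.pullsBack hdense hc
  set F : ModelSpace c.P → ModelSpace d.P := fun z => d.φ.symm (i (c.φ z)) with hF
  have hFi : ∀ q, ModelSpace.InteriorAt (fun z => lam q (F z)) w := hpb.interiorAt_lam hw hd hx
  obtain ⟨φ, C, hC, hφ⟩ := exists_logHom_comp_eq d.weaklyToric.1 hFi
  have hsurj := hi.exists_sub_mem_faceGroup hdense hc hw hd hx hC hφ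
  obtain ⟨b⟩ := nonempty_basis_grp c.rank_eq
  have hP := c.weaklyToric
  have hsat := fun (j : ℕ) (g : Grp c.P) => mem_faceGroup_of_nsmul (w := w) hP (j := j) (g := g)
  obtain ⟨ψ, hψ0, hψ⟩ := exists_section_mod b hsat φ hsurj
  choose a ha hal hab using fun j => exists_smoothAt_logHom hP.1 (hψ (b j))
  -- the correction `κ`, equal to `log z - log F(z) ∘ ψ` on the interior
  let κ : ModelSpace c.P → (Grp c.P →+ ℝ) := fun z =>
    homEquiv b fun j => a j z - C z (ψ (b j))
  have hκs : ∀ g, ModelSpace.SmoothAt (fun z => κ z g) w := fun g => by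
    simp only [κ, homEquiv_apply]
    exact SmoothAt.sum _ fun j _ => (smoothAt_const _ _).mul ((ha j).sub (hC _))
  have hκ : ∀ᶠ z in 𝓝 w, z ∈ ModelSpace.interior c.P →
      ∀ g, κ z g = logHom z g - logHom (F z) (ψ g) := by
    filter_upwards [hφ] with z hz hzi
    have h1 : (κ z).toIntLinearMap = (logHom z - (logHom (F z)).comp ψ).toIntLinearMap := by
      refine b.ext fun j => ?_
      change κ z (b j) = logHom z (b j) - logHom (F z) (ψ (b j))
      rw [← homEquiv_symm_apply, LinearEquiv.symm_apply_apply, ← hal j z hzi, (hz hzi).2, map_sub]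
      ring
    exact LinearMap.congr_fun h1
  -- smooth data
  let f : Fin M → d.P := faceGen t (F w)
  have hf0 : ∀ s, lam (f s) (F w) ≠ 0 := lam_faceGen_ne_zero t (F w)
  have hfs : ∀ s, ModelSpace.SmoothAt (fun z => Real.log (lam (f s) (F z))) w := fun s =>
    (hFi (f s)).smoothAt.log (hf0 s)
  choose A hA hAe using fun j => (hC (ψ (b j))).exists_eq_comp_lamv hr
  choose B hB hBe using fun s => (hC (toGrp (f s))).exists_eq_comp_lamv hr
  have hφf : ∀ s, φ (toGrp (f s)) ∈ faceGroup w := fun s => by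
    refine mem_faceGroup_of_logHom hP ((hfs s).sub (hC (toGrp (f s)))).continuousAt ?_
    filter_upwards [hφ] with z hz hzi
    rw [← logHom_toGrp (hz hzi).1, (hz hzi).2]
    ring
  -- The equations are `κ(φ ψ b_j) = -C(ψ b_j)` and `κ(φ f_s) = log λ_{f_s}(F) - C(f_s)`, where the
  -- right-hand `C` depend on `λ_r = E_r · exp κ(r)`. There are `m + M` equations for `m` unknowns,
  -- so only the uniqueness half of the implicit function theorem is used.
  let D : Fin m ⊕ Fin M → Grp c.P := Sum.elim (fun j => φ (ψ (b j))) fun s => φ (toGrp (f s))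
  let H : Fin m ⊕ Fin M → (Fin N → ℝ) → ℝ := Sum.elim A B
  have hH : ∀ μ, ContDiff ℝ ∞ (H μ) := by
    rintro (j | s)
    exacts [hA j, hB s]
  let τ : ModelSpace c.P → Fin m ⊕ Fin M → ℝ := fun z =>
    Sum.elim (fun _ => 0) fun s => Real.log (lam (f s) (F z))
  have hτ : ∀ μ, ModelSpace.SmoothAt (fun z => τ z μ) w := by
    rintro (j | s)
    exacts [smoothAt_const 0 w, hfs s]
  let E : c.P → ModelSpace c.P → ℝ := fun p z => lam p z * Real.exp (-κ z (toGrp p))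
  have hEs : ∀ p, ModelSpace.SmoothAt (E p) w := fun p => (smoothAt_lam p w).mul (hκs _).neg.exp
  have hEκ : ∀ p z, E p z * Real.exp (κ z (toGrp p)) = lam p z := fun p z => by
    rw [mul_assoc, ← Real.exp_add, neg_add_cancel, Real.exp_zero, mul_one]
  have hEr : ∀ z, (fun j => E (r j) z * Real.exp (κ z (toGrp (r j)))) = lamv r z := fun z =>
    funext fun j => hEκ (r j) z
  -- `g - φ (ψ g)` lies in the group of units, which `ψ` kills.
  have hψφψ : ∀ g, ψ (φ (ψ g)) = ψ g := fun g => by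
    have := hψ0 _ (hψ g)
    rw [map_sub, sub_eq_zero] at this
    exact this.symm
  have heq : ∀ μ, ∀ᶠ z in 𝓝 w, κ z (D μ) + H μ (lamv r z) = τ z μ := by
    intro μ
    have hs : ModelSpace.SmoothAt (fun z => κ z (D μ) + H μ (lamv r z)) w :=
      (hκs _).add (SmoothAt.of_comp_lamv (hH μ) (Eventually.of_forall fun _ => rfl))
    refine eventuallyEq_of_interior hP hs.eventually_continuousAt (hτ μ).eventually_continuousAt ?_
    rcases μ with j | s
    · filter_upwards [hφ, hκ, hAe j] with z h1 h2 h3 hz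
      change κ z (φ (ψ (b j))) + A j (lamv r z) = 0
      rw [← h3, h2 hz, hψφψ, (h1 hz).2]
      ring
    · filter_upwards [hφ, hκ, hBe s] with z h1 h2 h3 hz
      change κ z (φ (toGrp (f s))) + B s (lamv r z) = Real.log (lam (f s) (F z))
      rw [← h3, h2 hz, hψ0 _ (hφf s), map_zero, sub_zero, ← logHom_toGrp (h1 hz).1, (h1 hz).2]
  obtain ⟨Θ, hΘ, -, hΘu, -⟩ := exists_implicit_hom b (fun j => toGrp (r j)) D H hH
    (fun j => E (r j) w) (τ w) (κ w) (fun μ => by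
      rw [hEr]
      exact (heq μ).self_of_nhds) (fun δ hδ => by
      have hz : (fun j => E (r j) w * Real.exp (κ w (toGrp (r j))) * δ (toGrp (r j))) =
          fun j => lam (r j) w * δ (toGrp (r j)) :=
        funext fun j => by rw [hEκ]
      rw [hEr, hz] at hδ
      -- By the second family of equations the pulled-back units are constant to first order along
      -- `δ`, so the condition on strata makes `δ` vanish on the support of `w`. The first family
      -- then gives `δ(b_j) = 0`, since `b_j` and `φ ψ b_j` differ by units.
      have hδf : ∀ p, lam p w ≠ 0 → δ (toGrp p) = 0 := fun p hp => by
        refine hi.eq_zero_of_bder_log hpb hc hw hd hx ht (fun s hs => ?_) hp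
        have hts : t s = f s := by simp only [f, faceGen]; rw [if_neg hs]
        obtain ⟨a', ha', hal', hab'⟩ := exists_smoothAt_logHom hP.1 (hφf s)
        have h1 : ∀ᶠ z in 𝓝 w, Real.log (lam (f s) (F z)) = a' z + C z (toGrp (f s)) := by
          refine eventuallyEq_of_interior hP (hfs s).eventually_continuousAt
            (ha'.add (hC _)).eventually_continuousAt ?_
          filter_upwards [hφ] with z h1 hz
          rw [← logHom_toGrp (h1 hz).1, (h1 hz).2, hal' z hz]
        rw [hts]
        refine (bder_congr h1 δ).trans ?_
        rw [bder_add hP.1 ha' (hC _), hab', bder_eq_fderiv (hB s) (hBe s)]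
        exact hδ (Sum.inr s)
      have hδF : ∀ g ∈ faceGroup w, δ g = 0 := fun g hg => by
        obtain ⟨p, p', hp, hp', rfl⟩ := mem_faceGroup.1 hg
        rw [map_sub, hδf p hp, hδf p' hp', sub_zero]
      have h1 : δ.toIntLinearMap = 0 := b.ext fun j => by
        have h2 := hδ (Sum.inl j)
        have h3 : fderivDual r (A j) w δ = 0 := fderivDual_eq_zero hr _ fun s =>
          hδf _ (lam_faceGen_ne_zero r w s)
        have h4 : δ (φ (ψ (b j))) + fderivDual r (A j) w δ = 0 := h2
        have h5 := hδF _ (hψ (b j))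
        rw [map_sub] at h5
        change δ (b j) = 0
        linarith
      exact AddMonoidHom.ext fun g => LinearMap.congr_fun h1 g)
  have hκΘ : ∀ᶠ z in 𝓝 w, κ z = Θ (fun j => E (r j) z, τ z) :=
    hΘu (z := fun z j => E (r j) z) (tendsto_pi_nhds.2 fun j => (hEs (r j)).continuousAt)
      (tendsto_pi_nhds.2 fun μ => (hτ μ).continuousAt) (fun g => (hκs g).continuousAt) (by
        filter_upwards [eventually_all.2 heq] with z hz μ
        rw [hEr]
        exact hz μ)
  refine ⟨E, Θ, fun p => (hEs p).eventually_continuousAt, fun p => ?_, hΘ, ?_⟩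
  · obtain ⟨q₁, q₂, hq⟩ := exists_eq_toGrp_sub (ψ (toGrp p))
    refine ⟨q₁, q₂, eventuallyEq_of_interior hP
      ((hEs p).mul (hFi q₂).smoothAt).eventually_continuousAt
      (hFi q₁).smoothAt.eventually_continuousAt ?_⟩
    filter_upwards [hφ, hκ] with z h1 h2 hz
    change lam p z * Real.exp (-κ z (toGrp p)) * lam q₂ (F z) = lam q₁ (F z)
    rw [h2 hz, hq, ← exp_logHom hz, ← exp_logHom (h1 hz).1, ← exp_logHom (h1 hz).1, ← Real.exp_add,
      ← Real.exp_add, map_sub]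
    congr 1
    ring
  · filter_upwards [hκΘ] with z hz p
    rw [← hEκ p z]
    congr 2
    exact DFunLike.congr_fun hz (toGrp p)

/-- The charts of an embedded manifold are determined by the ambient manifold. -/
theorem IsImmersion.isAdmissible (hi : T.IsImmersion S i)
    (hdense : ∀ x, ∃ᶠ z in 𝓝 x, i z ∈ S.interior) (hc : c ∈ T.charts) : S.IsAdmissible i c := by
  refine ⟨hi.choose.pullsBack hdense hc, fun w hw p => ?_⟩
  obtain ⟨d, hd, hx⟩ := S.cover (i (c.φ w))
  obtain ⟨N, r, hr⟩ := exists_generates c.weaklyToric.1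
  obtain ⟨M, t, ht⟩ := exists_generates d.weaklyToric.1
  obtain ⟨E, Θ, hEc, hEq, hΘ, h⟩ := hi.exists_eq_quotient_mul_exp hdense hc hw hd hx hr ht
  have hcont : Continuous i := hi.choose.1
  have hlam : ∀ q, S.InteriorAt (fun y => lam q (d.φ.symm y)) (i (c.φ w)) := fun q => by
    have := interiorAt_lam_symm hd (d.φ.map_target hx) q
    rwa [d.φ.right_inv hx] at this
  have hE : ∀ p, S.IsUniversallyInteriorAt m i (fun y => E p (c.φ.symm y)) (c.φ w) := by
    intro p
    obtain ⟨q₁, q₂, hq⟩ := hEq p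
    refine IsQuotientAt.isUniversallyInteriorAt ⟨_, _, hlam q₁, hlam q₂, ?_⟩ ?_
    · rw [← c.φ.map_nhds_eq hw, eventually_map]
      filter_upwards [hq, c.φ.open_source.mem_nhds hw] with z hz hz'
      rw [c.φ.left_inv hz', hz]
    · rw [← c.φ.map_nhds_eq hw, eventually_map]
      filter_upwards [hEc p, c.φ.open_source.mem_nhds hw] with z hz hz'
      refine ContinuousAt.comp (g := E p) ?_ (c.φ.continuousAt_symm (c.φ.map_source hz'))
      rwa [c.φ.left_inv hz']
  intro c' hc' w' hw' hww
  have htr := GChart.tendsto_transition hw hw' hww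
  have hτ : ∀ μ, ModelSpace.SmoothAt (fun ζ => Sum.elim (fun _ : Fin m => (0 : ℝ)) (fun s => Real.log
      (lam (faceGen t (d.φ.symm (i (c.φ w))) s) (d.φ.symm (i (c'.φ ζ))))) μ) w' := by
    rintro (j | s)
    · exact smoothAt_const 0 w'
    · have hx' : i (c'.φ w') ∈ d.φ.target := by rwa [hww]
      refine (hc'.interiorAt_lam hw' hd hx' _).smoothAt.log ?_
      rw [hww]
      exact lam_faceGen_ne_zero _ _ _
  refine ((hE p c' hc' w' hw' hww).mul (interiorAt_of_pos
    (ModelSpace.SmoothAt.exp (ModelSpace.SmoothAt.comp_prod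
    (f := fun j ζ => E (r j) (c.φ.symm (c'.φ ζ)))
    (fun j => (hE (r j) c' hc' w' hw' hww).smoothAt) hτ (hΘ (toGrp p)))) (Real.exp_pos _))).congr ?_
  filter_upwards [htr.eventually h, GChart.eventually_mem_target hw hw' hww] with ζ h1 h2
  rw [h1 p, c.φ.right_inv h2]

end GCornersStructure

/-! ### Existence and uniqueness of the structure on the closure -/

namespace GCornersStructure

variable {m n k l : ℕ} {Y : Type*} [TopologicalSpace Y] {S : GCornersStructure n Y}
  {f g : Fin k → Y → ℝ} {h : Fin l → Y → ℝ}

/-- Interior points are dense in the closure of the solution set. -/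
theorem frequently_mem_interior_of_closure (x : closure (solutionSet S f g h)) :
    ∃ᶠ z : closure (solutionSet S f g h) in 𝓝 x, (z : Y) ∈ S.interior := by
  rw [nhds_subtype, frequently_comap]
  refine (mem_closure_iff_frequently.1 x.2).mono fun y hy => ⟨⟨y, subset_closure hy⟩, rfl, hy.1⟩

theorem existsUnique_structure (hf : ∀ i, S.IsInterior (f i)) (hg : ∀ i, S.IsInterior (g i))
    (hh : ∀ j, S.IsSmooth (h j)) (hm : m + k + l = n)
    (hind : ∀ x ∈ closure (solutionSet S f g h),
      LinearIndependent ℝ (Sum.elim (fun i => S.bd (f i) (hf i) x - S.bd (g i) (hg i) x)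
        (fun j => S.d (h j) (hh j) x))) :
    ∃! T : GCornersStructure m (closure (solutionSet S f g h)),
      T.IsEmbedding S (Subtype.val : closure (solutionSet S f g h) → Y) := by
  have hex := fun x : closure (solutionSet S f g h) =>
    exists_solution_chart hf hg hh hm x (hind x x.2)
  have := S.t2
  have := S.secondCountable
  obtain ⟨T, hT⟩ := exists_structure (S := S) (m := m)
    (i := (Subtype.val : closure (solutionSet S f g h) → Y)) inferInstance inferInstance fun x => by
      obtain ⟨e, w, hw, rfl, hpb, hq, -⟩ := hex x
      exact ⟨e, IsQuotientAt.isAdmissible hpb hq, e.φ.map_source hw⟩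
  have hi : T.IsImmersion S Subtype.val := isImmersion_of_charts continuous_subtype_val fun x => by
    obtain ⟨e, w, hw, hwx, hpb, hq, hc⟩ := hex x
    exact ⟨e, hT e (IsQuotientAt.isAdmissible hpb hq), w, hw, hwx, hpb, hwx ▸ hq w hw, hc⟩
  refine ⟨T, ⟨hi, Topology.IsEmbedding.subtypeVal⟩, fun T' hT' => ?_⟩
  exact eq_of_isAdmissible (S := S) (i := Subtype.val)
    (fun c hc => hT'.1.isAdmissible frequently_mem_interior_of_closure hc)
    fun c hc => hi.isAdmissible frequently_mem_interior_of_closure hc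

end GCornersStructure

end GCorners

end

theorem corollary4p17 {n k l : ℕ} {Y : Type*} [TopologicalSpace Y]
    (S : GCorners.GCornersStructure n Y)
    (f g : Fin k → Y → ℝ) (hf : ∀ i, S.IsInterior (f i)) (hg : ∀ i, S.IsInterior (g i))
    (h : Fin l → Y → ℝ) (hh : ∀ j, S.IsSmooth (h j))
    (hind : ∀ x ∈ closure (GCorners.solutionSet S f g h),
      LinearIndependent ℝ (Sum.elim (fun i => S.bd (f i) (hf i) x - S.bd (g i) (hg i) x)
        (fun j => S.d (h j) (hh j) x))) :
    ((closure (GCorners.solutionSet S f g h)).Nonempty → k + l ≤ n) ∧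
    ∀ m : ℕ, m + k + l = n →
      ∃! T : GCorners.GCornersStructure m (closure (GCorners.solutionSet S f g h)),
        T.IsEmbedding S (Subtype.val : closure (GCorners.solutionSet S f g h) → Y) :=
  ⟨fun ⟨x, hx⟩ => GCorners.GCornersStructure.add_le_of_linearIndependent (hind x hx),
    fun _ hm => GCorners.GCornersStructure.existsUnique_structure hf hg hh hm hind⟩
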